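/- **Setting.** Let $(X,*)$ be a quandle and $Y$ an $X$-set, i.e. a set with a right action, written $r*g$, of the associated group $G_X=\langle x\in X\mid x*y=y^{-1}xy\ (x,y\in X)\rangle$. The *symmetric double* of $X$ is the symmetric quandle $(D_X,\rho)$ with $D_X=X^{+1}\sqcup X^{-1}$, $x^{\varepsilon}\star y^{\delta}=(x*y^{\delta})^{\varepsilon}$ and $\rho(x^{\varepsilon})=x^{-\varepsilon}$; the set $Y$ is a $(D_X,\rho)$-set through the homomorphism $G_{(D_X,\rho)}\to G_X$, $x^{\varepsilon}\mapsto x^{\varepsilon}$. **Homology.** For $n\ge 1$ let $C_n(X)_Y$ be the free abelian group on $Y\times X^n$, with $$\partial_n(r,x_1,\dots,x_n)=\sum_{i=1}^n(-1)^i\{(r,x_1,\dots,\widehat{x_i},\dots,x_n)-(r*x_i,x_1*x_i,\dots,x_{i-1}*x_i,\widehat{x_i},x_{i+1},\dots,x_n)\}\quad(n\ge2).$$ Let $D_n(X)_Y$ be the subgroup generated by the tuples with $x_i=x_{i+1}$ for some $i$; for a symmetric quandle $(X,\rho)$ let $D_n(X,\rho)_Y$ be the subgroup generated by all $(r,x_1,\dots,x_n)+(r*x_i,x_1*x_i,\dots,x_{i-1}*x_i,\rho(x_i),x_{i+1},\dots,x_n)$.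 Put $C_n^{\rm Q}(X)_Y=C_n(X)_Y/D_n(X)_Y$ and $C_n^{\rm SQ}(X,\rho)_Y=C_n(X)_Y/(D_n(X)_Y+D_n(X,\rho)_Y)$; the homology groups are $H_n^{\rm Q}(X)_Y$ and $H_n^{\rm SQ}(X,\rho)_Y$. Modulo $D_n(D_X,\rho)_Y$, every tuple $(r,x_1^{\varepsilon_1},\dots,x_n^{\varepsilon_n})\in Y\times D_X^n$ is brought, by applying the generating relations successively at the entries $i=n,n-1,\dots,1$ of sign $-1$, to a canonical form $\delta(s,y_1^{+1},\dots,y_n^{+1})$, $\delta=\pm1$, and $T_n^{D_X\to X}:C_n^{\rm SQ}(D_X,\rho)_Y\to C_n^{\rm Q}(X)_Y$ sends the tuple to $\delta(s,y_1,\dots,y_n)$. This is a chain map; $(T_3^{D_X\to X})^*:H_3^{\rm SQ}(D_X,\rho)_Y\to H_3^{\rm Q}(X)_Y$ is the induced homomorphism $[z]\mapsto[T_3^{D_X\to X}(z)]$. **Diagrams and colorings.** A surface-link diagram $D$ is the image of a smoothly embedded closed surface $F\subset\mathbb R^4=\mathbb R^3\times\mathbb R$ under the projection to $\mathbb R^3$,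 which is generic (locally one sheet, a transverse double or triple point, or a branch point), with over/under information given by the height. *Sheets* are the components of $F$ cut along the lower double points, *semi-sheets* those of $F$ cut along all double points, *regions* the components of $\mathbb R^3\setminus D$. An orientation $o$ of $D$ (i.e. of $F$) gives normal orientations $n$ such that $(o_1,o_2,n)$ is right-handed. An *$X_Y$-coloring* of $(D,o)$ assigns elements of $X$ to sheets and of $Y$ to regions such that $x_1*x_3=x_2$ at a double curve whenever the normal orientation of the over-sheet (color $x_3$) points from the under-sheet colored $x_1$ to the one colored $x_2$, and $r_1*x=r_2$ whenever the normal orientation of a semi-sheet colored $x$ points from the region labeled $r_1$ to the one labeled $r_2$. For a symmetric quandle $(X,\rho)$ and an $(X,\rho)$-set $Y$, an *$(X,\rho)_Y$-coloring* of the unoriented diagram $D$ is an equivalence class of assignments of a normal orientation and an element of $X$ to every semi-sheet, and of an element of $Y$ to every region, such that: two over-semi-sheets at a double curve colored $x_1,x_2$ satisfy $x_1=x_2$ if their normal orientations are coherent and $x_1=\rho(x_2)$ otherwise; if the normal orientation of an over-semi-sheet colored $x_3$ points from the under-semi-sheet colored $x_1$ to that colored $x_2$, then $x_1*x_3=x_2$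 if the normal orientations of the latter two are coherent and $x_1*x_3=\rho(x_2)$ otherwise; and $r_1*x=r_2$ across semi-sheets as above. Two assignments are equivalent if they are related by basic inversions (reversing the normal orientation of a semi-sheet and replacing its color $x$ by $\rho(x)$). Every $(D_X,\rho)_Y$-coloring $C$ has a unique representative with all colors in $X^{+1}$, its *canonical form*; the orientation of $D$ determined by the normal orientations of the canonical form is the orientation *induced* by $C$. Write $C\sim_{\rm ori}C'$ if $C$ and $C'$ induce the same orientation, and $[C]_{\rm ori}$ for the class of $C$. **Weights.** The weight of a triple point of an $X_Y$-colored $(D,o)$ is $\varepsilon(r,x_1,x_2,x_3)$, where $r$ is the label of the region that all three normal orientations point from, $x_1,x_2,x_3$ are the colors of the bottom, middle and top sheets facing this region, and $\varepsilon=+1$ if the normal orientations of the top, middle and bottom sheets, in this order, form a right-handed triple, $\varepsilon=-1$ otherwise. For an $(X,\rho)_Y$-coloring of an unoriented diagram choose any one of the eight regions around the triple point, make the normal orientations of the three semi-sheets facing it point away from it by basic inversions, and define the weight in the same way. The sums $W^{X_Y}((D,o),C)\in C_3^{\rm Q}(X)_Y$ and $W^{(X,\rho)_Y}(D,C)\in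 C_3^{\rm SQ}(X,\rho)_Y$ of the weights of all triple points are 3-cycles. Define the multisets (with cardinal multiplicities) $$\mathcal W^{X_Y}(D,o)=\{[W^{X_Y}((D,o),C)]\in H_3^{\rm Q}(X)_Y\mid C\ \text{an}\ X_Y\text{-coloring of}\ (D,o)\},$$ $$\mathcal W^{(D_X,\rho)_Y}(D,[C]_{\rm ori})=\{[W^{(D_X,\rho)_Y}(D,C')]\in H_3^{\rm SQ}(D_X,\rho)_Y\mid C'\in[C]_{\rm ori}\}.$$ **Theorem.** Let $(D,o)$ be an oriented surface-link diagram and let $C$ be a $(D_X,\rho)_Y$-coloring of $D$ that induces the orientation $o$. Then $(T_3^{D_X\to X})^*$ is an isomorphism and, as multisets and for every choice of the specified regions at the triple points, $$(T_3^{D_X\to X})^*\big(\mathcal W^{(D_X,\rho)_Y}(D,[C]_{\rm ori})\big)=\mathcal W^{X_Y}(D,o).$$ -/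

import Mathlib

open scoped Quandles ContDiff

universe u v

/-! Quandles are Mathlib's `Quandle`; the right-handed operation `x * y` is `y ◃ x`, and
`x * y⁻¹` is `y ◃⁻¹ x`. -/

namespace SurfaceLink

/-! ### Associated groups and `X`-sets -/

/-- The relations `x * y = y⁻¹ x y`. -/
def assocRel (X : Type u) [Quandle X] : Set (FreeGroup X) :=
  {g | ∃ x y : X, g = (FreeGroup.of (y ◃ x))⁻¹ *
    ((FreeGroup.of y)⁻¹ * FreeGroup.of x * FreeGroup.of y)}

/-- The associated group `G_X`. -/
def AssocGroup (X : Type u) [Quandle X] : Type u := PresentedGroup (assocRel X)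

instance (X : Type u) [Quandle X] : Group (AssocGroup X) :=
  inferInstanceAs (Group (PresentedGroup (assocRel X)))

/-- The canonical map `X → G_X`. -/
def AssocGroup.of {X : Type u} [Quandle X] (x : X) : AssocGroup X :=
  PresentedGroup.of (rels := assocRel X) x

theorem AssocGroup.of_act {X : Type u} [Quandle X] (x y : X) :
    AssocGroup.of (y ◃ x) = (AssocGroup.of y)⁻¹ * AssocGroup.of x * AssocGroup.of y := by
  have h : PresentedGroup.mk (assocRel X) ((FreeGroup.of (y ◃ x))⁻¹ *
      ((FreeGroup.of y)⁻¹ * FreeGroup.of x * FreeGroup.of y)) = 1 :=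
    PresentedGroup.one_of_mem ⟨x, y, rfl⟩
  rw [map_mul, map_inv, inv_mul_eq_one, map_mul, map_mul, map_inv] at h
  exact h

/-- An `X`-set is a set `Y` with a right action of `G_X`, that is, an action of `G_Xᵐᵒᵖ`;
`xact r x` is `r * x`. -/
def xact {X : Type u} {Y : Type v} [Quandle X] [MulAction (AssocGroup X)ᵐᵒᵖ Y]
    (r : Y) (x : X) : Y := MulOpposite.op (AssocGroup.of x) • r

theorem xact_xact {X : Type u} {Y : Type v} [Quandle X] [MulAction (AssocGroup X)ᵐᵒᵖ Y]
    (r : Y) (x y : X) : xact (xact r x) y = xact (xact r y) (y ◃ x) := by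
  simp only [xact, smul_smul, ← MulOpposite.op_mul, AssocGroup.of_act]
  congr 2
  group

/-! ### Symmetric quandles -/

/-- A symmetric quandle: a quandle with a good involution `ρ`. -/
class SymmetricQuandle (X : Type u) extends Quandle X where
  ρ : X → X
  ρ_ρ : ∀ x, ρ (ρ x) = x
  ρ_act : ∀ x y : X, ρ (y ◃ x) = y ◃ ρ x
  act_ρ : ∀ x y : X, ρ y ◃ x = y ◃⁻¹ x

open SymmetricQuandle (ρ)

/-- The relations of `G_(X,ρ)`: those of `G_X` together with `ρ(x) = x⁻¹`. -/
def symAssocRel (X : Type u) [SymmetricQuandle X] : Set (FreeGroup X) :=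
  assocRel X ∪ {g | ∃ x : X, g = FreeGroup.of (ρ x) * FreeGroup.of x}

/-- The associated group `G_(X,ρ)` of a symmetric quandle. -/
def SymAssocGroup (X : Type u) [SymmetricQuandle X] : Type u := PresentedGroup (symAssocRel X)

instance (X : Type u) [SymmetricQuandle X] : Group (SymAssocGroup X) :=
  inferInstanceAs (Group (PresentedGroup (symAssocRel X)))

/-- The canonical map `X → G_(X,ρ)`. -/
def SymAssocGroup.of {X : Type u} [SymmetricQuandle X] (x : X) : SymAssocGroup X :=
  PresentedGroup.of (rels := symAssocRel X) x

theorem SymAssocGroup.of_act {X : Type u} [SymmetricQuandle X] (x y : X) :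
    SymAssocGroup.of (y ◃ x) =
      (SymAssocGroup.of y)⁻¹ * SymAssocGroup.of x * SymAssocGroup.of y := by
  have h : PresentedGroup.mk (symAssocRel X) ((FreeGroup.of (y ◃ x))⁻¹ *
      ((FreeGroup.of y)⁻¹ * FreeGroup.of x * FreeGroup.of y)) = 1 :=
    PresentedGroup.one_of_mem (Or.inl ⟨x, y, rfl⟩)
  rw [map_mul, map_inv, inv_mul_eq_one, map_mul, map_mul, map_inv] at h
  exact h

theorem SymAssocGroup.of_ρ_mul {X : Type u} [SymmetricQuandle X] (x : X) :
    SymAssocGroup.of (ρ x) * SymAssocGroup.of x = 1 :=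
  PresentedGroup.one_of_mem (rels := symAssocRel X) (Or.inr ⟨x, rfl⟩)

/-- The homomorphism `G_X → G_(X,ρ)` that is the identity on generators. -/
def assocToSym (X : Type u) [SymmetricQuandle X] : AssocGroup X →* SymAssocGroup X :=
  PresentedGroup.toGroup (rels := assocRel X) (f := SymAssocGroup.of) (by
    rintro _ ⟨x, y, rfl⟩
    simp only [map_mul, map_inv, FreeGroup.lift_apply_of, SymAssocGroup.of_act x y]
    group)

theorem assocToSym_of {X : Type u} [SymmetricQuandle X] (x : X) :
    assocToSym X (AssocGroup.of x) = SymAssocGroup.of x :=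
  PresentedGroup.toGroup.of _

/-- An `(X,ρ)`-set is a set with a right action of `G_(X,ρ)`; it is in particular an `X`-set. -/
instance symSetToSet (X : Type u) (Y : Type v) [SymmetricQuandle X]
    [MulAction (SymAssocGroup X)ᵐᵒᵖ Y] : MulAction (AssocGroup X)ᵐᵒᵖ Y :=
  MulAction.compHom Y (MonoidHom.op (assocToSym X))

theorem xact_sym {X : Type u} {Y : Type v} [SymmetricQuandle X]
    [MulAction (SymAssocGroup X)ᵐᵒᵖ Y] (r : Y) (x : X) :
    xact r x = MulOpposite.op (SymAssocGroup.of x) • r := by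
  change MulOpposite.op (assocToSym X (AssocGroup.of x)) • r = _
  rw [assocToSym_of]

theorem xact_ρ {X : Type u} {Y : Type v} [SymmetricQuandle X]
    [MulAction (SymAssocGroup X)ᵐᵒᵖ Y] (r : Y) (x : X) : xact (xact r x) (ρ x) = r := by
  have h : SymAssocGroup.of x * SymAssocGroup.of (ρ x) = 1 :=
    mul_eq_one_comm.mp (SymAssocGroup.of_ρ_mul x)
  simp only [xact_sym, smul_smul, ← MulOpposite.op_mul, h, MulOpposite.op_one, one_smul]

/-! ### The symmetric double -/

/-- The set `D_X = X⁺¹ ⊔ X⁻¹`; the element `x^ε` is `⟨x, ε⟩`. -/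
@[ext]
structure Double (X : Type u) : Type u where
  val : X
  sign : ℤˣ

/-- `x * y^δ`. -/
def powAct {X : Type u} [Quandle X] (x y : X) (δ : ℤˣ) : X :=
  if δ = 1 then y ◃ x else y ◃⁻¹ x

theorem powAct_one {X : Type u} [Quandle X] (x y : X) : powAct x y 1 = y ◃ x := if_pos rfl

theorem powAct_neg_one {X : Type u} [Quandle X] (x y : X) : powAct x y (-1) = y ◃⁻¹ x :=
  if_neg (by decide)

theorem powAct_neg {X : Type u} [Quandle X] (x y : X) (δ : ℤˣ) :
    powAct (powAct x y δ) y (-δ) = x := by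
  rcases Int.units_eq_one_or δ with rfl | rfl
  · rw [powAct_one, powAct_neg_one, Rack.invAct_act_eq]
  · rw [neg_neg, powAct_one, powAct_neg_one, Rack.act_invAct_eq]

theorem powAct_self {X : Type u} [Quandle X] (x : X) (δ : ℤˣ) : powAct x x δ = x := by
  rcases Int.units_eq_one_or δ with rfl | rfl
  · rw [powAct_one, Quandle.fix]
  · rw [powAct_neg_one, Quandle.fix_inv]

theorem powAct_distrib {X : Type u} [Quandle X] (x y z : X) (ε δ : ℤˣ) :
    powAct (powAct x y ε) z δ = powAct (powAct x z δ) (powAct y z δ) ε := by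
  have key : ∀ x y : X, ∀ δ, powAct (y ◃ x) z δ = powAct y z δ ◃ powAct x z δ := by
    intro x y δ
    rcases Int.units_eq_one_or δ with rfl | rfl
    · simp only [powAct_one]; exact Shelf.self_distrib
    · simp only [powAct_neg_one]
      rw [← Rack.left_cancel z, Shelf.self_distrib]
      simp only [Rack.act_invAct_eq]
  rcases Int.units_eq_one_or ε with rfl | rfl
  · simp only [powAct_one, key]
  · simp only [powAct_neg_one]
    rw [← Rack.left_cancel (powAct y z δ), Rack.act_invAct_eq, ← key, Rack.act_invAct_eq]

/-- `x^ε ⋆ y^δ = (x * y^δ)^ε`. -/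
instance (X : Type u) [Quandle X] : Quandle (Double X) where
  act y x := ⟨powAct x.val y.val y.sign, x.sign⟩
  invAct y x := ⟨powAct x.val y.val (-y.sign), x.sign⟩
  self_distrib := by
    intro z y x
    ext
    · exact powAct_distrib _ _ _ _ _
    · rfl
  left_inv y x := by
    ext
    · exact powAct_neg _ _ _
    · rfl
  right_inv y x := by
    ext
    · have := powAct_neg x.val y.val (-y.sign)
      rwa [neg_neg] at this
    · rfl
  fix := by
    intro x
    ext
    · exact powAct_self _ _
    · rfl

/-- The symmetric double `(D_X, ρ)`, with `ρ(x^ε) = x^(-ε)`. -/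
instance (X : Type u) [Quandle X] : SymmetricQuandle (Double X) where
  ρ x := ⟨x.val, -x.sign⟩
  ρ_ρ x := by ext <;> simp
  ρ_act x y := rfl
  act_ρ x y := rfl

theorem AssocGroup.of_powAct {X : Type u} [Quandle X] (x y : X) (δ : ℤˣ) :
    AssocGroup.of (powAct x y δ) =
      ((AssocGroup.of y) ^ (δ : ℤ))⁻¹ * AssocGroup.of x * (AssocGroup.of y) ^ (δ : ℤ) := by
  rcases Int.units_eq_one_or δ with rfl | rfl
  · simp [powAct_one, AssocGroup.of_act]
  · have h := AssocGroup.of_act (y ◃⁻¹ x) y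
    rw [Rack.act_invAct_eq] at h
    rw [powAct_neg_one, h]
    simp [mul_assoc]

/-- The homomorphism `π : G_(D_X,ρ) → G_X`, `x^ε ↦ x^ε`. -/
def doublePi (X : Type u) [Quandle X] : SymAssocGroup (Double X) →* AssocGroup X :=
  PresentedGroup.toGroup (rels := symAssocRel (Double X))
    (f := fun x => AssocGroup.of x.val ^ (x.sign : ℤ)) (by
    rintro _ (⟨x, y, rfl⟩ | ⟨x, rfl⟩)
    · have h : AssocGroup.of (y ◃ x).val =
        ((AssocGroup.of y.val) ^ (y.sign : ℤ))⁻¹ * AssocGroup.of x.val *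
          (AssocGroup.of y.val) ^ (y.sign : ℤ) := AssocGroup.of_powAct _ _ _
      have hs : (y ◃ x).sign = x.sign := rfl
      simp only [map_mul, map_inv, FreeGroup.lift_apply_of, h, hs]
      rcases Int.units_eq_one_or x.sign with hx | hx <;> simp [hx, mul_assoc]
    · have h : (ρ x).sign = -x.sign := rfl
      have h' : (ρ x).val = x.val := rfl
      simp [h, h'])

theorem doublePi_of {X : Type u} [Quandle X] (x : Double X) :
    doublePi X (SymAssocGroup.of x) = AssocGroup.of x.val ^ (x.sign : ℤ) :=
  PresentedGroup.toGroup.of _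

/-- An `X`-set is a `(D_X,ρ)`-set through `π`. -/
instance doubleSet (X : Type u) (Y : Type v) [Quandle X] [MulAction (AssocGroup X)ᵐᵒᵖ Y] :
    MulAction (SymAssocGroup (Double X))ᵐᵒᵖ Y :=
  MulAction.compHom Y (MonoidHom.op (doublePi X))

theorem xact_double_one {X : Type u} {Y : Type v} [Quandle X]
    [MulAction (AssocGroup X)ᵐᵒᵖ Y] (r : Y) (x : X) :
    xact r (⟨x, 1⟩ : Double X) = xact r x := by
  rw [xact_sym]
  change MulOpposite.op (doublePi X (SymAssocGroup.of _)) • r = _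
  rw [doublePi_of]
  simp [xact]

/-! ### Chain groups and homology -/

/-- The set `Y × Xⁿ` of `(n+1)`-tuples `(r, x₁, …, xₙ)`; the entry `x_{i+1}` is `z.2 i`. -/
abbrev Tup (X : Type u) (Y : Type v) (n : ℕ) : Type (max u v) := Y × (Fin n → X)

/-- The free abelian group `C_n(X)_Y` (used in positive degrees `n`). -/
abbrev Chain (X : Type u) (Y : Type v) (n : ℕ) : Type (max u v) := Tup X Y n →₀ ℤ

/-- `(r, x₁, …, x̂ᵢ, …)` -/
def face0 {X : Type u} {Y : Type v} {n : ℕ} (i : Fin (n + 1)) (z : Tup X Y (n + 1)) :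
    Tup X Y n := (z.1, fun j => z.2 (i.succAbove j))

/-- `(r * xᵢ, x₁ * xᵢ, …, xᵢ₋₁ * xᵢ, x̂ᵢ, xᵢ₊₁, …)` -/
def face1 {X : Type u} {Y : Type v} [Quandle X] [MulAction (AssocGroup X)ᵐᵒᵖ Y] {n : ℕ}
    (i : Fin (n + 1)) (z : Tup X Y (n + 1)) : Tup X Y n :=
  (xact z.1 (z.2 i),
    fun j => if j.castSucc < i then z.2 i ◃ z.2 (i.succAbove j) else z.2 (i.succAbove j))

/-- The boundary homomorphism `∂ : C_{n+1}(X)_Y → C_n(X)_Y` (used for `n ≥ 1`); the position of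
the entry `z.2 i` in the tuple is `i + 1`, whence the sign. -/
noncomputable def bd (X : Type u) (Y : Type v) [Quandle X] [MulAction (AssocGroup X)ᵐᵒᵖ Y]
    (n : ℕ) : Chain X Y (n + 1) →ₗ[ℤ] Chain X Y n :=
  Finsupp.linearCombination ℤ fun z => ∑ i : Fin (n + 1),
    (-1 : ℤ) ^ ((i : ℕ) + 1) • (Finsupp.single (face0 i z) (1 : ℤ) - Finsupp.single (face1 i z) 1)

/-- `D_n(X)_Y`. -/
noncomputable def degen (X : Type u) (Y : Type v) (n : ℕ) : Submodule ℤ (Chain X Y n) :=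
  Submodule.span ℤ {c | ∃ z : Tup X Y n, (∃ i j : Fin n, (j : ℕ) = i + 1 ∧ z.2 i = z.2 j) ∧
    c = Finsupp.single z 1}

/-- `(r * xᵢ, x₁ * xᵢ, …, xᵢ₋₁ * xᵢ, ρ(xᵢ), xᵢ₊₁, …, xₙ)` -/
def invert {X : Type u} {Y : Type v} [SymmetricQuandle X] [MulAction (SymAssocGroup X)ᵐᵒᵖ Y]
    {n : ℕ} (i : Fin n) (z : Tup X Y n) : Tup X Y n :=
  (xact z.1 (z.2 i),
    fun j => if j < i then z.2 i ◃ z.2 j else if j = i then ρ (z.2 i) else z.2 j)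

/-- `D_n(X,ρ)_Y`. -/
noncomputable def symDegen (X : Type u) (Y : Type v) [SymmetricQuandle X]
    [MulAction (SymAssocGroup X)ᵐᵒᵖ Y] (n : ℕ) : Submodule ℤ (Chain X Y n) :=
  Submodule.span ℤ {c | ∃ (z : Tup X Y n) (i : Fin n),
    c = Finsupp.single z 1 + Finsupp.single (invert i z) 1}

theorem bd_single {X : Type u} {Y : Type v} [Quandle X] [MulAction (AssocGroup X)ᵐᵒᵖ Y]
    {n : ℕ} (z : Tup X Y (n + 1)) : bd X Y n (Finsupp.single z 1) = ∑ i : Fin (n + 1),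
    (-1 : ℤ) ^ ((i : ℕ) + 1) •
      (Finsupp.single (face0 i z) (1 : ℤ) - Finsupp.single (face1 i z) 1) := by
  simp [bd, Finsupp.linearCombination_single]

theorem bd_degen (X : Type u) (Y : Type v) [Quandle X] [MulAction (AssocGroup X)ᵐᵒᵖ Y]
    (n : ℕ) : degen X Y (n + 1) ≤ (degen X Y n).comap (bd X Y n) := by
  rw [degen, Submodule.span_le]
  rintro _ ⟨z, ⟨a, b, hab, hz⟩, rfl⟩
  rw [SetLike.mem_coe, Submodule.mem_comap, bd_single]
  have hne : b ≠ a := by intro h; rw [h] at hab; omega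
  rw [← Finset.add_sum_erase _ _ (Finset.mem_univ a),
    ← Finset.add_sum_erase _ _ (Finset.mem_erase.mpr ⟨hne, Finset.mem_univ b⟩), ← add_assoc]
  have hface : ∀ k : Fin (n + 1), k ≠ a → k ≠ b → ∃ a' b' : Fin n, (b' : ℕ) = a' + 1 ∧
      k.succAbove a' = a ∧ k.succAbove b' = b ∧ (a'.castSucc < k ↔ b'.castSucc < k) := by
    intro k hka hkb
    obtain ⟨a', ha'⟩ := Fin.exists_succAbove_eq hka.symm
    obtain ⟨b', hb'⟩ := Fin.exists_succAbove_eq hkb.symm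
    refine ⟨a', b', ?_, ha', hb', ?_⟩ <;>
    · rw [Fin.ext_iff] at ha' hb'
      rw [Ne, Fin.ext_iff] at hka hkb
      simp only [Fin.succAbove, Fin.lt_def, Fin.val_castSucc] at *
      split_ifs at ha' hb' <;> simp at * <;> omega
  refine Submodule.add_mem _ ?_ ?_
  · have h0 : face0 a z = face0 b z := by
      refine Prod.ext rfl (funext fun j => ?_)
      by_cases hj : (j : ℕ) = a
      · have e1 : a.succAbove j = b := by
          rw [Fin.succAbove_of_le_castSucc _ _ (by rw [Fin.le_def]; simp; omega), Fin.ext_iff]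
          simp; omega
        have e2 : b.succAbove j = a := by
          rw [Fin.succAbove_of_castSucc_lt _ _ (by rw [Fin.lt_def]; simp; omega), Fin.ext_iff]
          simp; omega
        simp only [face0, e1, e2, hz]
      · have e : a.succAbove j = b.succAbove j := by
          simp only [Fin.succAbove, Fin.lt_def, Fin.val_castSucc]
          split_ifs <;> first | rfl | omega
        simp only [face0, e]
    have h1 : face1 a z = face1 b z := by
      refine Prod.ext (by simp only [face1, hz]) (funext fun j => ?_)
      by_cases hj : (j : ℕ) = a
      · have e1 : a.succAbove j = b := by
          rw [Fin.succAbove_of_le_castSucc _ _ (by rw [Fin.le_def]; simp; omega), Fin.ext_iff]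
          simp; omega
        have e2 : b.succAbove j = a := by
          rw [Fin.succAbove_of_castSucc_lt _ _ (by rw [Fin.lt_def]; simp; omega), Fin.ext_iff]
          simp; omega
        have l1 : ¬ j.castSucc < a := by rw [Fin.lt_def]; simp; omega
        have l2 : j.castSucc < b := by rw [Fin.lt_def]; simp; omega
        simp only [face1, e1, e2, hz, l1, l2, if_true, if_false, Quandle.fix]
      · have e : a.succAbove j = b.succAbove j := by
          simp only [Fin.succAbove, Fin.lt_def, Fin.val_castSucc]
          split_ifs <;> first | rfl | omega
        have l : j.castSucc < a ↔ j.castSucc < b := by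
          simp only [Fin.lt_def, Fin.val_castSucc]; omega
        simp only [face1, e, hz, l]
    rw [h0, h1, hab, ← add_smul, show (-1 : ℤ) ^ ((a : ℕ) + 1) + (-1) ^ ((a : ℕ) + 1 + 1) = 0 by
      ring, zero_smul]
    exact Submodule.zero_mem _
  · refine Submodule.sum_mem _ fun k hk => Submodule.smul_mem _ _ ?_
    simp only [Finset.mem_erase, Finset.mem_univ, and_true] at hk
    obtain ⟨a', b', h1, h2, h3, h4⟩ := hface k hk.2 hk.1
    refine Submodule.sub_mem _ (Submodule.subset_span ⟨_, ⟨a', b', h1, ?_⟩, rfl⟩)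
      (Submodule.subset_span ⟨_, ⟨a', b', h1, ?_⟩, rfl⟩)
    · simp only [face0, h2, h3, hz]
    · simp only [face1, h2, h3, hz, h4]

theorem face0_invert_ne {X : Type u} {Y : Type v} [SymmetricQuandle X]
    [MulAction (SymAssocGroup X)ᵐᵒᵖ Y] {n : ℕ} (k : Fin (n + 1)) (i : Fin n)
    (z : Tup X Y (n + 1)) : face0 k (invert (k.succAbove i) z) = invert i (face0 k z) := by
  refine Prod.ext rfl (funext fun j => ?_)
  simp only [face0, invert, Fin.succAbove_lt_succAbove_iff, Fin.succAbove_right_inj]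

theorem face1_invert_ne {X : Type u} {Y : Type v} [SymmetricQuandle X]
    [MulAction (SymAssocGroup X)ᵐᵒᵖ Y] {n : ℕ} (k : Fin (n + 1)) (i : Fin n)
    (z : Tup X Y (n + 1)) : face1 k (invert (k.succAbove i) z) = invert i (face1 k z) := by
  by_cases h : i.castSucc < k
  · have h1 : ¬ k < k.succAbove i := by
      rw [Fin.succAbove_of_castSucc_lt _ _ h]; exact not_lt.mpr h.le
    have h2 : k ≠ k.succAbove i := (Fin.succAbove_ne k i).symm
    refine Prod.ext ?_ (funext fun j => ?_)
    · simp only [face1, invert, h, h1, h2, if_true, if_false]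
      exact xact_xact _ _ _
    · simp only [face1, invert, h, h1, h2, if_true, if_false, Fin.succAbove_lt_succAbove_iff,
        Fin.succAbove_right_inj]
      by_cases hj : j < i
      · have hjk : j.castSucc < k := lt_trans (Fin.castSucc_lt_castSucc_iff.mpr hj) h
        simp only [hj, hjk, if_true]
        exact Shelf.self_distrib
      · by_cases hji : j = i
        · subst hji
          simp only [h, lt_irrefl, if_true, if_false]
          exact (SymmetricQuandle.ρ_act _ _).symm
        · simp only [hj, hji, if_false]
  · have h1 : k < k.succAbove i := by
      rw [Fin.succAbove_of_le_castSucc _ _ (not_lt.mp h)]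
      exact lt_of_le_of_lt (not_lt.mp h) (Fin.castSucc_lt_succ)
    refine Prod.ext ?_ (funext fun j => ?_)
    · simp only [face1, invert, h, h1, if_true, if_false]
      exact (xact_xact _ _ _).symm
    · simp only [face1, invert, h, h1, if_true, if_false, Fin.succAbove_lt_succAbove_iff,
        Fin.succAbove_right_inj]
      by_cases hj : j < i
      · by_cases hjk : j.castSucc < k
        · simp only [hj, hjk, if_true]
          exact Shelf.self_distrib.symm
        · simp only [hj, hjk, if_true, if_false]
      · have hjk : ¬ j.castSucc < k := fun hc =>
          h (lt_of_le_of_lt (Fin.castSucc_le_castSucc_iff.mpr (not_lt.mp hj)) hc)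
        simp only [hj, hjk, if_false]

theorem face0_invert_self {X : Type u} {Y : Type v} [SymmetricQuandle X]
    [MulAction (SymAssocGroup X)ᵐᵒᵖ Y] {n : ℕ} (i : Fin (n + 1)) (z : Tup X Y (n + 1)) :
    face0 i (invert i z) = face1 i z := by
  refine Prod.ext rfl (funext fun j => ?_)
  simp only [face0, face1, invert, Fin.succAbove_ne, if_false, Fin.succAbove_lt_iff_castSucc_lt]

theorem face1_invert_self {X : Type u} {Y : Type v} [SymmetricQuandle X]
    [MulAction (SymAssocGroup X)ᵐᵒᵖ Y] {n : ℕ} (i : Fin (n + 1)) (z : Tup X Y (n + 1)) :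
    face1 i (invert i z) = face0 i z := by
  refine Prod.ext ?_ (funext fun j => ?_)
  · simp only [face0, face1, invert, lt_irrefl, if_true, if_false]
    exact xact_ρ _ _
  · simp only [face0, face1, invert, lt_irrefl, if_true, if_false, Fin.succAbove_ne,
      Fin.succAbove_lt_iff_castSucc_lt]
    split_ifs
    · rw [SymmetricQuandle.act_ρ, Rack.invAct_act_eq]
    · rfl

theorem bd_symDegen (X : Type u) (Y : Type v) [SymmetricQuandle X]
    [MulAction (SymAssocGroup X)ᵐᵒᵖ Y] (n : ℕ) :
    symDegen X Y (n + 1) ≤ (symDegen X Y n).comap (bd X Y n) := by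
  rw [symDegen, Submodule.span_le]
  rintro _ ⟨z, i, rfl⟩
  rw [SetLike.mem_coe, Submodule.mem_comap, map_add, bd_single, bd_single,
    ← Finset.sum_add_distrib]
  refine Submodule.sum_mem _ fun k _ => ?_
  rw [← smul_add]
  refine Submodule.smul_mem _ _ ?_
  by_cases hk : i = k
  · subst hk
    rw [face0_invert_self, face1_invert_self, sub_add_sub_cancel, sub_self]
    exact Submodule.zero_mem _
  · obtain ⟨i, rfl⟩ := Fin.exists_succAbove_eq hk
    rw [face0_invert_ne, face1_invert_ne, sub_add_sub_comm]
    exact Submodule.sub_mem _ (Submodule.subset_span ⟨_, i, rfl⟩)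
      (Submodule.subset_span ⟨_, i, rfl⟩)

/-- `C_n^Q(X)_Y = C_n(X)_Y / D_n(X)_Y`. -/
abbrev QChain (X : Type u) (Y : Type v) (n : ℕ) : Type (max u v) := Chain X Y n ⧸ degen X Y n

/-- `∂^Q`. -/
noncomputable def qbd (X : Type u) (Y : Type v) [Quandle X] [MulAction (AssocGroup X)ᵐᵒᵖ Y]
    (n : ℕ) : QChain X Y (n + 1) →ₗ[ℤ] QChain X Y n :=
  Submodule.mapQ _ _ (bd X Y n) (bd_degen X Y n)

/-- `C_n^SQ(X,ρ)_Y = C_n(X)_Y / (D_n(X)_Y + D_n(X,ρ)_Y)`. -/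
abbrev SQChain (X : Type u) (Y : Type v) [SymmetricQuandle X]
    [MulAction (SymAssocGroup X)ᵐᵒᵖ Y] (n : ℕ) : Type (max u v) :=
  Chain X Y n ⧸ (degen X Y n ⊔ symDegen X Y n)

/-- `∂^SQ`. -/
noncomputable def sqbd (X : Type u) (Y : Type v) [SymmetricQuandle X]
    [MulAction (SymAssocGroup X)ᵐᵒᵖ Y] (n : ℕ) : SQChain X Y (n + 1) →ₗ[ℤ] SQChain X Y n :=
  Submodule.mapQ _ _ (bd X Y n) (sup_le
    ((bd_degen X Y n).trans (Submodule.comap_mono le_sup_left))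
    ((bd_symDegen X Y n).trans (Submodule.comap_mono le_sup_right)))

/-- `Ker d / Im d'` for homomorphisms `A --d'--> B --d--> C`. -/
abbrev Homology {A B C : Type v} [AddCommGroup A] [AddCommGroup B] [AddCommGroup C]
    (d' : A →ₗ[ℤ] B) (d : B →ₗ[ℤ] C) : Type v :=
  LinearMap.ker d ⧸ (LinearMap.range d').submoduleOf (LinearMap.ker d)

/-- `z` is a cycle and `[z] = h`. -/
def Represents {A B C : Type v} [AddCommGroup A] [AddCommGroup B] [AddCommGroup C]
    {d' : A →ₗ[ℤ] B} {d : B →ₗ[ℤ] C} (z : B) (h : Homology d' d) : Prop :=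
  ∃ hz : z ∈ LinearMap.ker d, Submodule.Quotient.mk ⟨z, hz⟩ = h

/-- The homomorphism `[z] ↦ [f z]` induced on homology by a chain map. -/
noncomputable def Homology.map {A B C A' B' C' : Type v} [AddCommGroup A] [AddCommGroup B]
    [AddCommGroup C] [AddCommGroup A'] [AddCommGroup B'] [AddCommGroup C']
    {d₁ : A →ₗ[ℤ] B} {d₂ : B →ₗ[ℤ] C} {e₁ : A' →ₗ[ℤ] B'} {e₂ : B' →ₗ[ℤ] C'}
    (f₁ : A →ₗ[ℤ] A') (f₂ : B →ₗ[ℤ] B') (f₃ : C →ₗ[ℤ] C')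
    (h₁ : ∀ a, f₂ (d₁ a) = e₁ (f₁ a)) (h₂ : ∀ b, f₃ (d₂ b) = e₂ (f₂ b)) :
    Homology d₁ d₂ →ₗ[ℤ] Homology e₁ e₂ :=
  Submodule.mapQ _ _
    (f₂.restrict (p := LinearMap.ker d₂) (q := LinearMap.ker e₂) (fun b hb => by
      rw [LinearMap.mem_ker] at hb ⊢
      rw [← h₂, hb, map_zero]))
    (by
      rintro ⟨b, hb⟩ ⟨a, ha⟩
      exact ⟨f₁ a, by rw [← h₁, ha]; rfl⟩)

/-- `H_3^Q(X)_Y`. -/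
abbrev QH3 (X : Type u) (Y : Type v) [Quandle X] [MulAction (AssocGroup X)ᵐᵒᵖ Y] :
    Type (max u v) := Homology (qbd X Y 3) (qbd X Y 2)

/-- `H_3^SQ(X,ρ)_Y`. -/
abbrev SQH3 (X : Type u) (Y : Type v) [SymmetricQuandle X]
    [MulAction (SymAssocGroup X)ᵐᵒᵖ Y] : Type (max u v) := Homology (sqbd X Y 3) (sqbd X Y 2)

/-! ### The isomorphism `T_n : C_n^SQ(D_X,ρ)_Y → C_n^Q(X)_Y` -/

section Canonical

variable {X : Type u} {Y : Type v} [Quandle X] [MulAction (AssocGroup X)ᵐᵒᵖ Y] {n : ℕ}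

/-- One step of the canonicalization: make the `i`-th sign positive. -/
def canonStep (i : Fin n) (z : Tup (Double X) Y n) : Tup (Double X) Y n :=
  if (z.2 i).sign = -1 then invert i z else z

/-- The tuple `(s, y₁⁺¹, …, yₙ⁺¹)` of the canonical form `δ(s, y₁⁺¹, …, yₙ⁺¹)`: the steps are
performed for `i = n, n - 1, …, 1`. -/
def canon (z : Tup (Double X) Y n) : Tup (Double X) Y n := (List.finRange n).foldr canonStep z

/-- The sign `δ` of the canonical form: one factor `-1` for every negative entry. -/
def canonSign (z : Tup (Double X) Y n) : ℤ := ∏ i, ((z.2 i).sign : ℤ)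

/-- Replace every `y^ε` by `y`. -/
def strip (z : Tup (Double X) Y n) : Tup X Y n := (z.1, fun i => (z.2 i).val)

/-- `(r, x₁^ε₁, …, xₙ^εₙ) ↦ δ (s, y₁, …, yₙ)` on `C_n(D_X)_Y`. -/
noncomputable def TChain (X : Type u) (Y : Type v) [Quandle X] [MulAction (AssocGroup X)ᵐᵒᵖ Y]
    (n : ℕ) : Chain (Double X) Y n →ₗ[ℤ] QChain X Y n :=
  Finsupp.linearCombination ℤ fun z =>
    canonSign z • (degen X Y n).mkQ (Finsupp.single (strip (canon z)) 1)

theorem TChain_single (z : Tup (Double X) Y n) : TChain X Y n (Finsupp.single z 1) =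
    canonSign z • (degen X Y n).mkQ (Finsupp.single (strip (canon z)) 1) := by
  simp only [TChain, Finsupp.linearCombination_single, one_smul]

theorem invert_sign_self (i : Fin n) (z : Tup (Double X) Y n) :
    ((invert i z).2 i).sign = -(z.2 i).sign := by
  simp only [invert, lt_irrefl, if_true, if_false]; rfl

theorem invert_sign_ne {i j : Fin n} (h : j ≠ i) (z : Tup (Double X) Y n) :
    ((invert i z).2 j).sign = (z.2 j).sign := by
  simp only [invert, h, if_false]
  split_ifs <;> rfl

theorem invert_invert {X : Type u} {Y : Type v} [SymmetricQuandle X]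
    [MulAction (SymAssocGroup X)ᵐᵒᵖ Y] {n : ℕ} (i : Fin n) (z : Tup X Y n) :
    invert i (invert i z) = z := by
  refine Prod.ext ?_ (funext fun j => ?_)
  · simp only [invert, lt_irrefl, if_true, if_false]
    exact xact_ρ _ _
  · simp only [invert, lt_irrefl, if_true, if_false]
    split_ifs with h1 h2
    · rw [SymmetricQuandle.act_ρ, Rack.invAct_act_eq]
    · rw [SymmetricQuandle.ρ_ρ, h2]
    · rfl

theorem invert_comm {X : Type u} {Y : Type v} [SymmetricQuandle X]
    [MulAction (SymAssocGroup X)ᵐᵒᵖ Y] {n : ℕ} (i j : Fin n) (z : Tup X Y n) :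
    invert i (invert j z) = invert j (invert i z) := by
  have key : ∀ {i j : Fin n}, i < j → ∀ z : Tup X Y n,
      invert i (invert j z) = invert j (invert i z) := by
    intro i j hij z
    have h1 : ¬ j < i := not_lt.mpr hij.le
    have h2 : j ≠ i := hij.ne'
    refine Prod.ext ?_ (funext fun k => ?_)
    · simp only [invert, hij, h1, h2, if_true, if_false]
      exact (xact_xact _ _ _).symm
    · simp only [invert, hij, h1, h2, if_true, if_false]
      by_cases hk : k < i
      · have hkj : k < j := hk.trans hij
        simp only [hk, hkj, if_true]
        exact Shelf.self_distrib.symm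
      · by_cases hki : k = i
        · subst hki
          simp only [lt_irrefl, hij, if_true, if_false]
          exact SymmetricQuandle.ρ_act _ _
        · simp only [hk, hki, if_false]
  rcases lt_trichotomy i j with h | h | h
  · exact key h z
  · rw [h]
  · exact (key h z).symm

theorem canonStep_invert_ne {i j : Fin n} (h : j ≠ i) (z : Tup (Double X) Y n) :
    canonStep j (invert i z) = invert i (canonStep j z) := by
  unfold canonStep
  rw [invert_sign_ne h]
  split_ifs
  · exact invert_comm _ _ _
  · rfl

theorem canonStep_invert_self (i : Fin n) (z : Tup (Double X) Y n) :
    canonStep i (invert i z) = canonStep i z := by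
  unfold canonStep
  rw [invert_sign_self]
  rcases Int.units_eq_one_or (z.2 i).sign with h | h
  · rw [h, if_pos rfl, if_neg (by decide), invert_invert]
  · rw [h, neg_neg, if_neg (by decide), if_pos rfl]

theorem canon_invert (i : Fin n) (z : Tup (Double X) Y n) : canon (invert i z) = canon z := by
  have h1 : ∀ (l : List (Fin n)) (z : Tup (Double X) Y n), i ∉ l →
      l.foldr canonStep (invert i z) = invert i (l.foldr canonStep z) := by
    intro l z hl
    induction l with
    | nil => rfl
    | cons a l ih =>
      rw [List.mem_cons, not_or] at hl
      rw [List.foldr_cons, List.foldr_cons, ih hl.2, canonStep_invert_ne (Ne.symm hl.1)]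
  have h2 : ∀ (l : List (Fin n)), l.Nodup → i ∈ l → ∀ z : Tup (Double X) Y n,
      l.foldr canonStep (invert i z) = l.foldr canonStep z := by
    intro l hn hl z
    induction l with
    | nil => simp at hl
    | cons a l ih =>
      rw [List.nodup_cons] at hn
      rw [List.foldr_cons, List.foldr_cons]
      by_cases ha : i = a
      · subst ha
        rw [h1 l z hn.1, canonStep_invert_self]
      · rw [ih hn.2 ((List.mem_cons.mp hl).resolve_left ha)]
  exact h2 _ (List.nodup_finRange n) (List.mem_finRange i) z

theorem canonSign_invert (i : Fin n) (z : Tup (Double X) Y n) :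
    canonSign (invert i z) = -canonSign z := by
  unfold canonSign
  rw [← Finset.mul_prod_erase _ _ (Finset.mem_univ i),
    ← Finset.mul_prod_erase (a := i) _ (fun j => ((z.2 j).sign : ℤ)) (Finset.mem_univ i),
    invert_sign_self, Finset.prod_congr rfl (fun j hj => by
      rw [invert_sign_ne (Finset.ne_of_mem_erase hj)])]
  simp

theorem canon_val_eq {i j : Fin n} (hij : (j : ℕ) = i + 1) (z : Tup (Double X) Y n)
    (h : (z.2 i).val = (z.2 j).val) : ((canon z).2 i).val = ((canon z).2 j).val := by
  have step : ∀ (k : Fin n) (z : Tup (Double X) Y n), (z.2 i).val = (z.2 j).val →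
      ((canonStep k z).2 i).val = ((canonStep k z).2 j).val := by
    intro k z h
    unfold canonStep
    split_ifs
    · have hval : ∀ l, ((invert k z).2 l).val =
          if l < k then powAct (z.2 l).val (z.2 k).val (z.2 k).sign else (z.2 l).val := by
        intro l
        simp only [invert]
        split_ifs with h1 h2
        · rfl
        · subst h2; rfl
        · rfl
      rw [hval, hval]
      by_cases hjk : j < k
      · have hik : i < k := by rw [Fin.lt_def] at *; omega
        rw [if_pos hik, if_pos hjk, h]
      · rw [if_neg hjk]
        split_ifs with hik
        · have : k = j := by rw [Fin.ext_iff]; rw [Fin.lt_def] at *; omega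
          rw [this, h, powAct_self]
        · exact h
    · exact h
  unfold canon
  generalize List.finRange n = l
  induction l with
  | nil => exact h
  | cons a l ih => exact step _ _ ih

theorem TChain_degen : degen (Double X) Y n ⊔ symDegen (Double X) Y n ≤
    LinearMap.ker (TChain X Y n) := by
  refine sup_le ?_ ?_
  · rw [degen, Submodule.span_le]
    rintro _ ⟨z, ⟨i, j, hij, h⟩, rfl⟩
    rw [SetLike.mem_coe, LinearMap.mem_ker, TChain_single]
    have : (degen X Y n).mkQ (Finsupp.single (strip (canon z)) 1) = 0 := by
      rw [Submodule.mkQ_apply, Submodule.Quotient.mk_eq_zero]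
      exact Submodule.subset_span
        ⟨_, ⟨i, j, hij, canon_val_eq hij z (congrArg Double.val h)⟩, rfl⟩
    rw [this, smul_zero]
  · rw [symDegen, Submodule.span_le]
    rintro _ ⟨z, i, rfl⟩
    rw [SetLike.mem_coe, LinearMap.mem_ker, map_add, TChain_single, TChain_single, canon_invert,
      canonSign_invert, neg_smul, add_neg_cancel]

end Canonical

/-- `T_n^{D_X → X} : C_n^SQ(D_X,ρ)_Y → C_n^Q(X)_Y`. -/
noncomputable def T (X : Type u) (Y : Type v) [Quandle X] [MulAction (AssocGroup X)ᵐᵒᵖ Y]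
    (n : ℕ) : SQChain (Double X) Y n →ₗ[ℤ] QChain X Y n :=
  Submodule.liftQ _ (TChain X Y n) TChain_degen

section ChainMap

variable {X : Type u} {Y : Type v} [Quandle X] [MulAction (AssocGroup X)ᵐᵒᵖ Y] {n : ℕ}

theorem canon_pos (z : Tup (Double X) Y n) (i : Fin n) : ((canon z).2 i).sign = 1 := by
  have step : ∀ (k : Fin n) (z : Tup (Double X) Y n),
      (i = k ∨ (z.2 i).sign = 1) → ((canonStep k z).2 i).sign = 1 := by
    intro k z h
    unfold canonStep
    by_cases hk : i = k
    · subst hk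
      rcases Int.units_eq_one_or (z.2 i).sign with h | h
      · rw [h, if_neg (by decide), h]
      · rw [h, if_pos rfl, invert_sign_self, h, neg_neg]
    · split_ifs
      · rw [invert_sign_ne hk, h.resolve_left hk]
      · exact h.resolve_left hk
  have key : ∀ l : List (Fin n), i ∈ l → ((l.foldr canonStep z).2 i).sign = 1 := by
    intro l hl
    induction l with
    | nil => simp at hl
    | cons a l ih =>
      rw [List.foldr_cons]
      rcases List.mem_cons.mp hl with h | h
      · exact step _ _ (Or.inl h)
      · exact step _ _ (Or.inr (ih h))
  exact key _ (List.mem_finRange i)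

theorem canon_of_pos {z : Tup (Double X) Y n} (hz : ∀ i, (z.2 i).sign = 1) : canon z = z := by
  unfold canon
  generalize List.finRange n = l
  induction l with
  | nil => rfl
  | cons a l ih =>
    rw [List.foldr_cons, ih, canonStep, hz, if_neg (by decide)]

theorem T_single_pos {z : Tup (Double X) Y n} (hz : ∀ i, (z.2 i).sign = 1) :
    T X Y n (Submodule.Quotient.mk (Finsupp.single z 1)) =
      Submodule.Quotient.mk (Finsupp.single (strip z) 1) := by
  have h : canonSign z = 1 := by simp [canonSign, hz]
  change TChain X Y n _ = _
  rw [TChain_single, canon_of_pos hz, h, one_smul]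
  rfl

theorem mk_single_eq_canon (z : Tup (Double X) Y n) :
    (Submodule.Quotient.mk (Finsupp.single z 1) : SQChain (Double X) Y n) =
      canonSign z • Submodule.Quotient.mk (Finsupp.single (canon z) 1) := by
  have hinv : ∀ (i : Fin n) (z : Tup (Double X) Y n),
      (Submodule.Quotient.mk (Finsupp.single z 1) : SQChain (Double X) Y n) =
        -Submodule.Quotient.mk (Finsupp.single (invert i z) 1) := by
    intro i z
    rw [eq_neg_iff_add_eq_zero, ← Submodule.Quotient.mk_add, Submodule.Quotient.mk_eq_zero]
    exact Submodule.mem_sup_right (Submodule.subset_span ⟨z, i, rfl⟩)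
  have key : ∀ (l : List (Fin n)) (z : Tup (Double X) Y n),
      canonSign z • (Submodule.Quotient.mk (Finsupp.single z 1) : SQChain (Double X) Y n) =
        canonSign (l.foldr canonStep z) •
          Submodule.Quotient.mk (Finsupp.single (l.foldr canonStep z) 1) := by
    intro l z
    induction l with
    | nil => rfl
    | cons a l ih =>
      rw [ih, List.foldr_cons]
      generalize l.foldr canonStep z = w
      unfold canonStep
      split_ifs
      · rw [canonSign_invert, hinv a w, smul_neg, neg_smul]
      · rfl
  have h1 : canonSign (canon z) = 1 := by simp [canonSign, canon_pos]
  have h2 : canonSign z * canonSign z = 1 := by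
    simp only [canonSign, ← Finset.prod_mul_distrib, ← Units.val_mul, Int.units_mul_self]
    simp
  have h := key (List.finRange n) z
  change _ = canonSign (canon z) • Submodule.Quotient.mk (Finsupp.single (canon z) 1) at h
  rw [h1, one_smul] at h
  rw [← h, smul_smul, h2, one_smul]

theorem T_chainMap (c : SQChain (Double X) Y (n + 1)) :
    T X Y n (sqbd (Double X) Y n c) = qbd X Y n (T X Y (n + 1) c) := by
  suffices h : (T X Y n).comp (sqbd (Double X) Y n) = (qbd X Y n).comp (T X Y (n + 1)) from
    LinearMap.congr_fun h c
  refine Submodule.linearMap_qext _ (Finsupp.lhom_ext' fun z => LinearMap.ext_ring ?_)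
  change T X Y n (sqbd (Double X) Y n (Submodule.Quotient.mk (Finsupp.single z 1))) =
    qbd X Y n (T X Y (n + 1) (Submodule.Quotient.mk (Finsupp.single z 1)))
  rw [mk_single_eq_canon]
  simp only [map_smul]
  congr 1
  have hz := canon_pos z
  generalize canon z = w at hz
  have e0 : ∀ i, strip (face0 i w) = face0 i (strip w) := fun i => rfl
  have hw : ∀ i, w.2 i = ⟨(w.2 i).val, 1⟩ := fun i => Double.ext rfl (hz i)
  have e1 : ∀ i, strip (face1 i w) = face1 i (strip w) := by
    intro i
    refine Prod.ext ?_ (funext fun j => ?_)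
    · simp only [strip, face1]
      rw [hw i]
      exact xact_double_one _ _
    · simp only [strip, face1]
      split_ifs
      · change powAct _ _ (w.2 i).sign = _
        rw [hz, powAct_one]
      · rfl
  have p0 : ∀ i j, ((face0 i w).2 j).sign = 1 := fun i j => hz _
  have p1 : ∀ i j, ((face1 i w).2 j).sign = 1 := by
    intro i j
    simp only [face1]
    split_ifs
    · exact hz _
    · exact hz _
  rw [T_single_pos hz]
  change T X Y n (Submodule.Quotient.mk (bd (Double X) Y n (Finsupp.single w 1))) =
    Submodule.Quotient.mk (bd X Y n (Finsupp.single (strip w) 1))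
  rw [bd_single, bd_single]
  simp only [← Submodule.mkQ_apply, map_sum, map_smul, map_sub]
  refine Finset.sum_congr rfl fun i _ => ?_
  simp only [Submodule.mkQ_apply]
  rw [T_single_pos (p0 i), T_single_pos (p1 i), e0, e1]

end ChainMap

/-- `(T_3^{D_X → X})^* : H_3^SQ(D_X,ρ)_Y → H_3^Q(X)_Y`, `[z] ↦ [T_3 z]`. -/
noncomputable def T3 (X : Type u) (Y : Type v) [Quandle X] [MulAction (AssocGroup X)ᵐᵒᵖ Y] :
    SQH3 (Double X) Y →ₗ[ℤ] QH3 X Y :=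
  Homology.map (T X Y 4) (T X Y 3) (T X Y 2) T_chainMap T_chainMap

/-! ### Surface-link diagrams -/

/-- Euclidean 3-space. -/
abbrev E3 : Type := EuclideanSpace ℝ (Fin 3)

/-- 4-space, as the product of 3-space and the height direction; the projection is `Prod.fst`. -/
abbrev E4 : Type := E3 × ℝ

/-- The determinant of three vectors of 3-space; it is positive iff they match the right-handed
orientation. -/
noncomputable def det3 (a b c : E3) : ℝ := Matrix.det (Matrix.of fun i j => (![a, b, c] i) j)

/-- A smooth chart of 3-space centred at `q`, with image the open cube `(-1,1)³`. -/
structure CubeChart (q : E3) where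
  φ : OpenPartialHomeomorph E3 E3
  mem_source : q ∈ φ.source
  map_center : φ q = 0
  target_eq : φ.target = {y | ∀ i, |y i| < 1}
  smooth : ContDiffOn ℝ ∞ φ φ.source
  smooth_symm : ContDiffOn ℝ ∞ φ.symm φ.target

/-- The `i`-th component of the image of the vector `n` at `x` under the derivative of the chart:
it is positive iff `n` points towards increasing values of the `i`-th chart coordinate. -/
noncomputable def CubeChart.slope {q : E3} (χ : CubeChart q) (i : Fin 3) (x n : E3) : ℝ :=
  (fderiv ℝ χ.φ x n) i

/-- A chart in which the part of `F` above the chart domain consists of `k ≤ 3` pieces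
(sheets `0, …, k-1`) that project diffeomorphically onto coordinate planes
`{y_0 = 0}, …, {y_{k-1} = 0}`, where over the intersection of two such planes the sheet of smaller
index is the upper one. The centre is a regular point of the projection for `k = 1`, a double
point for `k = 2`, a triple point for `k = 3`. -/
structure CrossingChart (F : Set E4) (k : ℕ) (q : E3) extends CubeChart q where
  height : Fin 3 → E3 → ℝ
  height_smooth : ∀ i, ContDiffOn ℝ ∞ (height i) φ.source
  height_lt : ∀ i j : Fin 3, i < j → (j : ℕ) < k → ∀ x ∈ φ.source, φ x i = 0 → φ x j = 0 →
    height j x < height i x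
  mem_iff : ∀ p : E4, p.1 ∈ φ.source →
    (p ∈ F ↔ ∃ i : Fin 3, (i : ℕ) < k ∧ φ p.1 i = 0 ∧ p.2 = height i p.1)

/-- `p` is a point of the `i`-th sheet of the chart. -/
def CrossingChart.OnSheet {F : Set E4} {k : ℕ} {q : E3} (χ : CrossingChart F k q) (i : Fin 3)
    (p : E4) : Prop := p.1 ∈ χ.φ.source ∧ χ.φ p.1 i = 0 ∧ p.2 = χ.height i p.1

/-- A chart centred at a branch point: the part of `F` above the chart domain is parametrized by
`(u, v) ↦ (u², uv, v)` (Whitney's umbrella) and a height function that makes it an embedded smooth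
surface. -/
structure BranchChart (F : Set E4) (q : E3) extends CubeChart q where
  height : ℝ × ℝ → ℝ
  height_smooth : ContDiffOn ℝ ∞ height (Set.Ioo (-1) 1 ×ˢ Set.Ioo (-1) 1)
  height_immersive : fderiv ℝ height (0, 0) (1, 0) ≠ 0
  height_ne : ∀ u ∈ Set.Ioo (0 : ℝ) 1, height (u, 0) ≠ height (-u, 0)
  mem_iff : ∀ p : E4, p.1 ∈ φ.source →
    (p ∈ F ↔ ∃ u v : ℝ, φ p.1 = !₂[u ^ 2, u * v, v] ∧ p.2 = height (u, v))

/-- A surface-link diagram: a compact subset `F` of 4-space in general position with respect to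
the projection to 3-space, that is, every point of the projection is a regular point, a transverse
double point, a transverse triple point or a branch point. The local forms say that `F` is a
smoothly embedded closed surface. The diagram is the projection of `F`; the height coordinate
carries the over/under information. -/
structure Diagram where
  F : Set E4
  isCompact : IsCompact F
  generic : ∀ p ∈ F, Nonempty (CrossingChart F 1 p.1) ∨ Nonempty (CrossingChart F 2 p.1) ∨
    Nonempty (CrossingChart F 3 p.1) ∨ Nonempty (BranchChart F p.1)

namespace Diagram

/-- The lower points over the double and triple points. -/
def lower (D : Diagram) : Set E4 := {p | p ∈ D.F ∧ ∃ p' ∈ D.F, p'.1 = p.1 ∧ p.2 < p'.2}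

/-- The upper points over the double and triple points. -/
def upper (D : Diagram) : Set E4 := {p | p ∈ D.F ∧ ∃ p' ∈ D.F, p'.1 = p.1 ∧ p'.2 < p.2}

/-- The union of the sheets; the closure adds the branch points to the lower points. -/
def sheets (D : Diagram) : Set E4 := D.F \ closure D.lower

/-- The union of the semi-sheets. -/
def semiSheets (D : Diagram) : Set E4 := D.F \ closure (D.lower ∪ D.upper)

/-- The union of the complementary regions. -/
def regions (D : Diagram) : Set E3 := (Prod.fst '' D.F)ᶜ

/-- The set of sheets. -/
abbrev Sheet (D : Diagram) : Type := ConnectedComponents D.sheets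

/-- The set of semi-sheets. -/
abbrev SemiSheet (D : Diagram) : Type := ConnectedComponents D.semiSheets

/-- The set of complementary regions. -/
abbrev Region (D : Diagram) : Type := ConnectedComponents D.regions

theorem semiSheets_subset (D : Diagram) : D.semiSheets ⊆ D.sheets := fun _ hp =>
  ⟨hp.1, fun h => hp.2 (closure_mono Set.subset_union_left h)⟩

/-- The semi-sheet that contains a point. -/
def semiSheetOf (D : Diagram) (p : D.semiSheets) : D.SemiSheet := ConnectedComponents.mk p

/-- The sheet that contains a point of a semi-sheet. -/
def sheetOf (D : Diagram) (p : D.semiSheets) : D.Sheet :=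
  ConnectedComponents.mk ⟨p.1, D.semiSheets_subset p.2⟩

/-- The complementary region that contains a point. -/
def regionOf (D : Diagram) (x : D.regions) : D.Region := ConnectedComponents.mk x

/-- `n` is a unit normal vector of the diagram at (the projection of) `p`: it is orthogonal to the
projection of the tangent plane of `F` at `p`. -/
def IsUnitNormal (D : Diagram) (p : E4) (n : E3) : Prop :=
  ‖n‖ = 1 ∧ ∀ v ∈ tangentConeAt ℝ D.F p, inner ℝ n v.1 = 0

/-- An orientation of the diagram, that is, of the surface `F`, given by a continuous 2-form along
`F` that vanishes on no tangent plane; `(v, w)` is a positive basis of the tangent plane at `p` iff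
`0 < form p ![v, w]`. -/
structure Orientation (D : Diagram) where
  form : D.F → E4 [⋀^Fin 2]→L[ℝ] ℝ
  continuous_form : Continuous form
  form_ne : ∀ p : D.F, ∃ v ∈ tangentConeAt ℝ D.F p.1, ∃ w ∈ tangentConeAt ℝ D.F p.1,
    form p ![v, w] ≠ 0

/-- `n` is the normal orientation given by the orientation at the point `p` of a semi-sheet: for a
positive basis `(o₁, o₂)` of the tangent plane, `(o₁, o₂, n)` is right-handed. -/
def Orientation.IsNormal {D : Diagram} (o : D.Orientation) (p : D.semiSheets) (n : E3) : Prop :=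
  D.IsUnitNormal p.1 n ∧ ∀ v ∈ tangentConeAt ℝ D.F p.1, ∀ w ∈ tangentConeAt ℝ D.F p.1,
    0 < o.form ⟨p.1, p.2.1⟩ ![v, w] → 0 < det3 v.1 w.1 n

/-! ### Colorings by quandles -/

/-- An `X_Y`-coloring of the oriented diagram `(D, o)`. -/
structure Coloring (D : Diagram) (o : D.Orientation) (X : Type u) (Y : Type v) [Quandle X]
    [MulAction (AssocGroup X)ᵐᵒᵖ Y] where
  color : D.Sheet → X
  region : D.Region → Y
  /-- At a double point curve, if the normal orientation of the over-sheet (color `x₃`) points from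
  the under-sheet with color `x₁` to that with color `x₂`, then `x₁ * x₃ = x₂`. -/
  crossing_rule : ∀ (q : E3) (χ : CrossingChart D.F 2 q) (a b e : D.semiSheets) (n : E3),
    χ.OnSheet 1 a → χ.OnSheet 1 b → χ.OnSheet 0 e → χ.φ a.1.1 0 < 0 → 0 < χ.φ b.1.1 0 →
    o.IsNormal e n → 0 < χ.slope 0 e.1.1 n →
    color (D.sheetOf e) ◃ color (D.sheetOf a) = color (D.sheetOf b)
  /-- If the normal orientation of a semi-sheet with color `x` points from the region with label
  `r₁` to that with label `r₂`, then `r₁ * x = r₂`. -/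
  side_rule : ∀ (q : E3) (χ : CrossingChart D.F 1 q) (c c' : D.regions) (e : D.semiSheets) (n : E3),
    c.1 ∈ χ.φ.source → c'.1 ∈ χ.φ.source → χ.OnSheet 0 e → χ.φ c.1 0 < 0 → 0 < χ.φ c'.1 0 →
    o.IsNormal e n → 0 < χ.slope 0 e.1.1 n →
    xact (region (D.regionOf c)) (color (D.sheetOf e)) = region (D.regionOf c')

/-! ### Colorings by symmetric quandles -/

/-- An assignment of a normal orientation (a continuous unit normal vector field) and an element of
`X` to each semi-sheet and of an element of `Y` to each complementary region that satisfies the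
conditions of an `(X,ρ)_Y`-coloring. -/
structure Assignment (D : Diagram) (X : Type u) (Y : Type v) [SymmetricQuandle X]
    [MulAction (SymAssocGroup X)ᵐᵒᵖ Y] where
  normal : D.semiSheets → E3
  continuous_normal : Continuous normal
  isUnitNormal : ∀ p, D.IsUnitNormal p.1 (normal p)
  color : D.SemiSheet → X
  region : D.Region → Y
  /-- Two over-semi-sheets: equal colors if the normal orientations are coherent, colors related by
  `ρ` otherwise. -/
  over_rule : ∀ (q : E3) (χ : CrossingChart D.F 2 q) (a b : D.semiSheets),
    χ.OnSheet 0 a → χ.OnSheet 0 b → χ.φ a.1.1 1 < 0 → 0 < χ.φ b.1.1 1 →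
    (0 < χ.slope 0 a.1.1 (normal a) * χ.slope 0 b.1.1 (normal b) →
      color (D.semiSheetOf a) = color (D.semiSheetOf b)) ∧
    (χ.slope 0 a.1.1 (normal a) * χ.slope 0 b.1.1 (normal b) < 0 →
      color (D.semiSheetOf a) = ρ (color (D.semiSheetOf b)))
  /-- Two under-semi-sheets with colors `x₁`, `x₂`, the normal orientation of an over-semi-sheet
  with color `x₃` pointing from the first to the second: `x₁ * x₃ = x₂` if the normal orientations
  are coherent, `x₁ * x₃ = ρ(x₂)` otherwise. -/
  under_rule : ∀ (q : E3) (χ : CrossingChart D.F 2 q) (a b e : D.semiSheets),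
    χ.OnSheet 1 a → χ.OnSheet 1 b → χ.OnSheet 0 e → χ.φ a.1.1 0 < 0 → 0 < χ.φ b.1.1 0 →
    0 < χ.slope 0 e.1.1 (normal e) →
    (0 < χ.slope 1 a.1.1 (normal a) * χ.slope 1 b.1.1 (normal b) →
      color (D.semiSheetOf e) ◃ color (D.semiSheetOf a) = color (D.semiSheetOf b)) ∧
    (χ.slope 1 a.1.1 (normal a) * χ.slope 1 b.1.1 (normal b) < 0 →
      color (D.semiSheetOf e) ◃ color (D.semiSheetOf a) = ρ (color (D.semiSheetOf b)))
  /-- The condition on the labels of the regions on the two sides of a semi-sheet. -/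
  side_rule : ∀ (q : E3) (χ : CrossingChart D.F 1 q) (c c' : D.regions) (e : D.semiSheets),
    c.1 ∈ χ.φ.source → c'.1 ∈ χ.φ.source → χ.OnSheet 0 e → χ.φ c.1 0 < 0 → 0 < χ.φ c'.1 0 →
    0 < χ.slope 0 e.1.1 (normal e) →
    xact (region (D.regionOf c)) (color (D.semiSheetOf e)) = region (D.regionOf c')

section Sym

variable (D : Diagram) (X : Type u) (Y : Type v) [SymmetricQuandle X]
  [MulAction (SymAssocGroup X)ᵐᵒᵖ Y]

/-- Two assignments are equivalent if they are related by basic inversions, that is, if they differ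
by inverting the normal orientation and applying `ρ` to the color on some of the semi-sheets. -/
instance assignmentSetoid : Setoid (D.Assignment X Y) where
  r a b := a.region = b.region ∧ ∀ σ : D.SemiSheet,
    ((∀ p, D.semiSheetOf p = σ → a.normal p = b.normal p) ∧ a.color σ = b.color σ) ∨
    ((∀ p, D.semiSheetOf p = σ → a.normal p = -b.normal p) ∧ a.color σ = ρ (b.color σ))
  iseqv := by
    refine ⟨fun a => ⟨rfl, fun σ => Or.inl ⟨fun _ _ => rfl, rfl⟩⟩, fun {a b} h => ?_,
      fun {a b c} h h' => ?_⟩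
    · refine ⟨h.1.symm, fun σ => ?_⟩
      rcases h.2 σ with ⟨h1, h2⟩ | ⟨h1, h2⟩
      · exact Or.inl ⟨fun p hp => (h1 p hp).symm, h2.symm⟩
      · refine Or.inr ⟨fun p hp => by rw [h1 p hp, neg_neg], ?_⟩
        rw [h2, SymmetricQuandle.ρ_ρ]
    · refine ⟨h.1.trans h'.1, fun σ => ?_⟩
      rcases h.2 σ with ⟨h1, h2⟩ | ⟨h1, h2⟩ <;> rcases h'.2 σ with ⟨h3, h4⟩ | ⟨h3, h4⟩
      · exact Or.inl ⟨fun p hp => by rw [h1 p hp, h3 p hp], h2.trans h4⟩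
      · exact Or.inr ⟨fun p hp => by rw [h1 p hp, h3 p hp], h2.trans h4⟩
      · exact Or.inr ⟨fun p hp => by rw [h1 p hp, h3 p hp], by rw [h2, h4]⟩
      · exact Or.inl ⟨fun p hp => by rw [h1 p hp, h3 p hp, neg_neg],
          by rw [h2, h4, SymmetricQuandle.ρ_ρ]⟩

/-- `Col_{(X,ρ)_Y}(D)`, the set of `(X,ρ)_Y`-colorings of the unoriented diagram `D`. -/
def SymColoring : Type (max u v) := Quotient (D.assignmentSetoid X Y)

end Sym

/-! ### Weights of triple points -/

/-- The set of triple points. -/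
def TriplePoint (D : Diagram) : Type := {t : E3 // Nonempty (CrossingChart D.F 3 t)}

/-- A chart centred at a triple point; its sheets `0`, `1`, `2` are the top, middle and bottom
sheets. The eight regions around the triple point are the octants of the chart: the sign vector `s`
stands for the octant `{y | s_i y_i < 0 for all i}`, so that the normal orientation of sheet `i`
points out of the octant `s` iff it points towards increasing values of `s_i y_i`. -/
noncomputable def TriplePoint.chart {D : Diagram} (t : D.TriplePoint) : CrossingChart D.F 3 t.1 :=
  Classical.choice t.2

/-- A point in the octant `s`. -/
noncomputable def TriplePoint.corner {D : Diagram} (t : D.TriplePoint) (s : Fin 3 → ℤˣ) : E3 :=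
  t.chart.φ.symm (WithLp.toLp 2 fun j => -((s j : ℤ) : ℝ) / 2)

/-- A point on the semi-sheet of sheet `i` that faces the octant `s`. -/
noncomputable def TriplePoint.face {D : Diagram} (t : D.TriplePoint) (s : Fin 3 → ℤˣ)
    (i : Fin 3) : E4 :=
  let x := t.chart.φ.symm (WithLp.toLp 2 fun j => if j = i then 0 else -((s j : ℤ) : ℝ) / 2)
  (x, t.chart.height i x)

theorem abs_sign_half (e : ℤˣ) : |-((e : ℤ) : ℝ) / 2| < 1 := by
  rcases Int.units_eq_one_or e with rfl | rfl <;> norm_num [abs_lt]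

theorem sign_half_ne (e : ℤˣ) : -((e : ℤ) : ℝ) / 2 ≠ 0 := by
  rcases Int.units_eq_one_or e with rfl | rfl <;> norm_num

theorem TriplePoint.corner_mem {D : Diagram} (t : D.TriplePoint) (s : Fin 3 → ℤˣ) :
    t.corner s ∈ D.regions := by
  have hy : WithLp.toLp 2 (fun j => -((s j : ℤ) : ℝ) / 2) ∈ t.chart.φ.target := by
    rw [t.chart.target_eq]
    exact fun i => abs_sign_half _
  rintro ⟨p, hp, hpx⟩
  have hx : p.1 ∈ t.chart.φ.source := by
    rw [hpx]; exact t.chart.φ.map_target hy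
  obtain ⟨i, -, h, -⟩ := (t.chart.mem_iff p hx).mp hp
  rw [hpx, TriplePoint.corner, t.chart.φ.right_inv hy] at h
  exact sign_half_ne _ h

theorem TriplePoint.face_mem {D : Diagram} (t : D.TriplePoint) (s : Fin 3 → ℤˣ) (i : Fin 3) :
    t.face s i ∈ D.semiSheets := by
  have hy : WithLp.toLp 2 (fun j => if j = i then 0 else -((s j : ℤ) : ℝ) / 2) ∈
      t.chart.φ.target := by
    rw [t.chart.target_eq]
    intro j
    by_cases hj : j = i
    · simp [hj]
    · simp only [hj, if_false]
      exact abs_sign_half (s j)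
  have hx := t.chart.φ.map_target hy
  have hr := t.chart.φ.right_inv hy
  refine ⟨(t.chart.mem_iff _ hx).mpr ⟨i, i.2, ?_, rfl⟩, ?_⟩
  · change t.chart.φ (t.chart.φ.symm _) i = 0
    rw [hr]
    simp
  · -- off the other two sheets, the chart domain contains no double points
    let V : Set E3 := t.chart.φ.source ∩ t.chart.φ ⁻¹' {y | ∀ j, j ≠ i → y j ≠ 0}
    have hV : IsOpen V := by
      refine t.chart.φ.isOpen_inter_preimage ?_
      simp only [Set.ofPred_forall]
      refine isOpen_iInter_of_finite fun j => isOpen_iInter_of_finite fun _ => ?_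
      exact isOpen_ne_fun (by fun_prop) continuous_const
    have hmem : t.face s i ∈ Prod.fst ⁻¹' V := by
      refine ⟨hx, fun j hj => ?_⟩
      change t.chart.φ (t.chart.φ.symm _) j ≠ 0
      rw [hr]
      simp only [hj, if_false]
      exact sign_half_ne (s j)
    have huniq : ∀ p ∈ D.F, p.1 ∈ V → p.2 = t.chart.height i p.1 := by
      intro p hp hpV
      obtain ⟨j, -, h1, h2⟩ := (t.chart.mem_iff p hpV.1).mp hp
      by_cases hj : j = i
      · rw [← hj]; exact h2
      · exact absurd h1 (hpV.2 j hj)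
    intro hcl
    obtain ⟨p, hpV, hp⟩ := mem_closure_iff.mp hcl _ (hV.preimage continuous_fst) hmem
    have hpV' : p.1 ∈ V := hpV
    rcases hp with ⟨hpF, p', hp'F, h1, h2⟩ | ⟨hpF, p', hp'F, h1, h2⟩ <;>
    · have e1 := huniq p hpF hpV'
      have e2 := huniq p' hp'F (h1 ▸ hpV')
      rw [h1] at e2
      rw [e1, e2] at h2
      exact lt_irrefl _ h2

/-- The face point as a point of the union of the semi-sheets. -/
noncomputable def TriplePoint.facePt {D : Diagram} (t : D.TriplePoint) (s : Fin 3 → ℤˣ)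
    (i : Fin 3) : D.semiSheets := ⟨t.face s i, t.face_mem s i⟩

/-- The octant `s` as a complementary region. -/
noncomputable def TriplePoint.octant {D : Diagram} (t : D.TriplePoint) (s : Fin 3 → ℤˣ) :
    D.Region := D.regionOf ⟨t.corner s, t.corner_mem s⟩

/-- The sign `+1` or `-1` according to whether the normal orientations of the top, middle and
bottom sheets that point out of the octant `s` form a right-handed triple. These are positive
multiples of `s_i` times the gradients of the chart coordinates, that is, of the rows of the
Jacobian matrix. -/
noncomputable def TriplePoint.sign {D : Diagram} (t : D.TriplePoint) (s : Fin 3 → ℤˣ) : ℤ :=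
  (SignType.sign (fderiv ℝ t.chart.φ t.1).det : ℤ) * ∏ i, (s i : ℤ)

/-- `s` is the octant that the normal orientations of the three sheets point from. -/
def TriplePoint.IsSource {D : Diagram} (t : D.TriplePoint) (o : D.Orientation)
    (s : Fin 3 → ℤˣ) : Prop :=
  ∀ i, ∃ n, o.IsNormal (t.facePt s i) n ∧
    0 < ((s i : ℤ) : ℝ) * t.chart.slope i (t.face s i).1 n

/-- The octant that the normal orientations of the three sheets point from. -/
noncomputable def TriplePoint.source {D : Diagram} (t : D.TriplePoint) (o : D.Orientation) :
    Fin 3 → ℤˣ := Classical.epsilon (t.IsSource o)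

section QuandleWeight

variable {X : Type u} {Y : Type v} [Quandle X] [MulAction (AssocGroup X)ᵐᵒᵖ Y]

/-- The weight `ε(r, x₁, x₂, x₃)` of a triple point of a colored oriented diagram: `r` is the label
of the region that the normal orientations point from, and `x₁`, `x₂`, `x₃` are the colors of the
bottom, middle and top sheets that face this region. -/
noncomputable def Coloring.weight {D : Diagram} {o : D.Orientation} (C : D.Coloring o X Y)
    (t : D.TriplePoint) : QChain X Y 3 :=
  t.sign (t.source o) • Submodule.Quotient.mk (Finsupp.single
    (C.region (t.octant (t.source o)),
      fun j => C.color (D.sheetOf (t.facePt (t.source o) j.rev))) 1)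

/-- `W^{X_Y}((D,o),C)`, the sum of the weights of the (finitely many) triple points. -/
noncomputable def Coloring.W {D : Diagram} {o : D.Orientation} (C : D.Coloring o X Y) :
    QChain X Y 3 := ∑ᶠ t : D.TriplePoint, C.weight t

end QuandleWeight

section SymWeight

variable {X : Type u} {Y : Type v} [SymmetricQuandle X] [MulAction (SymAssocGroup X)ᵐᵒᵖ Y]

open Classical in
/-- The color of the semi-sheet of sheet `i` that faces the octant `s`, after a basic inversion if
this is necessary to make the normal orientation point out of the octant. -/
noncomputable def Assignment.faceColor {D : Diagram} (a : D.Assignment X Y) (t : D.TriplePoint)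
    (s : Fin 3 → ℤˣ) (i : Fin 3) : X :=
  if 0 < ((s i : ℤ) : ℝ) * t.chart.slope i (t.face s i).1 (a.normal (t.facePt s i)) then
    a.color (D.semiSheetOf (t.facePt s i))
  else ρ (a.color (D.semiSheetOf (t.facePt s i)))

/-- The weight `ε(r, x₁, x₂, x₃)` of a triple point with specified region the octant `s`. -/
noncomputable def Assignment.weight {D : Diagram} (a : D.Assignment X Y) (t : D.TriplePoint)
    (s : Fin 3 → ℤˣ) : SQChain X Y 3 :=
  t.sign s • Submodule.Quotient.mk (Finsupp.single
    (a.region (t.octant s), fun j => a.faceColor t s j.rev) 1)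

/-- `W^{(X,ρ)_Y}(D,C)`, the sum of the weights of the triple points, computed from a representative
of the coloring `C` and a choice `s` of a specified region at every triple point. -/
noncomputable def SymColoring.W {D : Diagram} (s : D.TriplePoint → Fin 3 → ℤˣ)
    (C : D.SymColoring X Y) : SQChain X Y 3 :=
  ∑ᶠ t : D.TriplePoint, (Quotient.out C).weight t (s t)

end SymWeight

/-! ### Canonical forms and induced orientations -/

section Canon

variable {X : Type u} {Y : Type v} [Quandle X] [MulAction (AssocGroup X)ᵐᵒᵖ Y]

/-- `a` is the canonical form of the coloring `C`: it represents `C` and all its colors lie in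
`X⁺¹`. -/
def IsCanonicalForm {D : Diagram} (C : D.SymColoring (Double X) Y)
    (a : D.Assignment (Double X) Y) : Prop :=
  Quotient.mk _ a = C ∧ ∀ σ, (a.color σ).sign = 1

/-- The orientation induced by the canonical form of `C` is `o`. -/
def Induces {D : Diagram} (C : D.SymColoring (Double X) Y) (o : D.Orientation) : Prop :=
  ∃ a, IsCanonicalForm C a ∧ ∀ p, o.IsNormal p (a.normal p)

/-- `C ∼_ori C'`: the orientations induced by the canonical forms coincide, that is, the canonical
forms have the same normal orientations. -/
def OriEquiv {D : Diagram} (C C' : D.SymColoring (Double X) Y) : Prop :=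
  ∃ a a', IsCanonicalForm C a ∧ IsCanonicalForm C' a' ∧ a.normal = a'.normal

/-- `[C]_ori`. -/
def oriClass {D : Diagram} (C : D.SymColoring (Double X) Y) : Set (D.SymColoring (Double X) Y) :=
  {C' | OriEquiv C C'}

end Canon

end Diagram

/-! ### Multi-sets of homology classes -/

/-- A multi-set of elements of `A`, given by the multiplicities (cardinal numbers, since there may
be infinitely many colorings). -/
abbrev MultiSet (A : Type u) : Type (u + 1) := A → Cardinal.{u}

/-- The image of a multi-set under a map. -/
noncomputable def MultiSet.map {A B : Type u} (f : A → B) (m : MultiSet A) : MultiSet B :=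
  fun b => Cardinal.sum fun a : {a : A // f a = b} => m a.1

namespace Diagram

/-- `𝒲^{X_Y}(D,o)`: the multi-set of the classes `[W((D,o),C)]` in `H_3^Q(X)_Y`, for all
`X_Y`-colorings `C` of `(D,o)`. -/
noncomputable def homologyInvariant (D : Diagram) (o : D.Orientation) (X : Type u) (Y : Type v)
    [Quandle X] [MulAction (AssocGroup X)ᵐᵒᵖ Y] : MultiSet (QH3 X Y) :=
  fun h => Cardinal.mk {C : D.Coloring o X Y // Represents C.W h}

/-- The multi-set of the classes `[W(D,C)]` in `H_3^SQ(X,ρ)_Y`, for all `C` in a set `K` of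
`(X,ρ)_Y`-colorings of `D`, for a choice `s` of specified regions. -/
noncomputable def symHomologyInvariant (D : Diagram) {X : Type u} {Y : Type v}
    [SymmetricQuandle X] [MulAction (SymAssocGroup X)ᵐᵒᵖ Y] (s : D.TriplePoint → Fin 3 → ℤˣ)
    (K : Set (D.SymColoring X Y)) : MultiSet (SQH3 X Y) :=
  fun h => Cardinal.mk {C : D.SymColoring X Y // C ∈ K ∧ Represents (SymColoring.W s C) h}

end Diagram

end SurfaceLink

/-! Modulo `symDegen`, every tuple over `Double X` is plus or minus a tuple with positive entries
only, and positive tuples are the same as tuples over `X`. Hence giving every entry the sign +1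
induces an inverse of `T` in each degree, and `T3` is bijective.

For the multisets it remains to find a bijection Φ from `oriClass C` to the colorings of `(D, o)`
such that `T` carries the weight sum of a coloring to that of its image; `represents_T3_iff` then
transfers the homology classes. The canonical form of a coloring in the class has the normals given
by `o`. When all normals come from an orientation, only the coherent clauses of the coloring rules
matter: the colors of the two over-semi-sheets at a double curve agree, so the colors descend from
semi-sheets to sheets (`exists_sheetColor`), and the other rules become those of an `X_Y`-coloring.
Conversely, an `X_Y`-coloring is pulled back to the semi-sheets, with the normals of the canonical
form of `C`. Canonical forms are unique because `ρ` changes the sign of a color, so Φ is bijective.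

As to the weights, moving the specified region across one sheet of a triple point negates the sign
and applies `invert` to the tuple, so the weight in the quotient by `symDegen` does not change
(`weight_flip`). The region may therefore be the one that all three normals point from; there the
canonical form yields a positive tuple, which `T` turns into the weight for the oriented diagram.

Two facts about charts carry the geometry. The normal given by an orientation points to one and the
same side along a whole sheet of a chart, even across double curves (`exists_sign_slope`). And the
coloring rules, which are stated for charts centred at regular and double points, can be used inside
any crossing chart, because suitable sub-boxes of its cube give such charts (`CrossingChart.sub`).
-/

namespace SurfaceLink

/-! ### `T_n` is an isomorphism -/

section TIso

variable {X : Type u} {Y : Type v} {n : ℕ}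

/-- `(r, x₁, …, xₙ) ↦ (r, x₁⁺¹, …, xₙ⁺¹)` -/
def unstrip (z : Tup X Y n) : Tup (Double X) Y n := (z.1, fun i => ⟨z.2 i, 1⟩)

theorem strip_unstrip (z : Tup X Y n) : strip (unstrip z) = z := rfl

theorem unstrip_strip {z : Tup (Double X) Y n} (hz : ∀ i, (z.2 i).sign = 1) :
    unstrip (strip z) = z :=
  Prod.ext rfl (funext fun i => Double.ext rfl (hz i).symm)

variable [Quandle X] [MulAction (AssocGroup X)ᵐᵒᵖ Y]

/-- The inverse of `T_n`, induced by `unstrip`. -/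
noncomputable def TInv (X : Type u) (Y : Type v) [Quandle X] [MulAction (AssocGroup X)ᵐᵒᵖ Y]
    (n : ℕ) : QChain X Y n →ₗ[ℤ] SQChain (Double X) Y n :=
  Submodule.mapQ _ _ (Finsupp.lmapDomain ℤ ℤ unstrip) (by
    rw [degen, Submodule.span_le]
    rintro _ ⟨z, ⟨i, j, hij, h⟩, rfl⟩
    rw [SetLike.mem_coe, Submodule.mem_comap, Finsupp.lmapDomain_apply, Finsupp.mapDomain_single]
    exact Submodule.mem_sup_left (Submodule.subset_span
      ⟨_, ⟨i, j, hij, by simp only [unstrip, h]⟩, rfl⟩))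

theorem TInv_single (z : Tup X Y n) : TInv X Y n (Submodule.Quotient.mk (Finsupp.single z 1)) =
    Submodule.Quotient.mk (Finsupp.single (unstrip z) 1) := by
  change Submodule.Quotient.mk (Finsupp.lmapDomain ℤ ℤ unstrip _) = _
  rw [Finsupp.lmapDomain_apply, Finsupp.mapDomain_single]

theorem T_TInv (c : QChain X Y n) : T X Y n (TInv X Y n c) = c := by
  suffices h : (T X Y n).comp (TInv X Y n) = LinearMap.id from LinearMap.congr_fun h c
  refine Submodule.linearMap_qext _ (Finsupp.lhom_ext' fun z => LinearMap.ext_ring ?_)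
  change T X Y n (TInv X Y n (Submodule.Quotient.mk (Finsupp.single z 1))) =
    Submodule.Quotient.mk (Finsupp.single z 1)
  rw [TInv_single, T_single_pos (fun i => rfl), strip_unstrip]

/-- In the quotient a generator is its canonical form up to sign, so only positive tuples have to be
checked; on these `strip` and `unstrip` are mutually inverse. -/
theorem TInv_T (c : SQChain (Double X) Y n) : TInv X Y n (T X Y n c) = c := by
  suffices h : (TInv X Y n).comp (T X Y n) = LinearMap.id from LinearMap.congr_fun h c
  refine Submodule.linearMap_qext _ (Finsupp.lhom_ext' fun z => LinearMap.ext_ring ?_)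
  change TInv X Y n (T X Y n (Submodule.Quotient.mk (Finsupp.single z 1))) =
    Submodule.Quotient.mk (Finsupp.single z 1)
  rw [mk_single_eq_canon, map_smul, map_smul, T_single_pos (canon_pos z), TInv_single,
    unstrip_strip (canon_pos z)]

theorem T_bijective (X : Type u) (Y : Type v) [Quandle X] [MulAction (AssocGroup X)ᵐᵒᵖ Y]
    (n : ℕ) : Function.Bijective (T X Y n) :=
  Function.bijective_iff_has_inverse.mpr ⟨TInv X Y n, TInv_T, T_TInv⟩

end TIso

/-- Surjectivity of `f₁` lifts a bounding chain, and injectivity of `f₃` shows that the preimage of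
a cycle is a cycle; a full isomorphism is needed in the middle degree only. -/
theorem Homology.map_bijective {A B C A' B' C' : Type v} [AddCommGroup A] [AddCommGroup B]
    [AddCommGroup C] [AddCommGroup A'] [AddCommGroup B'] [AddCommGroup C']
    {d₁ : A →ₗ[ℤ] B} {d₂ : B →ₗ[ℤ] C} {e₁ : A' →ₗ[ℤ] B'} {e₂ : B' →ₗ[ℤ] C'}
    {f₁ : A →ₗ[ℤ] A'} {f₂ : B →ₗ[ℤ] B'} {f₃ : C →ₗ[ℤ] C'}
    (h₁ : ∀ a, f₂ (d₁ a) = e₁ (f₁ a)) (h₂ : ∀ b, f₃ (d₂ b) = e₂ (f₂ b))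
    (hf₁ : Function.Surjective f₁) (hf₂ : Function.Bijective f₂) (hf₃ : Function.Injective f₃) :
    Function.Bijective (Homology.map f₁ f₂ f₃ h₁ h₂) := by
  constructor
  · rw [injective_iff_map_eq_zero]
    intro x hx
    induction x using Submodule.Quotient.induction_on with
    | _ x =>
      obtain ⟨x, hxk⟩ := x
      have hx' : Submodule.Quotient.mk (p := (LinearMap.range e₁).submoduleOf (LinearMap.ker e₂))
          ⟨f₂ x, by rw [LinearMap.mem_ker] at hxk ⊢; rw [← h₂, hxk, map_zero]⟩ = 0 := hx
      rw [Submodule.Quotient.mk_eq_zero] at hx' ⊢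
      obtain ⟨a', ha'⟩ := hx'
      obtain ⟨a, rfl⟩ := hf₁ a'
      refine ⟨a, hf₂.1 ?_⟩
      rw [h₁, ha']
      rfl
  · intro y
    induction y using Submodule.Quotient.induction_on with
    | _ y =>
      obtain ⟨y, hy⟩ := y
      obtain ⟨x, rfl⟩ := hf₂.2 y
      refine ⟨Submodule.Quotient.mk ⟨x, ?_⟩, rfl⟩
      rw [LinearMap.mem_ker] at hy ⊢
      rw [← h₂] at hy
      exact hf₃ (hy.trans (map_zero f₃).symm)

/-- Injectivity of `f₃` makes `z` a cycle as soon as `f₂ z` is one; injectivity on homology then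
compares the classes. -/
theorem represents_map_iff {A B C A' B' C' : Type v} [AddCommGroup A] [AddCommGroup B]
    [AddCommGroup C] [AddCommGroup A'] [AddCommGroup B'] [AddCommGroup C']
    {d₁ : A →ₗ[ℤ] B} {d₂ : B →ₗ[ℤ] C} {e₁ : A' →ₗ[ℤ] B'} {e₂ : B' →ₗ[ℤ] C'}
    {f₁ : A →ₗ[ℤ] A'} {f₂ : B →ₗ[ℤ] B'} {f₃ : C →ₗ[ℤ] C'}
    (h₁ : ∀ a, f₂ (d₁ a) = e₁ (f₁ a)) (h₂ : ∀ b, f₃ (d₂ b) = e₂ (f₂ b))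
    (hinj : Function.Injective (Homology.map f₁ f₂ f₃ h₁ h₂)) (hf₃ : Function.Injective f₃)
    (z : B) (h : Homology d₁ d₂) :
    Represents z h ↔ Represents (f₂ z) (Homology.map f₁ f₂ f₃ h₁ h₂ h) := by
  constructor
  · rintro ⟨hz, rfl⟩
    exact ⟨by rw [LinearMap.mem_ker] at hz ⊢; rw [← h₂, hz, map_zero], rfl⟩
  · rintro ⟨hz, hzh⟩
    have hz' : z ∈ LinearMap.ker d₂ := by
      rw [LinearMap.mem_ker] at hz ⊢
      rw [← h₂] at hz
      exact hf₃ (hz.trans (map_zero f₃).symm)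
    exact ⟨hz', hinj hzh⟩

theorem T3_bijective (X : Type u) (Y : Type v) [Quandle X] [MulAction (AssocGroup X)ᵐᵒᵖ Y] :
    Function.Bijective (T3 X Y) :=
  Homology.map_bijective _ _ (T_bijective X Y 4).2 (T_bijective X Y 3) (T_bijective X Y 2).1

theorem represents_T3_iff {X : Type u} {Y : Type v} [Quandle X] [MulAction (AssocGroup X)ᵐᵒᵖ Y]
    (z : SQChain (Double X) Y 3) (h : SQH3 (Double X) Y) :
    Represents z h ↔ Represents (T X Y 3 z) (T3 X Y h) :=
  represents_map_iff _ _ (T3_bijective X Y).1 (T_bijective X Y 2).1 z h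

/-- The fibre over `f a` is a single point, so the cardinal sum has one term. -/
theorem MultiSet.map_apply_of_bijective {A B : Type u} {f : A → B} (hf : Function.Bijective f)
    (m : MultiSet A) (a : A) : MultiSet.map f m (f a) = m a := by
  let e : {a' : A // f a' = f a} ≃ PUnit.{u + 1} :=
    { toFun := fun _ => PUnit.unit
      invFun := fun _ => ⟨a, rfl⟩
      left_inv := fun x => Subtype.ext (hf.1 x.2).symm
      right_inv := fun _ => rfl }
  have : ∀ x : {a' : A // f a' = f a}, m x.1 = m a := fun x => by rw [hf.1 x.2]
  rw [MultiSet.map, funext this, Cardinal.sum_const', Cardinal.mk_congr e, Cardinal.mk_punit,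
    one_mul]

/-! ### Local structure of a diagram in a crossing chart -/

theorem CubeChart.isOpen_cube : IsOpen {y : E3 | ∀ i, |y i| < 1} := by
  simp only [Set.ofPred_forall]
  exact isOpen_iInter_of_finite fun i => isOpen_lt (by fun_prop) continuous_const

namespace CrossingChart

variable {F : Set E4} {k : ℕ} {q : E3}

/-- The point of the `i`-th sheet over the point with chart coordinates `y`. -/
noncomputable def lift (χ : CrossingChart F k q) (i : Fin 3) (y : E3) : E4 :=
  (χ.φ.symm y, χ.height i (χ.φ.symm y))

theorem mem_target (χ : CrossingChart F k q) {y : E3} : y ∈ χ.φ.target ↔ ∀ i, |y i| < 1 := by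
  rw [χ.target_eq]; rfl

theorem φ_lift (χ : CrossingChart F k q) {i : Fin 3} {y : E3} (hy : y ∈ χ.φ.target) :
    χ.φ (χ.lift i y).1 = y := χ.φ.right_inv hy

theorem onSheet_lift (χ : CrossingChart F k q) {i : Fin 3} {y : E3} (hy : y ∈ χ.φ.target)
    (h0 : y i = 0) : χ.OnSheet i (χ.lift i y) :=
  ⟨χ.φ.map_target hy, by rw [φ_lift χ hy, h0], rfl⟩

theorem OnSheet.eq_lift {χ : CrossingChart F k q} {i : Fin 3} {p : E4} (h : χ.OnSheet i p) :
    p = χ.lift i (χ.φ p.1) := by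
  have h1 : χ.φ.symm (χ.φ p.1) = p.1 := χ.φ.left_inv h.1
  exact Prod.ext h1.symm (by rw [lift, h1]; exact h.2.2)

theorem OnSheet.φ_mem {χ : CrossingChart F k q} {i : Fin 3} {p : E4} (h : χ.OnSheet i p) :
    χ.φ p.1 ∈ χ.φ.target := χ.φ.map_source h.1

theorem OnSheet.mem {χ : CrossingChart F k q} {i : Fin 3} {p : E4} (h : χ.OnSheet i p)
    (hi : (i : ℕ) < k) : p ∈ F := (χ.mem_iff p h.1).mpr ⟨i, hi, h.2⟩

theorem exists_onSheet (χ : CrossingChart F k q) {p : E4} (hp : p ∈ F) (h : p.1 ∈ χ.φ.source) :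
    ∃ i : Fin 3, (i : ℕ) < k ∧ χ.OnSheet i p := by
  obtain ⟨i, hi, h'⟩ := (χ.mem_iff p h).mp hp
  exact ⟨i, hi, h, h'⟩

theorem OnSheet.unique {χ : CrossingChart F k q} {i j : Fin 3} {p : E4} (h : χ.OnSheet i p)
    (h' : χ.OnSheet j p) (hi : (i : ℕ) < k) (hj : (j : ℕ) < k) : i = j := by
  rcases lt_trichotomy i j with hij | hij | hij
  · have := χ.height_lt i j hij hj p.1 h.1 h.2.1 h'.2.1
    rw [← h.2.2, ← h'.2.2] at this
    exact absurd this (lt_irrefl _)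
  · exact hij
  · have := χ.height_lt j i hij hi p.1 h.1 h'.2.1 h.2.1
    rw [← h.2.2, ← h'.2.2] at this
    exact absurd this (lt_irrefl _)

theorem contDiffOn_lift (χ : CrossingChart F k q) (i : Fin 3) :
    ContDiffOn ℝ ∞ (χ.lift i) χ.φ.target :=
  χ.smooth_symm.prodMk ((χ.height_smooth i).comp χ.smooth_symm fun _ hy => χ.φ.map_target hy)

theorem continuousOn_lift (χ : CrossingChart F k q) (i : Fin 3) :
    ContinuousOn (χ.lift i) χ.φ.target := (χ.contDiffOn_lift i).continuousOn

theorem convex_target (χ : CrossingChart F k q) : Convex ℝ χ.φ.target := by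
  intro y hy z hz a b ha hb hab
  refine χ.mem_target.mpr fun l => ?_
  have h1 := abs_lt.mp (χ.mem_target.mp hy l)
  have h2 := abs_lt.mp (χ.mem_target.mp hz l)
  have := (convex_Ioo (-1 : ℝ) 1) (x := y l) ⟨h1.1, h1.2⟩ (y := z l) ⟨h2.1, h2.2⟩ ha hb hab
  exact abs_lt.mpr ⟨by simpa using this.1, by simpa using this.2⟩

theorem convex_plane (χ : CrossingChart F k q) (i : Fin 3) :
    Convex ℝ {y : E3 | y ∈ χ.φ.target ∧ y i = 0} := by
  intro y hy z hz a b ha hb hab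
  exact ⟨χ.convex_target hy.1 hz.1 ha hb hab, by simp [hy.2, hz.2]⟩

/-- The part of 4-space above the chart domain and off all sheets but the `i`-th. -/
def offOthers (χ : CrossingChart F k q) (i : Fin 3) : Set E4 :=
  {p | p.1 ∈ χ.φ.source ∧ ∀ j : Fin 3, (j : ℕ) < k → j ≠ i → ¬ χ.OnSheet j p}

/-- Above the chart domain a sheet is relatively closed, being the zero set of a coordinate together
with a height difference. Removing the other sheets leaves an open set in which `F` is the `i`-th
sheet alone; this isolates a sheet in 4-space even where its projection crosses others. -/
theorem isOpen_offOthers (χ : CrossingChart F k q) (i : Fin 3) : IsOpen (χ.offOthers i) := by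
  have h1 : IsOpen (Prod.fst ⁻¹' χ.φ.source : Set E4) := χ.φ.open_source.preimage continuous_fst
  have h2 : ∀ j : Fin 3, IsOpen {p : E4 | p.1 ∈ χ.φ.source ∧ ¬ χ.OnSheet j p} := by
    intro j
    have hc : ContinuousOn (fun p : E4 => (χ.φ p.1 j, p.2 - χ.height j p.1))
        (Prod.fst ⁻¹' χ.φ.source) := by
      have hφ : ContinuousOn (fun p : E4 => χ.φ p.1) (Prod.fst ⁻¹' χ.φ.source) :=
        χ.φ.continuousOn.comp continuous_fst.continuousOn fun _ h => h
      have hh : ContinuousOn (fun p : E4 => χ.height j p.1) (Prod.fst ⁻¹' χ.φ.source) :=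
        (χ.height_smooth j).continuousOn.comp continuous_fst.continuousOn fun _ h => h
      have ha : Continuous fun y : E3 => y j := by fun_prop
      exact (ha.comp_continuousOn hφ).prodMk (continuous_snd.continuousOn.sub hh)
    convert hc.isOpen_inter_preimage h1 (isOpen_compl_singleton (x := ((0 : ℝ), (0 : ℝ)))) using 1
    ext p
    simp only [OnSheet, Set.mem_ofPred_eq, Set.mem_inter_iff, Set.mem_preimage, Set.mem_compl_iff,
      Set.mem_singleton_iff, Prod.mk.injEq, sub_eq_zero]
    tauto
  have h3 : χ.offOthers i = (Prod.fst ⁻¹' χ.φ.source) ∩ ⋂ j : Fin 3, ⋂ _ : (j : ℕ) < k,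
      ⋂ _ : j ≠ i, {p : E4 | p.1 ∈ χ.φ.source ∧ ¬ χ.OnSheet j p} := by
    ext p
    simp only [offOthers, Set.mem_ofPred_eq, Set.mem_inter_iff, Set.mem_preimage, Set.mem_iInter]
    exact ⟨fun h => ⟨h.1, fun j a b => ⟨h.1, h.2 j a b⟩⟩,
      fun h => ⟨h.1, fun j a b => (h.2 j a b).2⟩⟩
  rw [h3]
  exact h1.inter (isOpen_iInter_of_finite fun j => isOpen_iInter_of_finite fun _ =>
    isOpen_iInter_of_finite fun _ => h2 j)

theorem OnSheet.mem_offOthers {χ : CrossingChart F k q} {i : Fin 3} {p : E4} (h : χ.OnSheet i p)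
    (hi : (i : ℕ) < k) : p ∈ χ.offOthers i :=
  ⟨h.1, fun _ hj hji h' => hji (h'.unique h hj hi)⟩

theorem onSheet_of_mem_offOthers (χ : CrossingChart F k q) {i : Fin 3} {p : E4} (hp : p ∈ F)
    (h : p ∈ χ.offOthers i) : χ.OnSheet i p := by
  obtain ⟨j, hj, hj'⟩ := χ.exists_onSheet hp h.1
  by_cases hji : j = i
  · exact hji ▸ hj'
  · exact absurd hj' (h.2 j hj hji)

end CrossingChart

/-! ### Sheets and semi-sheets seen in a crossing chart -/

namespace Diagram

variable {D : Diagram} {k : ℕ} {q : E3}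

/-- Near `p` only sheet `0` is present, and no point of `F` lies above sheet `0`, so lower points do
not accumulate at `p`. -/
theorem mem_sheets_of_onSheet_zero {χ : CrossingChart D.F k q} {p : E4} (h : χ.OnSheet 0 p)
    (hk : 0 < k) : p ∈ D.sheets := by
  refine ⟨h.mem hk, fun hcl => ?_⟩
  obtain ⟨p', hp', hp'F, p'', hp''F, h1, h2⟩ :=
    mem_closure_iff.mp hcl _ (χ.isOpen_offOthers 0) (h.mem_offOthers hk)
  have e1 := χ.onSheet_of_mem_offOthers hp'F hp'
  obtain ⟨j, hj, e2⟩ := χ.exists_onSheet hp''F (h1 ▸ e1.1)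
  rw [e1.2.2, e2.2.2, h1] at h2
  rcases eq_or_ne j 0 with rfl | hj0
  · exact lt_irrefl _ h2
  · exact lt_asymm h2 (χ.height_lt 0 j (Fin.pos_of_ne_zero hj0) hj _ e1.1 e1.2.1 (h1 ▸ e2.2.1))

/-- Away from the other coordinate planes `F` is the graph of one height function over its
projection, so there are no double points nearby. -/
theorem mem_semiSheets_of_onSheet {χ : CrossingChart D.F k q} {i : Fin 3} {p : E4}
    (h : χ.OnSheet i p) (hi : (i : ℕ) < k)
    (hne : ∀ j : Fin 3, (j : ℕ) < k → j ≠ i → χ.φ p.1 j ≠ 0) : p ∈ D.semiSheets := by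
  let V : Set E3 := χ.φ.source ∩ χ.φ ⁻¹' {y | ∀ j : Fin 3, (j : ℕ) < k → j ≠ i → y j ≠ 0}
  have hV : IsOpen V := by
    refine χ.φ.isOpen_inter_preimage ?_
    simp only [Set.ofPred_forall]
    refine isOpen_iInter_of_finite fun j => isOpen_iInter_of_finite fun _ =>
      isOpen_iInter_of_finite fun _ => ?_
    exact isOpen_ne_fun (by fun_prop) continuous_const
  have huniq : ∀ p ∈ D.F, p.1 ∈ V → p.2 = χ.height i p.1 := by
    intro p hp hpV
    obtain ⟨j, hj, h1⟩ := χ.exists_onSheet hp hpV.1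
    by_cases hji : j = i
    · rw [← hji]; exact h1.2.2
    · exact absurd h1.2.1 (hpV.2 j hj hji)
  refine ⟨h.mem hi, fun hcl => ?_⟩
  obtain ⟨p', hpV, hp⟩ := mem_closure_iff.mp hcl _ (hV.preimage continuous_fst) ⟨h.1, hne⟩
  have hpV' : p'.1 ∈ V := hpV
  rcases hp with ⟨hpF, p'', hp'F, h1, h2⟩ | ⟨hpF, p'', hp'F, h1, h2⟩ <;>
  · have e1 := huniq p' hpF hpV'
    have e2 := huniq p'' hp'F (h1 ▸ hpV')
    rw [h1] at e2
    rw [e1, e2] at h2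
    exact lt_irrefl _ h2

/-- On the plane of another sheet the point would be a lower or an upper point, according to the
order of the two indices. -/
theorem coord_ne_zero_of_mem_semiSheets {χ : CrossingChart D.F k q} {i : Fin 3} {p : E4}
    (h : χ.OnSheet i p) (hi : (i : ℕ) < k) (hp : p ∈ D.semiSheets) {j : Fin 3} (hj : (j : ℕ) < k)
    (hji : j ≠ i) : χ.φ p.1 j ≠ 0 := by
  intro h0
  refine hp.2 (subset_closure ?_)
  have hF : (p.1, χ.height j p.1) ∈ D.F :=
    (χ.mem_iff (p.1, χ.height j p.1) h.1).mpr ⟨j, hj, h0, rfl⟩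
  rcases lt_or_gt_of_ne hji with hlt | hlt
  · refine Or.inl ⟨h.mem hi, _, hF, rfl, ?_⟩
    rw [h.2.2]
    exact χ.height_lt j i hlt hi p.1 h.1 h0 h.2.1
  · refine Or.inr ⟨h.mem hi, _, hF, rfl, ?_⟩
    rw [h.2.2]
    exact χ.height_lt i j hlt hj p.1 h.1 h.2.1 h0

end Diagram

namespace CrossingChart

variable {F : Set E4} {k : ℕ} {q : E3}

/-! ### Charts around the other points of a crossing chart -/

/-- The affine change of coordinates that permutes the coordinates by `π`, multiplies the first
`k'` of them by the signs `s` and maps the halves of `(-1,1)` opposite to the signs `s` onto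
`(-1,1)` in the others. -/
noncomputable def subAffine (π : Equiv.Perm (Fin 3)) (k' : ℕ) (s : Fin 3 → ℤˣ) :
    E3 ≃ₜ E3 where
  -- In the first `k'` coordinates the sign makes increasing values point out of the octant `s`. In
  -- the others, `|2y + s| < 1` says that `y` lies strictly between `0` and `-s`, which is the half
  -- on the side of the octant.
  toFun y := WithLp.toLp 2 fun l =>
    if (l : ℕ) < k' then ((s (π l) : ℤ) : ℝ) * y (π l) else 2 * y (π l) + ((s (π l) : ℤ) : ℝ)
  invFun z := WithLp.toLp 2 fun i =>
    if (π.symm i : ℕ) < k' then ((s i : ℤ) : ℝ) * z (π.symm i)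
    else (z (π.symm i) - ((s i : ℤ) : ℝ)) / 2
  left_inv y := by
    ext i
    simp only [Equiv.apply_symm_apply]
    split_ifs
    · rw [← mul_assoc, ← Int.cast_mul, ← Units.val_mul, Int.units_mul_self]; simp
    · ring
  right_inv z := by
    ext l
    simp only [Equiv.symm_apply_apply]
    split_ifs
    · rw [← mul_assoc, ← Int.cast_mul, ← Units.val_mul, Int.units_mul_self]; simp
    · ring
  continuous_toFun := by
    refine (PiLp.continuous_toLp 2 _).comp (continuous_pi fun l => ?_)
    split_ifs <;> fun_prop
  continuous_invFun := by
    refine (PiLp.continuous_toLp 2 _).comp (continuous_pi fun l => ?_)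
    split_ifs <;> fun_prop

theorem subAffine_apply (π : Equiv.Perm (Fin 3)) (k' : ℕ) (s : Fin 3 → ℤˣ) (y : E3)
    (l : Fin 3) : subAffine π k' s y l =
      if (l : ℕ) < k' then ((s (π l) : ℤ) : ℝ) * y (π l)
      else 2 * y (π l) + ((s (π l) : ℤ) : ℝ) := rfl

theorem contDiff_subAffine (π : Equiv.Perm (Fin 3)) (k' : ℕ) (s : Fin 3 → ℤˣ) :
    ContDiff ℝ ∞ (subAffine π k' s) := by
  rw [contDiff_euclidean]
  intro l
  simp only [subAffine_apply]
  split_ifs <;> fun_prop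

theorem contDiff_subAffine_symm (π : Equiv.Perm (Fin 3)) (k' : ℕ) (s : Fin 3 → ℤˣ) :
    ContDiff ℝ ∞ (subAffine π k' s).symm := by
  rw [contDiff_euclidean]
  intro l
  change ContDiff ℝ ∞ fun z : E3 => if (π.symm l : ℕ) < k' then
    ((s l : ℤ) : ℝ) * z (π.symm l) else (z (π.symm l) - ((s l : ℤ) : ℝ)) / 2
  split_ifs <;> fun_prop

theorem abs_units_mul (e : ℤˣ) (x : ℝ) : |((e : ℤ) : ℝ) * x| = |x| := by
  rcases Int.units_eq_one_or e with rfl | rfl <;> simp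

theorem abs_lt_one_of_subAffine {π : Equiv.Perm (Fin 3)} {k' : ℕ} {s : Fin 3 → ℤˣ} {y : E3}
    {l : Fin 3} (h : |subAffine π k' s y l| < 1) : |y (π l)| < 1 := by
  rw [subAffine_apply] at h
  split_ifs at h
  · rwa [abs_units_mul] at h
  · rcases Int.units_eq_one_or (s (π l)) with hs | hs <;> rw [hs] at h <;> norm_num at h <;>
      rw [abs_lt] at h ⊢ <;> constructor <;> linarith

/-- This keeps the sheets belonging to the halved coordinates out of the smaller chart. -/
theorem ne_zero_of_subAffine {π : Equiv.Perm (Fin 3)} {k' : ℕ} {s : Fin 3 → ℤˣ} {y : E3}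
    {l : Fin 3} (hl : ¬ (l : ℕ) < k') (h : |subAffine π k' s y l| < 1) : y (π l) ≠ 0 := by
  rw [subAffine_apply, if_neg hl] at h
  intro h0
  rw [h0] at h
  rcases Int.units_eq_one_or (s (π l)) with hs | hs <;> rw [hs] at h <;> norm_num at h

theorem subAffine_eq_zero_iff {π : Equiv.Perm (Fin 3)} {k' : ℕ} {s : Fin 3 → ℤˣ} {y : E3}
    {l : Fin 3} (hl : (l : ℕ) < k') : subAffine π k' s y l = 0 ↔ y (π l) = 0 := by
  rw [subAffine_apply, if_pos hl]
  rcases Int.units_eq_one_or (s (π l)) with hs | hs <;> simp [hs]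

/-- The chart obtained from `χ` by the change of coordinates `subAffine`. -/
noncomputable def sub (χ : CrossingChart F k q) (π : Equiv.Perm (Fin 3)) (k' : ℕ)
    (s : Fin 3 → ℤˣ) (hmono : ∀ l l' : Fin 3, l < l' → (l' : ℕ) < k' → π l < π l')
    (hlt : ∀ l : Fin 3, (l : ℕ) < k' → (π l : ℕ) < k) :
    CrossingChart F k' (χ.φ.symm ((subAffine π k' s).symm 0)) where
  -- The final restriction cuts the target down to the standard cube.
  φ := (χ.φ.trans (subAffine π k' s).toOpenPartialHomeomorph).trans
    (OpenPartialHomeomorph.ofSet _ CubeChart.isOpen_cube)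
  mem_source := by
    have h : (subAffine π k' s).symm 0 ∈ χ.φ.target := by
      rw [χ.mem_target]
      intro i
      obtain ⟨l, rfl⟩ := π.surjective i
      apply abs_lt_one_of_subAffine (k' := k') (s := s)
      simp
    simp [χ.φ.map_target h, χ.φ.right_inv h]
  map_center := by
    have h : (subAffine π k' s).symm 0 ∈ χ.φ.target := by
      rw [χ.mem_target]
      intro i
      obtain ⟨l, rfl⟩ := π.surjective i
      apply abs_lt_one_of_subAffine (k' := k') (s := s)
      simp
    simp [χ.φ.right_inv h]
  target_eq := by
    ext z
    simp only [OpenPartialHomeomorph.trans_target, OpenPartialHomeomorph.ofSet_target,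
      OpenPartialHomeomorph.ofSet_symm, OpenPartialHomeomorph.ofSet_apply, Set.preimage_id,
      Homeomorph.toOpenPartialHomeomorph_target, Set.univ_inter, Set.mem_inter_iff, Set.mem_preimage]
    refine ⟨fun h => h.1, fun h => ⟨h, ?_⟩⟩
    change (subAffine π k' s).symm z ∈ _
    rw [χ.mem_target]
    intro i
    obtain ⟨l, rfl⟩ := π.surjective i
    apply abs_lt_one_of_subAffine (k' := k') (s := s)
    rw [Homeomorph.apply_symm_apply]
    exact h l
  smooth := (contDiff_subAffine π k' s).comp_contDiffOn
    (χ.smooth.mono fun x hx => hx.1.1)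
  smooth_symm := χ.smooth_symm.comp (contDiff_subAffine_symm π k' s).contDiffOn
    fun z hz => hz.2.2
  height l := χ.height (π l)
  height_smooth l := (χ.height_smooth (π l)).mono fun x hx => hx.1.1
  -- Monotonicity of `π` on the first `k'` indices preserves the convention that a smaller index
  -- means an upper sheet.
  height_lt l l' hl hl' x hx h0 h0' := χ.height_lt _ _ (hmono l l' hl hl') (hlt l' hl') x hx.1.1
    ((subAffine_eq_zero_iff (lt_trans hl hl')).mp h0) ((subAffine_eq_zero_iff hl').mp h0')
  mem_iff p hp := by
    rw [χ.mem_iff p hp.1.1]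
    constructor
    · rintro ⟨i, hi, h0, h⟩
      obtain ⟨l, rfl⟩ := π.surjective i
      have hl : (l : ℕ) < k' := by
        by_contra hl
        exact ne_zero_of_subAffine hl (hp.2 l) h0
      exact ⟨l, hl, (subAffine_eq_zero_iff hl).mpr h0, h⟩
    · rintro ⟨l, hl, h0, h⟩
      exact ⟨π l, hlt l hl, (subAffine_eq_zero_iff hl).mp h0, h⟩

section Sub

variable (χ : CrossingChart F k q) {π : Equiv.Perm (Fin 3)} {k' : ℕ}
    {s : Fin 3 → ℤˣ} (hmono : ∀ l l' : Fin 3, l < l' → (l' : ℕ) < k' → π l < π l')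
    (hlt : ∀ l : Fin 3, (l : ℕ) < k' → (π l : ℕ) < k)

theorem sub_φ (x : E3) (l : Fin 3) : (χ.sub π k' s hmono hlt).φ x l =
    if (l : ℕ) < k' then ((s (π l) : ℤ) : ℝ) * χ.φ x (π l)
    else 2 * χ.φ x (π l) + ((s (π l) : ℤ) : ℝ) := rfl

theorem mem_sub_source {x : E3} : x ∈ (χ.sub π k' s hmono hlt).φ.source ↔
    x ∈ χ.φ.source ∧ ∀ l : Fin 3, ¬ (l : ℕ) < k' →
      |2 * χ.φ x (π l) + ((s (π l) : ℤ) : ℝ)| < 1 := by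
  have h : x ∈ (χ.sub π k' s hmono hlt).φ.source ↔
      (x ∈ χ.φ.source ∧ True) ∧ ∀ l, |subAffine π k' s (χ.φ x) l| < 1 := Iff.rfl
  rw [h, and_true]
  refine and_congr_right fun hx => forall_congr' fun l => ?_
  rw [subAffine_apply]
  split_ifs with hl
  · simp only [hl, not_true, false_imp_iff, iff_true, abs_units_mul]
    exact χ.mem_target.mp (χ.φ.map_source hx) _
  · simp [hl]

/-- The factor translates "pointing out of the octant `s`" into "pointing towards increasing
coordinate", the form in which the coloring rules are stated. -/
theorem sub_slope {x : E3} (hx : x ∈ (χ.sub π k' s hmono hlt).φ.source)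
    {l : Fin 3} (hl : (l : ℕ) < k') (n : E3) : (χ.sub π k' s hmono hlt).slope l x n =
      ((s (π l) : ℤ) : ℝ) * χ.slope (π l) x n := by
  have d1 : DifferentiableAt ℝ χ.φ x :=
    (χ.smooth.contDiffAt (χ.φ.open_source.mem_nhds hx.1.1)).differentiableAt (by simp)
  have d2 : DifferentiableAt ℝ (χ.sub π k' s hmono hlt).φ x :=
    ((χ.sub π k' s hmono hlt).smooth.contDiffAt
      ((χ.sub π k' s hmono hlt).φ.open_source.mem_nhds hx)).differentiableAt (by simp)
  have e1 := ((EuclideanSpace.proj (𝕜 := ℝ) (π l) : E3 →L[ℝ] ℝ).hasFDerivAt.comp x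
    d1.hasFDerivAt).const_mul ((s (π l) : ℤ) : ℝ)
  have e2 := (EuclideanSpace.proj (𝕜 := ℝ) l : E3 →L[ℝ] ℝ).hasFDerivAt.comp x d2.hasFDerivAt
  have hfun : (fun y => ((s (π l) : ℤ) : ℝ) * (EuclideanSpace.proj (𝕜 := ℝ) (π l) ∘ χ.φ) y) =
      (EuclideanSpace.proj (𝕜 := ℝ) l : E3 →L[ℝ] ℝ) ∘ (χ.sub π k' s hmono hlt).φ := by
    funext y
    simp [sub_φ, hl]
  rw [hfun] at e1
  have := DFunLike.congr_fun (e2.unique e1) n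
  simpa [CubeChart.slope] using this

theorem sub_onSheet {p : E4} {l : Fin 3} (hl : (l : ℕ) < k')
    (hp : p.1 ∈ (χ.sub π k' s hmono hlt).φ.source) (h : χ.OnSheet (π l) p) :
    (χ.sub π k' s hmono hlt).OnSheet l p :=
  ⟨hp, (subAffine_eq_zero_iff hl).mpr h.2.1, h.2.2⟩

end Sub

end CrossingChart

/-! ### Normal orientations along a sheet of a chart -/

/-- The `i`-th standard basis vector. -/
noncomputable abbrev stdVec (i : Fin 3) : E3 := EuclideanSpace.single i (1 : ℝ)

theorem eq_sum_stdVec (w : E3) (i : Fin 3) :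
    w = w (i + 1) • stdVec (i + 1) + w (i + 2) • stdVec (i + 2) + w i • stdVec i := by
  ext l
  fin_cases i <;> fin_cases l <;> simp [stdVec]

theorem det3_swap (a b c : E3) : det3 b a c = -det3 a b c := by
  simp only [det3, Matrix.det_fin_three, Matrix.of_apply]
  simp
  ring

theorem det3_combination (a b c : E3) (α β γ : ℝ) :
    det3 a b (α • a + β • b + γ • c) = γ * det3 a b c := by
  simp only [det3, Matrix.det_fin_three, Matrix.of_apply]
  simp
  ring

theorem det3_ne_zero_of_leftInverse {A B : E3 →ₗ[ℝ] E3} (h : ∀ w, A (B w) = w) (i : Fin 3) :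
    det3 (B (stdVec (i + 1))) (B (stdVec (i + 2))) (B (stdVec i)) ≠ 0 := by
  -- `M` has the three given vectors as rows, and `N` is the matrix of `A` with its columns permuted
  -- by the same `σ`; thus `A ∘ B = id` becomes `M * N = 1`.
  let σ : Fin 3 → Fin 3 := ![i + 1, i + 2, i]
  let M : Matrix (Fin 3) (Fin 3) ℝ := Matrix.of fun l m => B (stdVec (σ l)) m
  let N : Matrix (Fin 3) (Fin 3) ℝ := Matrix.of fun m p => A (stdVec m) (σ p)
  have hσ : Function.Injective σ := by
    intro a b
    fin_cases i <;> fin_cases a <;> fin_cases b <;> simp [σ]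
  have hMN : M * N = 1 := by
    ext l p
    have h1 := h (stdVec (σ l))
    rw [eq_sum_stdVec (B (stdVec (σ l))) 0] at h1
    have h2 := congrArg (fun w : E3 => w (σ p)) h1
    simp only [map_add, map_smul, PiLp.add_apply, PiLp.smul_apply, smul_eq_mul] at h2
    rw [Matrix.mul_apply, Fin.sum_univ_three, Matrix.one_apply]
    simp only [M, N, Matrix.of_apply]
    simp only [zero_add] at h2
    have h3 : (stdVec (σ l)) (σ p) = if l = p then (1 : ℝ) else 0 := by
      simp only [stdVec, PiLp.single_apply, hσ.eq_iff, eq_comm]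
    rw [← h3, ← h2]
    ring
  have hdet := congrArg Matrix.det hMN
  rw [Matrix.det_mul, Matrix.det_one] at hdet
  have hM : det3 (B (stdVec (i + 1))) (B (stdVec (i + 2))) (B (stdVec i)) = M.det := by
    unfold det3
    congr 1
    ext l m
    fin_cases l <;> rfl
  rw [hM]
  exact left_ne_zero_of_mul_eq_one hdet

namespace CrossingChart

variable {F : Set E4} {k : ℕ} {q : E3} (χ : CrossingChart F k q)

/-- The derivative of the parametrization of the `i`-th sheet. -/
noncomputable def dlift (i : Fin 3) (y : E3) : E3 →L[ℝ] E4 := fderiv ℝ (χ.lift i) y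

theorem hasFDerivAt_lift (i : Fin 3) {y : E3} (hy : y ∈ χ.φ.target) :
    HasFDerivAt (χ.lift i) (χ.dlift i y) y :=
  (((χ.contDiffOn_lift i).contDiffAt (χ.φ.open_target.mem_nhds hy)).differentiableAt
    (by simp)).hasFDerivAt

theorem hasFDerivAt_φ {x : E3} (hx : x ∈ χ.φ.source) : HasFDerivAt χ.φ (fderiv ℝ χ.φ x) x :=
  ((χ.smooth.contDiffAt (χ.φ.open_source.mem_nhds hx)).differentiableAt (by simp)).hasFDerivAt

/-- The first component of the parametrization of any sheet is the inverse chart, so this is the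
chain rule for `φ.symm ∘ φ`. -/
theorem dlift_fst_fderiv (i : Fin 3) {x : E3} (hx : x ∈ χ.φ.source) (n : E3) :
    (χ.dlift i (χ.φ x) (fderiv ℝ χ.φ x n)).1 = n := by
  have h1 := (hasFDerivAt_fst (𝕜 := ℝ) (p := χ.lift i (χ.φ x))).comp x
    ((χ.hasFDerivAt_lift i (χ.φ.map_source hx)).comp x (χ.hasFDerivAt_φ hx))
  have h2 : HasFDerivAt (Prod.fst ∘ χ.lift i ∘ χ.φ) (ContinuousLinearMap.id ℝ E3) x := by
    refine (hasFDerivAt_id x).congr_of_eventuallyEq ?_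
    filter_upwards [χ.φ.open_source.mem_nhds hx] with z hz
    exact χ.φ.left_inv hz
  exact DFunLike.congr_fun (h1.unique h2) n

theorem fderiv_dlift_fst (i : Fin 3) {x : E3} (hx : x ∈ χ.φ.source) (w : E3) :
    fderiv ℝ χ.φ x (χ.dlift i (χ.φ x) w).1 = w := by
  have hy := χ.φ.map_source hx
  have hxl : (χ.lift i (χ.φ x)).1 = x := χ.φ.left_inv hx
  have h0 : HasFDerivAt χ.φ (fderiv ℝ χ.φ x) ((Prod.fst ∘ χ.lift i) (χ.φ x)) := by
    rw [Function.comp_apply, hxl]; exact χ.hasFDerivAt_φ hx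
  have h1 := h0.comp (χ.φ x) ((hasFDerivAt_fst (𝕜 := ℝ) (p := χ.lift i (χ.φ x))).comp (χ.φ x)
    (χ.hasFDerivAt_lift i hy))
  have h2 : HasFDerivAt (χ.φ ∘ Prod.fst ∘ χ.lift i) (ContinuousLinearMap.id ℝ E3) (χ.φ x) := by
    refine (hasFDerivAt_id _).congr_of_eventuallyEq ?_
    filter_upwards [χ.φ.open_target.mem_nhds hy] with z hz
    exact χ.φ.right_inv hz
  exact DFunLike.congr_fun (h1.unique h2) w

variable {χ}

theorem OnSheet.dlift_mem_tangentConeAt {i : Fin 3} {p : E4} (h : χ.OnSheet i p)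
    (hi : (i : ℕ) < k) {j : Fin 3} (hj : j ≠ i) :
    χ.dlift i (χ.φ p.1) (stdVec j) ∈ tangentConeAt ℝ F p := by
  let s : Set E3 := {y | y ∈ χ.φ.target ∧ y i = 0}
  have h1 := (χ.hasFDerivAt_lift i h.φ_mem).hasFDerivWithinAt (s := s).mapsTo_tangent_cone
  rw [← h.eq_lift] at h1
  refine tangentConeAt_mono ?_ (h1 ?_)
  · rintro _ ⟨y, hy, rfl⟩
    exact (χ.onSheet_lift hy.1 hy.2).mem hi
  -- The points with coordinates `φ p + 2⁻ⁿ e_j` stay in the plane `y_i = 0` because `j ≠ i`.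
  · refine mem_tangentConeAt_of_pow_smul (r := (1 / 2 : ℝ)) (by norm_num) (by norm_num) ?_
    have ht : Filter.Tendsto (fun n : ℕ => χ.φ p.1 + (1 / 2 : ℝ) ^ n • stdVec j) Filter.atTop
        (nhds (χ.φ p.1)) := by
      have := (tendsto_pow_atTop_nhds_zero_of_lt_one (r := (1 / 2 : ℝ)) (by norm_num)
        (by norm_num)).smul_const (stdVec j)
      simpa using tendsto_const_nhds.add this
    filter_upwards [ht.eventually (χ.φ.open_target.mem_nhds h.φ_mem)] with n hn
    refine ⟨hn, ?_⟩
    simp [stdVec, h.2.1, hj.symm]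

/-- On `F` near `p` the `i`-th chart coordinate vanishes and `lift ∘ φ ∘ fst` is the identity;
derivatives of maps that agree on `F` agree on tangent vectors of `F`. -/
theorem OnSheet.tangentConeAt_eq {i : Fin 3} {p : E4} (h : χ.OnSheet i p) (hi : (i : ℕ) < k)
    {v : E4} (hv : v ∈ tangentConeAt ℝ F p) :
    (fderiv ℝ χ.φ p.1 v.1) i = 0 ∧ χ.dlift i (χ.φ p.1) (fderiv ℝ χ.φ p.1 v.1) = v := by
  have hnear : ∀ᶠ z in nhdsWithin p F, χ.OnSheet i z := by
    filter_upwards [mem_nhdsWithin_of_mem_nhds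
      ((χ.isOpen_offOthers i).mem_nhds (h.mem_offOthers hi)), self_mem_nhdsWithin] with z hz hzF
    exact χ.onSheet_of_mem_offOthers hzF hz
  have hφ := (χ.hasFDerivAt_φ h.1).comp p (hasFDerivAt_fst (𝕜 := ℝ) (p := p))
  constructor
  · have h1 := ((EuclideanSpace.proj (𝕜 := ℝ) i : E3 →L[ℝ] ℝ).hasFDerivAt.comp p
      hφ).hasFDerivWithinAt (s := F)
    have h2 : HasFDerivWithinAt ((EuclideanSpace.proj (𝕜 := ℝ) i : E3 →L[ℝ] ℝ) ∘ χ.φ ∘ Prod.fst)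
        (0 : E4 →L[ℝ] ℝ) F p := by
      refine (hasFDerivWithinAt_const (0 : ℝ) p F).congr_of_eventuallyEq ?_ h.2.1
      filter_upwards [hnear] with z hz
      exact hz.2.1
    exact h1.unique_on h2 hv
  · have h1 := ((χ.hasFDerivAt_lift i h.φ_mem).comp p hφ).hasFDerivWithinAt (s := F)
    have h2 : HasFDerivWithinAt (χ.lift i ∘ χ.φ ∘ Prod.fst) (ContinuousLinearMap.id ℝ E4) F p := by
      refine (hasFDerivWithinAt_id p F).congr_of_eventuallyEq ?_ h.eq_lift.symm
      filter_upwards [hnear] with z hz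
      exact hz.eq_lift.symm
    exact h1.unique_on h2 hv

end CrossingChart

/-- Carries the nonvanishing of an orientation form on some tangent pair over to the coordinate
frame of a chart. -/
theorem alternating_combination (η : E4 [⋀^Fin 2]→L[ℝ] ℝ) (a b : E4) (α β γ δ : ℝ) :
    η ![α • a + β • b, γ • a + δ • b] = (α * δ - β * γ) * η ![a, b] := by
  have h0 : ∀ c : E4, η ![c, c] = 0 := fun c =>
    η.map_eq_zero_of_eq ![c, c] (i := 0) (j := 1) rfl (by decide)
  have hl : ∀ (r t : ℝ) (c d e : E4), η ![r • c + t • d, e] = r * η ![c, e] + t * η ![d, e] := by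
    intro r t c d e
    have hu : ∀ z : E4, Function.update ![c, e] 0 z = ![z, e] := fun z => by
      ext1 l
      fin_cases l <;> rfl
    have h1 := η.map_update_add ![c, e] 0 (r • c) (t • d)
    rw [η.map_update_smul, η.map_update_smul] at h1
    simpa only [hu, smul_eq_mul] using h1
  have hr : ∀ (r t : ℝ) (c d e : E4), η ![e, r • c + t • d] = r * η ![e, c] + t * η ![e, d] := by
    intro r t c d e
    have hu : ∀ z : E4, Function.update ![e, c] 1 z = ![e, z] := fun z => by
      ext1 l
      fin_cases l <;> rfl
    have h1 := η.map_update_add ![e, c] 1 (r • c) (t • d)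
    rw [η.map_update_smul, η.map_update_smul] at h1
    simpa only [hu, smul_eq_mul] using h1
  have hs : η ![b, a] = -η ![a, b] := by
    have := h0 ((1 : ℝ) • a + (1 : ℝ) • b)
    rw [hl, hr, hr, h0, h0] at this
    linarith
  rw [hl, hr, hr, h0, h0, hs]
  ring

namespace Diagram

variable {D : Diagram} {k : ℕ} {q : E3}

/-- Normals live on semi-sheets, which the double curves separate, so continuity of the normals
cannot compare the two sides of a double curve. The 2-form, however, is continuous along the whole
sheet, and with a determinant it gives a continuous nowhere vanishing function on the coordinate
plane that has the sign of the slope. -/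
theorem exists_sign_slope (o : D.Orientation) (χ : CrossingChart D.F k q) {i : Fin 3}
    (hi : (i : ℕ) < k) : ∃ σ : ℤˣ, ∀ p : D.semiSheets, χ.OnSheet i p → ∀ n, o.IsNormal p n →
      0 < ((σ : ℤ) : ℝ) * χ.slope i p.1.1 n := by
  let P : Set E3 := {y | y ∈ χ.φ.target ∧ y i = 0}
  have hPF : ∀ y : P, χ.lift i y.1 ∈ D.F := fun y => (χ.onSheet_lift y.2.1 y.2.2).mem hi
  let V : P → Fin 3 → E4 := fun y j => χ.dlift i y.1 (stdVec j)
  -- The first factor tells whether the coordinate frame of the tangent plane is positive, the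
  -- second whether that frame followed by the `i`-th direction is right-handed.
  let f : P → ℝ := fun y => o.form ⟨χ.lift i y.1, hPF y⟩ ![V y (i + 1), V y (i + 2)] *
    det3 (V y (i + 1)).1 (V y (i + 2)).1 (V y i).1
  have hi1 : i + 1 ≠ i := by fin_cases i <;> decide
  have hi2 : i + 2 ≠ i := by fin_cases i <;> decide
  have hcont : Continuous f := by
    have hV : ∀ j, Continuous fun y => V y j := by
      intro j
      have h1 : ContinuousOn (χ.dlift i) χ.φ.target :=
        (χ.contDiffOn_lift i).continuousOn_fderiv_of_isOpen χ.φ.open_target (by simp)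
      have h2 : Continuous fun y : P => χ.dlift i y.1 :=
        h1.comp_continuous continuous_subtype_val fun y => y.2.1
      exact h2.clm_apply continuous_const
    have hl : Continuous fun y : P => (⟨χ.lift i y.1, hPF y⟩ : D.F) :=
      ((χ.continuousOn_lift i).comp_continuous continuous_subtype_val
        fun y => y.2.1).subtype_mk _
    have hform := o.continuous_form.comp hl
    refine Continuous.mul (Continuous.eval hform ?_) ?_
    · refine continuous_pi fun l => ?_
      fin_cases l
      · exact hV (i + 1)
      · exact hV (i + 2)
    · have hVc : ∀ j m, Continuous fun y => (V y j).1 m := fun j m => by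
        have := hV j
        fun_prop
      simp only [det3, Matrix.det_fin_three, Matrix.of_apply]
      simp only [Matrix.cons_val]
      have a := hVc (i + 1)
      have b := hVc (i + 2)
      have c := hVc i
      fun_prop
  have hdet : ∀ y : P, det3 (V y (i + 1)).1 (V y (i + 2)).1 (V y i).1 ≠ 0 := by
    intro y
    have hx := χ.φ.map_target y.2.1
    refine det3_ne_zero_of_leftInverse (A := (fderiv ℝ χ.φ (χ.φ.symm y.1)).toLinearMap)
      (B := (LinearMap.fst ℝ E3 ℝ).comp (χ.dlift i y.1).toLinearMap) (fun w => ?_) i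
    have := χ.fderiv_dlift_fst i hx w
    rwa [χ.φ.right_inv y.2.1] at this
  have hform : ∀ y : P, o.form ⟨χ.lift i y.1, hPF y⟩ ![V y (i + 1), V y (i + 2)] ≠ 0 := by
    intro y h0
    obtain ⟨v, hv, w, hw, hvw⟩ := o.form_ne ⟨χ.lift i y.1, hPF y⟩
    have hon := χ.onSheet_lift y.2.1 y.2.2
    have key : ∀ v ∈ tangentConeAt ℝ D.F (χ.lift i y.1), ∃ α β : ℝ,
        v = α • V y (i + 1) + β • V y (i + 2) := by
      intro v hv
      obtain ⟨h1, h2⟩ := hon.tangentConeAt_eq hi hv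
      rw [χ.φ_lift y.2.1] at h2
      rw [eq_sum_stdVec (fderiv ℝ χ.φ (χ.lift i y.1).1 v.1) i, h1, zero_smul, add_zero, map_add,
        map_smul, map_smul] at h2
      exact ⟨_, _, h2.symm⟩
    obtain ⟨α, β, rfl⟩ := key v hv
    obtain ⟨γ, δ, rfl⟩ := key w hw
    rw [alternating_combination, h0, mul_zero] at hvw
    exact hvw rfl
  have hne : ∀ y, f y ≠ 0 := fun y => mul_ne_zero (hform y) (hdet y)
  have hpre : PreconnectedSpace P :=
    Subtype.preconnectedSpace (χ.convex_plane i).isPreconnected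
  -- The plane inside the cube is convex, so a change of sign would force a zero.
  have hsign : (∀ y, 0 < f y) ∨ ∀ y, f y < 0 := by
    by_contra hcon
    rw [not_or] at hcon
    push Not at hcon
    obtain ⟨⟨y, hy⟩, ⟨z, hz⟩⟩ := hcon
    obtain ⟨w, hw⟩ := mem_range_of_exists_le_of_exists_ge hcont ⟨y, hy⟩ ⟨z, hz⟩
    exact hne w hw
  have hslope : ∀ p : D.semiSheets, (hp : χ.OnSheet i p) → ∀ n, o.IsNormal p n →
      0 < f ⟨χ.φ p.1.1, hp.φ_mem, hp.2.1⟩ * χ.slope i p.1.1 n := by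
    intro p hp n hn
    -- Modulo the tangent plane, `n` is its slope times the image of the `i`-th basis vector.
    have hd : det3 (V ⟨χ.φ p.1.1, hp.φ_mem, hp.2.1⟩ (i + 1)).1
        (V ⟨χ.φ p.1.1, hp.φ_mem, hp.2.1⟩ (i + 2)).1 n = χ.slope i p.1.1 n *
          det3 (V ⟨χ.φ p.1.1, hp.φ_mem, hp.2.1⟩ (i + 1)).1
          (V ⟨χ.φ p.1.1, hp.φ_mem, hp.2.1⟩ (i + 2)).1
          (V ⟨χ.φ p.1.1, hp.φ_mem, hp.2.1⟩ i).1 := by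
      have h1 := χ.dlift_fst_fderiv i hp.1 n
      rw [eq_sum_stdVec (fderiv ℝ χ.φ p.1.1 n) i, map_add, map_add, map_smul, map_smul,
        map_smul] at h1
      rw [← det3_combination _ _ _ ((fderiv ℝ χ.φ p.1.1 n) (i + 1))
        ((fderiv ℝ χ.φ p.1.1 n) (i + 2))]
      exact congrArg _ h1.symm
    have hV1 := hp.dlift_mem_tangentConeAt hi hi1
    have hV2 := hp.dlift_mem_tangentConeAt hi hi2
    have hpeq : (⟨χ.lift i (χ.φ p.1.1), hPF ⟨χ.φ p.1.1, hp.φ_mem, hp.2.1⟩⟩ : D.F) =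
        ⟨p.1, p.2.1⟩ := Subtype.ext hp.eq_lift.symm
    have hf := hform ⟨χ.φ p.1.1, hp.φ_mem, hp.2.1⟩
    simp only [f]
    rw [mul_assoc, mul_comm (det3 _ _ _), ← hd]
    simp only [hpeq] at hf ⊢
    -- If the coordinate frame is negative, exchanging its two vectors gives a positive basis to
    -- which the definition of the normal applies.
    rcases lt_or_gt_of_ne hf with hlt | hlt
    · have hswap : o.form ⟨p.1, p.2.1⟩ ![χ.dlift i (χ.φ p.1.1) (stdVec (i + 2)),
          χ.dlift i (χ.φ p.1.1) (stdVec (i + 1))] = -o.form ⟨p.1, p.2.1⟩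
          ![χ.dlift i (χ.φ p.1.1) (stdVec (i + 1)), χ.dlift i (χ.φ p.1.1) (stdVec (i + 2))] := by
        have := alternating_combination (o.form ⟨p.1, p.2.1⟩)
          (χ.dlift i (χ.φ p.1.1) (stdVec (i + 1))) (χ.dlift i (χ.φ p.1.1) (stdVec (i + 2))) 0 1 1 0
        simpa using this
      have := hn.2 _ hV2 _ hV1 (by rw [hswap]; exact neg_pos.mpr hlt)
      rw [det3_swap] at this
      exact mul_pos_of_neg_of_neg hlt (neg_pos.mp this)
    · exact mul_pos hlt (hn.2 _ hV1 _ hV2 hlt)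
  rcases hsign with hs | hs
  · refine ⟨1, fun p hp n hn => ?_⟩
    have := pos_of_mul_pos_right (hslope p hp n hn) (hs _).le
    simpa using this
  · refine ⟨-1, fun p hp n hn => ?_⟩
    have := neg_of_mul_pos_right (hslope p hp n hn) (hs _).le
    simpa using this

end Diagram

/-! ### Connecting points of a sheet -/

theorem connectedComponents_mk_eq_of_continuousOn {A B : Type*} [TopologicalSpace A]
    [TopologicalSpace B] {K : Set A} {S : Set B} {f : A → B} (hK : IsPreconnected K)
    (hf : ContinuousOn f K) (hKS : Set.MapsTo f K S) {y z : A} (hy : y ∈ K) (hz : z ∈ K) :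
    ConnectedComponents.mk (⟨f y, hKS hy⟩ : S) = ConnectedComponents.mk (⟨f z, hKS hz⟩ : S) := by
  have : PreconnectedSpace K := Subtype.preconnectedSpace hK
  have hg : Continuous (hKS.restrict f K S) := hf.mapsToRestrict hKS
  rw [ConnectedComponents.coe_eq_coe']
  exact (isPreconnected_univ.image _ hg.continuousOn).subset_connectedComponent
    ⟨⟨z, hz⟩, trivial, rfl⟩ ⟨⟨y, hy⟩, trivial, rfl⟩

/-- A locally constant function on a dense subset `S` of `S'` that is constant near every point of
`S'` factors through the components of `S'`. -/
theorem exists_connectedComponents_extension {A : Type*} [TopologicalSpace A] {S S' : Set A}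
    {X : Type*} (hS : S ⊆ S') (hd : S' ⊆ closure S) (f : S → X)
    (hf : ∀ p ∈ S', ∃ U, IsOpen U ∧ p ∈ U ∧ ∃ x, ∀ e : S, e.1 ∈ U → f e = x) :
    ∃ g : ConnectedComponents S' → X, ∀ e : S, g (ConnectedComponents.mk ⟨e.1, hS e.2⟩) = f e := by
  choose U hU hpU x hx using hf
  -- With the discrete topology, locally constant maps are continuous and factor through components.
  let _ : TopologicalSpace X := ⊥
  have : DiscreteTopology X := ⟨rfl⟩
  let g : S' → X := fun p => x p.1 p.2
  have hg : Continuous g := by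
    refine IsLocallyConstant.continuous ((IsLocallyConstant.iff_exists_open g).mpr fun p => ?_)
    refine ⟨Subtype.val ⁻¹' U p.1 p.2, (hU _ _).preimage continuous_subtype_val, hpU _ _, ?_⟩
    intro p' hp'
    -- Two of the neighbourhoods meet in a nonempty open set, which contains a point of the dense
    -- set `S`; there the two constants agree.
    obtain ⟨e, he, heS⟩ := mem_closure_iff.mp (hd p'.2) _ ((hU p.1 p.2).inter (hU p'.1 p'.2))
      ⟨hp', hpU _ _⟩
    exact (hx _ p'.2 ⟨e, heS⟩ he.2).symm.trans (hx _ p.2 ⟨e, heS⟩ he.1)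
  exact ⟨hg.connectedComponentsLift, fun e => (hx _ (hS e.2) e (hpU _ _)).symm⟩

/-- The chart coordinates of a point on the `i`-th coordinate plane that faces the octant `s`. -/
noncomputable def facePos (s : Fin 3 → ℤˣ) (i : Fin 3) : E3 :=
  WithLp.toLp 2 fun j => if j = i then 0 else -((s j : ℤ) : ℝ) / 2

/-- The chart coordinates of a point in the octant `s`. -/
noncomputable def cornerPos (s : Fin 3 → ℤˣ) : E3 :=
  WithLp.toLp 2 fun j => -((s j : ℤ) : ℝ) / 2

theorem facePos_self (s : Fin 3 → ℤˣ) (i : Fin 3) : facePos s i i = 0 := if_pos rfl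

theorem facePos_ne (s : Fin 3 → ℤˣ) {i j : Fin 3} (h : j ≠ i) :
    facePos s i j = -((s j : ℤ) : ℝ) / 2 := if_neg h

theorem abs_facePos_lt (s : Fin 3 → ℤˣ) (i j : Fin 3) : |facePos s i j| < 1 := by
  by_cases h : j = i
  · rw [h, facePos_self]; simp
  · rw [facePos_ne s h]; exact Diagram.abs_sign_half _

theorem units_mul_neg_half (e : ℤˣ) : ((e : ℤ) : ℝ) * (-((e : ℤ) : ℝ) / 2) = -1 / 2 := by
  rcases Int.units_eq_one_or e with rfl | rfl <;> norm_num

/-- The sign vector of the octant on the other side of the `m`-th coordinate plane. -/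
def flip (s : Fin 3 → ℤˣ) (m : Fin 3) : Fin 3 → ℤˣ := Function.update s m (-s m)

theorem flip_self (s : Fin 3 → ℤˣ) (m : Fin 3) : flip s m m = -s m := Function.update_self ..

theorem flip_ne (s : Fin 3 → ℤˣ) {m j : Fin 3} (h : j ≠ m) : flip s m j = s j :=
  Function.update_of_ne h ..

theorem facePos_flip_self (s : Fin 3 → ℤˣ) (m : Fin 3) : facePos (flip s m) m = facePos s m := by
  ext j
  by_cases h : j = m
  · rw [h, facePos_self, facePos_self]
  · rw [facePos_ne _ h, facePos_ne _ h, flip_ne s h]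

/-! ### Faces and sectors of a chart, and the sheets and semi-sheets that contain them -/

namespace CrossingChart

variable {F : Set E4} {k : ℕ} {q : E3} (χ : CrossingChart F k q)

theorem facePos_mem (s : Fin 3 → ℤˣ) (i : Fin 3) : facePos s i ∈ χ.φ.target :=
  χ.mem_target.mpr (abs_facePos_lt s i)

theorem cornerPos_mem (s : Fin 3 → ℤˣ) : cornerPos s ∈ χ.φ.target :=
  χ.mem_target.mpr fun _ => Diagram.abs_sign_half _

theorem onSheet_face (s : Fin 3 → ℤˣ) (i : Fin 3) : χ.OnSheet i (χ.lift i (facePos s i)) :=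
  χ.onSheet_lift (χ.facePos_mem s i) (facePos_self s i)

theorem φ_face (s : Fin 3 → ℤˣ) (i : Fin 3) : χ.φ (χ.lift i (facePos s i)).1 = facePos s i :=
  χ.φ_lift (χ.facePos_mem s i)

/-- The part of the `i`-th coordinate plane opposite to the signs `s`, for the signs that belong to
the other sheets of the chart. -/
def sector (s : Fin 3 → ℤˣ) (i : Fin 3) : Set E3 :=
  {y | y ∈ χ.φ.target ∧ y i = 0 ∧ ∀ j : Fin 3, (j : ℕ) < k → j ≠ i → ((s j : ℤ) : ℝ) * y j < 0}

theorem convex_sector (s : Fin 3 → ℤˣ) (i : Fin 3) : Convex ℝ (χ.sector s i) := by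
  intro y hy z hz a b ha hb hab
  refine ⟨χ.convex_target hy.1 hz.1 ha hb hab, by simp [hy.2.1, hz.2.1], fun j hj hji => ?_⟩
  have := (convex_Iio (0 : ℝ)) (hy.2.2 j hj hji) (hz.2.2 j hj hji) ha hb hab
  simp only [Set.mem_Iio, smul_eq_mul] at this
  simp only [PiLp.add_apply, PiLp.smul_apply, smul_eq_mul]
  linarith

theorem facePos_mem_sector (s : Fin 3 → ℤˣ) (i : Fin 3) : facePos s i ∈ χ.sector s i := by
  refine ⟨χ.facePos_mem s i, facePos_self s i, fun j _ hji => ?_⟩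
  rw [facePos_ne s hji, units_mul_neg_half]
  norm_num

end CrossingChart

namespace Diagram

variable {D : Diagram} {k : ℕ} {q : E3}

theorem sector_mapsTo (χ : CrossingChart D.F k q) (s : Fin 3 → ℤˣ) {i : Fin 3}
    (hi : (i : ℕ) < k) : Set.MapsTo (χ.lift i) (χ.sector s i) D.semiSheets := by
  intro y hy
  refine mem_semiSheets_of_onSheet (χ.onSheet_lift hy.1 hy.2.1) hi fun j hj hji h0 => ?_
  rw [χ.φ_lift hy.1] at h0
  have := hy.2.2 j hj hji
  rw [h0, mul_zero] at this
  exact lt_irrefl _ this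

/-- A point on the semi-sheet of the `i`-th sheet of a chart that faces the octant `s`. -/
noncomputable def chartFace (χ : CrossingChart D.F k q) (s : Fin 3 → ℤˣ) {i : Fin 3}
    (hi : (i : ℕ) < k) : D.semiSheets :=
  ⟨χ.lift i (facePos s i), sector_mapsTo χ s hi (χ.facePos_mem_sector s i)⟩

/-- A sector is convex and its lift avoids all double points, so the lift lies in one semi-sheet. -/
theorem semiSheetOf_eq_of_mem_sector (χ : CrossingChart D.F k q) (s : Fin 3 → ℤˣ) {i : Fin 3}
    (hi : (i : ℕ) < k) {e : D.semiSheets} (he : χ.OnSheet i e) (hes : χ.φ e.1.1 ∈ χ.sector s i) :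
    D.semiSheetOf e = D.semiSheetOf (chartFace χ s hi) := by
  have h := connectedComponents_mk_eq_of_continuousOn (χ.convex_sector s i).isPreconnected
    ((χ.continuousOn_lift i).mono fun y hy => hy.1) (sector_mapsTo χ s hi) hes
    (χ.facePos_mem_sector s i)
  have h' : e = ⟨χ.lift i (χ.φ e.1.1), sector_mapsTo χ s hi hes⟩ := Subtype.ext he.eq_lift
  rw [h']
  exact h

/-- The top sheet contains no lower points, so it stays connected over its entire coordinate plane.
-/
theorem sheetOf_eq_of_onSheet_zero (χ : CrossingChart D.F k q) (hk : 0 < k) {p p' : D.sheets}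
    (hp : χ.OnSheet 0 p) (hp' : χ.OnSheet 0 p') :
    (ConnectedComponents.mk p : D.Sheet) = ConnectedComponents.mk p' := by
  have hm : Set.MapsTo (χ.lift 0) {y : E3 | y ∈ χ.φ.target ∧ y 0 = 0} D.sheets := fun y hy =>
    mem_sheets_of_onSheet_zero (χ.onSheet_lift hy.1 hy.2) hk
  have h := connectedComponents_mk_eq_of_continuousOn (χ.convex_plane 0).isPreconnected
    ((χ.continuousOn_lift 0).mono fun y hy => hy.1) hm ⟨hp.φ_mem, hp.2.1⟩ ⟨hp'.φ_mem, hp'.2.1⟩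
  have h1 : p = ⟨χ.lift 0 (χ.φ p.1.1), hm ⟨hp.φ_mem, hp.2.1⟩⟩ := Subtype.ext hp.eq_lift
  have h2 : p' = ⟨χ.lift 0 (χ.φ p'.1.1), hm ⟨hp'.φ_mem, hp'.2.1⟩⟩ := Subtype.ext hp'.eq_lift
  rw [h1, h2]
  exact h

/-- In Whitney's umbrella the parameters `(τ, 0)` and `(-τ, 0)` have the same projection; the lower
of the two points tends to the branch point as `τ` tends to `0`. -/
theorem mem_closure_lower_of_branchChart {p : E4} (hp : p ∈ D.F) (χ : BranchChart D.F p.1) :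
    p ∈ closure D.lower := by
  obtain ⟨u, v, h1, h2⟩ := (χ.mem_iff p χ.mem_source).mp hp
  rw [χ.map_center] at h1
  have hv : v = 0 := by simpa using (congrArg (fun y : E3 => y 2) h1).symm
  have hu : u = 0 := by simpa using (congrArg (fun y : E3 => y 0) h1).symm
  subst hu hv
  have hO : IsOpen (Set.Ioo (-1 : ℝ) 1 ×ˢ Set.Ioo (-1 : ℝ) 1) := isOpen_Ioo.prod isOpen_Ioo
  have hch : ContinuousAt χ.height (0, 0) :=
    (χ.height_smooth.continuousOn).continuousAt (hO.mem_nhds (by simp))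
  have h0t : (0 : E3) ∈ χ.φ.target := by rw [χ.target_eq]; intro i; simp
  have hcs : ContinuousAt χ.φ.symm 0 := χ.φ.continuousAt_symm h0t
  have hsym : χ.φ.symm 0 = p.1 := by rw [← χ.map_center, χ.φ.left_inv χ.mem_source]
  -- The minimum selects the lower point and is continuous at `0`, although which parameter gives it
  -- may depend on `τ`.
  let P : ℝ → E4 := fun τ => (χ.φ.symm !₂[τ ^ 2, 0, 0],
    min (χ.height (τ, 0)) (χ.height (-τ, 0)))
  have hPc : ContinuousAt P 0 := by
    have c1 : Continuous fun τ : ℝ => (!₂[τ ^ 2, 0, 0] : E3) := by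
      refine (PiLp.continuous_toLp 2 _).comp (continuous_pi fun l => ?_)
      fin_cases l <;> simp <;> fun_prop
    have e1 : (!₂[(0 : ℝ) ^ 2, 0, 0] : E3) = 0 := by ext l; fin_cases l <;> simp
    have e2 : ((-0 : ℝ), (0 : ℝ)) = (0, 0) := by simp
    refine ContinuousAt.prodMk ?_ (Filter.Tendsto.min ?_ ?_)
    · exact ContinuousAt.comp (g := χ.φ.symm) (by rw [e1]; exact hcs) c1.continuousAt
    · exact ContinuousAt.comp (g := χ.height) hch (by fun_prop)
    · exact ContinuousAt.comp (g := χ.height) (f := fun τ : ℝ => (-τ, (0 : ℝ)))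
        (by rw [e2]; exact hch) (by fun_prop)
  have hP0 : P 0 = p := by
    have e1 : (!₂[(0 : ℝ) ^ 2, 0, 0] : E3) = 0 := by ext l; fin_cases l <;> simp
    refine Prod.ext ?_ ?_
    · simp only [P]; rw [e1, hsym]
    · simp [P, h2]
  have ht : Filter.Tendsto P (nhdsWithin 0 (Set.Ioi 0)) (nhds p) := by
    have := hPc.tendsto.mono_left (nhdsWithin_le_nhds (s := Set.Ioi 0))
    rwa [hP0] at this
  refine mem_closure_of_tendsto ht ?_
  filter_upwards [Ioo_mem_nhdsGT (zero_lt_one' ℝ)] with τ hτ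
  have hτt : (!₂[τ ^ 2, 0, 0] : E3) ∈ χ.φ.target := by
    rw [χ.target_eq]
    have : |τ| < 1 := by rw [abs_of_pos hτ.1]; exact hτ.2
    intro i
    fin_cases i <;> simp [this]
  have hsrc := χ.φ.map_target hτt
  have hF : ∀ w : ℝ, w ^ 2 = τ ^ 2 → (χ.φ.symm !₂[τ ^ 2, 0, 0], χ.height (w, 0)) ∈ D.F := by
    intro w hw
    refine (χ.mem_iff (χ.φ.symm !₂[τ ^ 2, 0, 0], χ.height (w, 0)) hsrc).mpr ⟨w, 0, ?_, rfl⟩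
    change χ.φ (χ.φ.symm _) = _
    rw [χ.φ.right_inv hτt, hw, mul_zero]
  have hne := χ.height_ne τ hτ
  rcases lt_or_gt_of_ne hne with hlt | hlt
  · have hmin : P τ = (χ.φ.symm !₂[τ ^ 2, 0, 0], χ.height (τ, 0)) :=
      Prod.ext rfl (min_eq_left hlt.le)
    rw [hmin]
    exact ⟨hF τ rfl, _, hF (-τ) (neg_sq τ), rfl, hlt⟩
  · have hmin : P τ = (χ.φ.symm !₂[τ ^ 2, 0, 0], χ.height (-τ, 0)) :=
      Prod.ext rfl (min_eq_right hlt.le)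
    rw [hmin]
    exact ⟨hF (-τ) (neg_sq τ), _, hF τ rfl, rfl, hlt⟩

/-- All coordinates vanish at the centre, so every sheet of the chart passes over it; a point there
that is not on the top sheet is a lower point. -/
theorem onSheet_zero_of_mem_sheets {p : E4} (hp : p ∈ D.sheets) (χ : CrossingChart D.F k p.1) :
    0 < k ∧ χ.OnSheet 0 p := by
  obtain ⟨i, hi, h⟩ := χ.exists_onSheet hp.1 χ.mem_source
  have hk : 0 < k := lt_of_le_of_lt (Nat.zero_le _) hi
  refine ⟨hk, ?_⟩
  by_cases hi0 : i = 0
  · exact hi0 ▸ h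
  have h0 : χ.φ p.1 0 = 0 := by rw [χ.map_center]; rfl
  refine absurd (subset_closure (s := D.lower) ⟨hp.1, (p.1, χ.height 0 p.1), ?_, rfl, ?_⟩) hp.2
  · exact (χ.mem_iff (p.1, χ.height 0 p.1) χ.mem_source).mpr ⟨0, hk, h0, rfl⟩
  · rw [h.2.2]
    exact χ.height_lt 0 i (Fin.pos_of_ne_zero hi0) hi p.1 χ.mem_source h0 h.2.1

theorem exists_chart_of_mem_sheets {p : E4} (hp : p ∈ D.sheets) :
    ∃ (k : ℕ) (χ : CrossingChart D.F k p.1), 0 < k ∧ χ.OnSheet 0 p := by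
  rcases D.generic p hp.1 with ⟨⟨χ⟩⟩ | ⟨⟨χ⟩⟩ | ⟨⟨χ⟩⟩ | ⟨⟨χ⟩⟩
  · exact ⟨1, χ, onSheet_zero_of_mem_sheets hp χ⟩
  · exact ⟨2, χ, onSheet_zero_of_mem_sheets hp χ⟩
  · exact ⟨3, χ, onSheet_zero_of_mem_sheets hp χ⟩
  · exact absurd (mem_closure_lower_of_branchChart hp.1 χ) hp.2

theorem exists_sheetOf_eq (σ : D.Sheet) : ∃ e : D.semiSheets, D.sheetOf e = σ := by
  obtain ⟨p, rfl⟩ := ConnectedComponents.surjective_coe σ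
  obtain ⟨k, χ, hk, h⟩ := exists_chart_of_mem_sheets p.2
  exact ⟨chartFace χ 1 (i := 0) hk, sheetOf_eq_of_onSheet_zero χ hk (χ.onSheet_face 1 0) h⟩

/-- From the centre of a chart, the ray through `facePos 1 0` immediately leaves the planes of all
other sheets, while staying on the top sheet. -/
theorem sheets_subset_closure : D.sheets ⊆ closure D.semiSheets := by
  intro p hp
  obtain ⟨k, χ, hk, h⟩ := exists_chart_of_mem_sheets hp
  have hp0 : χ.lift 0 0 = p := by rw [← χ.map_center, ← h.eq_lift]
  have h0t : (0 : E3) ∈ χ.φ.target := by rw [← χ.map_center]; exact h.φ_mem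
  have hc : ContinuousAt (fun τ : ℝ => χ.lift 0 (τ • facePos 1 0)) 0 := by
    refine ContinuousAt.comp (g := χ.lift 0) ?_ (by fun_prop)
    rw [zero_smul]
    exact (χ.continuousOn_lift 0).continuousAt (χ.φ.open_target.mem_nhds h0t)
  have ht : Filter.Tendsto (fun τ : ℝ => χ.lift 0 (τ • facePos 1 0)) (nhdsWithin 0 (Set.Ioi 0))
      (nhds p) := by
    have := hc.tendsto.mono_left (nhdsWithin_le_nhds (s := Set.Ioi 0))
    rwa [zero_smul, hp0] at this
  refine mem_closure_of_tendsto ht ?_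
  filter_upwards [Ioo_mem_nhdsGT (zero_lt_one' ℝ)] with τ hτ
  refine sector_mapsTo χ 1 hk ⟨?_, by simp [facePos_self], fun j _ hj0 => ?_⟩
  · have := χ.convex_target h0t (χ.facePos_mem 1 0) (sub_nonneg.mpr hτ.2.le) hτ.1.le
      (sub_add_cancel 1 τ)
    simpa using this
  · simp only [PiLp.smul_apply, facePos_ne 1 hj0, smul_eq_mul]
    have := hτ.1
    simp
    linarith

end Diagram

/-! ### Colors and labels of adjacent octants -/

open SymmetricQuandle (ρ)

namespace CrossingChart

variable {F : Set E4} {k : ℕ} {q : E3} (χ : CrossingChart F k q) {π : Equiv.Perm (Fin 3)} {k' : ℕ}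
    {s : Fin 3 → ℤˣ} (hmono : ∀ l l' : Fin 3, l < l' → (l' : ℕ) < k' → π l < π l')
    (hlt : ∀ l : Fin 3, (l : ℕ) < k' → (π l : ℕ) < k)

/-- In a halved direction the new coordinate of the face point is `2(-s/2) + s = 0`. -/
theorem face_mem_sub_source {s' : Fin 3 → ℤˣ} {i : Fin 3}
    (h : ∀ l : Fin 3, ¬ (l : ℕ) < k' → π l ≠ i ∧ s' (π l) = s (π l)) :
    (χ.lift i (facePos s' i)).1 ∈ (χ.sub π k' s hmono hlt).φ.source := by
  refine (χ.mem_sub_source hmono hlt).mpr ⟨(χ.onSheet_face s' i).1, fun l hl => ?_⟩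
  rw [χ.φ_face, facePos_ne _ (h l hl).1, (h l hl).2]
  ring_nf
  simp

theorem corner_mem_sub_source {s' : Fin 3 → ℤˣ}
    (h : ∀ l : Fin 3, ¬ (l : ℕ) < k' → s' (π l) = s (π l)) :
    χ.φ.symm (cornerPos s') ∈ (χ.sub π k' s hmono hlt).φ.source := by
  have hc := χ.cornerPos_mem s'
  refine (χ.mem_sub_source hmono hlt).mpr ⟨χ.φ.map_target hc, fun l hl => ?_⟩
  rw [χ.φ.right_inv hc, ← h l hl]
  change |2 * (-((s' (π l) : ℤ) : ℝ) / 2) + _| < 1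
  ring_nf
  simp

end CrossingChart

theorem exists_perm_of_ne : ∀ i m : Fin 3, i ≠ m → ∃ π : Equiv.Perm (Fin 3), π 0 = i ∧ π 1 = m := by
  decide

theorem units_mul_neg_half_neg (e : ℤˣ) :
    ((e : ℤ) : ℝ) * (-(((-e : ℤˣ) : ℤ) : ℝ) / 2) = 1 / 2 := by
  rcases Int.units_eq_one_or e with rfl | rfl <;> norm_num

namespace Diagram

variable {D : Diagram} {k : ℕ} {q : E3} {o : D.Orientation}

/-- Normals of one orientation are coherent along a sheet of the chart. With `p = p'` this also
compares two normals at a point and shows that slopes do not vanish. -/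
theorem slope_mul_slope_pos (χ : CrossingChart D.F k q) {i : Fin 3} (hi : (i : ℕ) < k)
    {p p' : D.semiSheets} (hp : χ.OnSheet i p) (hp' : χ.OnSheet i p') {n n' : E3}
    (hn : o.IsNormal p n) (hn' : o.IsNormal p' n') :
    0 < χ.slope i p.1.1 n * χ.slope i p'.1.1 n' := by
  obtain ⟨σ, hσ⟩ := exists_sign_slope o χ hi
  have h := mul_pos (hσ p hp n hn) (hσ p' hp' n' hn')
  rcases Int.units_eq_one_or σ with rfl | rfl <;> simpa using h

section Rules

variable {X : Type u} {Y : Type v} [SymmetricQuandle X] [MulAction (SymAssocGroup X)ᵐᵒᵖ Y]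
  {a : D.Assignment X Y}

/-- Halving the third coordinate gives a chart of the double curve where sheet `i` passes over sheet
`m`; the normals are coherent, so the over rule gives equal colors. -/
theorem color_chartFace_flip_of_lt (hN : ∀ p, o.IsNormal p (a.normal p))
    (χ : CrossingChart D.F k q) (s : Fin 3 → ℤˣ) {i m : Fin 3} (him : i < m) (hi : (i : ℕ) < k)
    (hm : (m : ℕ) < k) : a.color (D.semiSheetOf (chartFace χ s hi)) =
      a.color (D.semiSheetOf (chartFace χ (flip s m) hi)) := by
  obtain ⟨π, rfl, rfl⟩ := exists_perm_of_ne i m him.ne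
  have hmono : ∀ l l' : Fin 3, l < l' → (l' : ℕ) < 2 → π l < π l' := by
    intro l l' h h'
    have h1 : l = 0 := by omega
    have h2 : l' = 1 := by omega
    rw [h1, h2]; exact him
  have hlt : ∀ l : Fin 3, (l : ℕ) < 2 → (π l : ℕ) < k := by
    intro l hl
    have h1 : l = 0 ∨ l = 1 := by omega
    rcases h1 with rfl | rfl
    · exact hi
    · exact hm
  have hthird : ∀ l : Fin 3, ¬ (l : ℕ) < 2 → π l ≠ π 0 ∧ π l ≠ π 1 := by
    intro l hl
    simp only [Ne, π.injective.eq_iff]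
    omega
  have on1 : (χ.sub π 2 s hmono hlt).OnSheet 0 (chartFace χ s hi) :=
    χ.sub_onSheet hmono hlt (by simp) (χ.face_mem_sub_source hmono hlt fun l hl =>
      ⟨(hthird l hl).1, rfl⟩) (χ.onSheet_face s (π 0))
  have on2 : (χ.sub π 2 s hmono hlt).OnSheet 0 (chartFace χ (flip s (π 1)) hi) :=
    χ.sub_onSheet hmono hlt (by simp) (χ.face_mem_sub_source hmono hlt fun l hl =>
      ⟨(hthird l hl).1, flip_ne s (hthird l hl).2⟩) (χ.onSheet_face _ (π 0))
  refine (a.over_rule _ (χ.sub π 2 s hmono hlt) (chartFace χ s hi)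
    (chartFace χ (flip s (π 1)) hi) on1 on2 ?_ ?_).1
    (slope_mul_slope_pos _ (by simp) on1 on2 (hN _) (hN _))
  · rw [χ.sub_φ, if_pos (by simp)]
    change _ * χ.φ (χ.lift (π 0) _).1 (π 1) < 0
    rw [χ.φ_face, facePos_ne _ him.ne', units_mul_neg_half]
    norm_num
  · rw [χ.sub_φ, if_pos (by simp)]
    change 0 < _ * χ.φ (χ.lift (π 0) _).1 (π 1)
    rw [χ.φ_face, facePos_ne _ him.ne', flip_self, units_mul_neg_half_neg]
    norm_num

/-- Now sheet `i` passes under sheet `m`. By `hs` the over-normal points out of the octant `s`, that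
is, from the face for `s` to the face for `flip s m`, which fixes the direction of the action. -/
theorem color_chartFace_flip_of_gt (hN : ∀ p, o.IsNormal p (a.normal p))
    (χ : CrossingChart D.F k q) (s : Fin 3 → ℤˣ) {i m : Fin 3} (him : m < i) (hi : (i : ℕ) < k)
    (hm : (m : ℕ) < k)
    (hs : 0 < ((s m : ℤ) : ℝ) * χ.slope m (chartFace χ s hm).1.1 (a.normal (chartFace χ s hm))) :
    a.color (D.semiSheetOf (chartFace χ s hm)) ◃ a.color (D.semiSheetOf (chartFace χ s hi)) =
      a.color (D.semiSheetOf (chartFace χ (flip s m) hi)) := by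
  obtain ⟨π, rfl, rfl⟩ := exists_perm_of_ne m i him.ne
  have hmono : ∀ l l' : Fin 3, l < l' → (l' : ℕ) < 2 → π l < π l' := by
    intro l l' h h'
    have h1 : l = 0 := by omega
    have h2 : l' = 1 := by omega
    rw [h1, h2]; exact him
  have hlt : ∀ l : Fin 3, (l : ℕ) < 2 → (π l : ℕ) < k := by
    intro l hl
    have h1 : l = 0 ∨ l = 1 := by omega
    rcases h1 with rfl | rfl
    · exact hm
    · exact hi
  have hthird : ∀ l : Fin 3, ¬ (l : ℕ) < 2 → π l ≠ π 0 ∧ π l ≠ π 1 := by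
    intro l hl
    simp only [Ne, π.injective.eq_iff]
    omega
  have on0 : (χ.sub π 2 s hmono hlt).OnSheet 0 (chartFace χ s hm) :=
    χ.sub_onSheet hmono hlt (by simp) (χ.face_mem_sub_source hmono hlt fun l hl =>
      ⟨(hthird l hl).1, rfl⟩) (χ.onSheet_face s (π 0))
  have on1 : (χ.sub π 2 s hmono hlt).OnSheet 1 (chartFace χ s hi) :=
    χ.sub_onSheet hmono hlt (by simp) (χ.face_mem_sub_source hmono hlt fun l hl =>
      ⟨(hthird l hl).2, rfl⟩) (χ.onSheet_face s (π 1))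
  have on2 : (χ.sub π 2 s hmono hlt).OnSheet 1 (chartFace χ (flip s (π 0)) hi) :=
    χ.sub_onSheet hmono hlt (by simp) (χ.face_mem_sub_source hmono hlt fun l hl =>
      ⟨(hthird l hl).2, flip_ne s (hthird l hl).1⟩) (χ.onSheet_face _ (π 1))
  refine (a.under_rule _ (χ.sub π 2 s hmono hlt) (chartFace χ s hi)
    (chartFace χ (flip s (π 0)) hi) (chartFace χ s hm) on1 on2 on0 ?_ ?_ ?_).1
    (slope_mul_slope_pos _ (by simp) on1 on2 (hN _) (hN _))
  · rw [χ.sub_φ, if_pos (by simp)]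
    change _ * χ.φ (χ.lift (π 1) _).1 (π 0) < 0
    rw [χ.φ_face, facePos_ne _ him.ne, units_mul_neg_half]
    norm_num
  · rw [χ.sub_φ, if_pos (by simp)]
    change 0 < _ * χ.φ (χ.lift (π 1) _).1 (π 0)
    rw [χ.φ_face, facePos_ne _ him.ne, flip_self, units_mul_neg_half_neg]
    norm_num
  · rw [χ.sub_slope hmono hlt on0.1 (l := 0) (by simp)]
    exact hs

/-- Halving both other coordinates leaves sheet `m` alone in the smaller chart, with the two corners
on its two sides. -/
theorem region_corner_flip (χ : CrossingChart D.F k q) (s : Fin 3 → ℤˣ) {m : Fin 3}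
    (hm : (m : ℕ) < k)
    (hs : 0 < ((s m : ℤ) : ℝ) * χ.slope m (chartFace χ s hm).1.1 (a.normal (chartFace χ s hm)))
    (hc : χ.φ.symm (cornerPos s) ∈ D.regions)
    (hc' : χ.φ.symm (cornerPos (flip s m)) ∈ D.regions) :
    xact (a.region (D.regionOf ⟨_, hc⟩)) (a.color (D.semiSheetOf (chartFace χ s hm))) =
      a.region (D.regionOf ⟨_, hc'⟩) := by
  obtain ⟨π, rfl⟩ : ∃ π : Equiv.Perm (Fin 3), π 0 = m := ⟨Equiv.swap 0 m, by simp⟩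
  have hmono : ∀ l l' : Fin 3, l < l' → (l' : ℕ) < 1 → π l < π l' := by
    intro l l' h h'
    omega
  have hlt : ∀ l : Fin 3, (l : ℕ) < 1 → (π l : ℕ) < k := by
    intro l hl
    have h1 : l = 0 := by omega
    rw [h1]; exact hm
  have hother : ∀ l : Fin 3, ¬ (l : ℕ) < 1 → π l ≠ π 0 := by
    intro l hl
    simp only [Ne, π.injective.eq_iff]
    omega
  have on0 : (χ.sub π 1 s hmono hlt).OnSheet 0 (chartFace χ s hm) :=
    χ.sub_onSheet hmono hlt (by simp) (χ.face_mem_sub_source hmono hlt fun l hl =>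
      ⟨hother l hl, rfl⟩) (χ.onSheet_face s (π 0))
  refine a.side_rule _ (χ.sub π 1 s hmono hlt) ⟨_, hc⟩ ⟨_, hc'⟩ (chartFace χ s hm)
    (χ.corner_mem_sub_source hmono hlt fun l _ => rfl)
    (χ.corner_mem_sub_source hmono hlt fun l hl => flip_ne s (hother l hl)) on0 ?_ ?_ ?_
  · rw [χ.sub_φ, if_pos (by simp), χ.φ.right_inv (χ.cornerPos_mem s)]
    change _ * (-((s (π 0) : ℤ) : ℝ) / 2) < 0
    rw [units_mul_neg_half]
    norm_num
  · rw [χ.sub_φ, if_pos (by simp), χ.φ.right_inv (χ.cornerPos_mem _)]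
    change 0 < _ * (-((flip s (π 0) (π 0) : ℤ) : ℝ) / 2)
    rw [flip_self, units_mul_neg_half_neg]
    norm_num
  · rw [χ.sub_slope hmono hlt on0.1 (l := 0) (by simp)]
    exact hs

theorem color_top_eq_flip (hN : ∀ p, o.IsNormal p (a.normal p)) (χ : CrossingChart D.F k q)
    (hk : 0 < k) (s : Fin 3 → ℤˣ) (m : Fin 3) :
    a.color (D.semiSheetOf (chartFace χ s (i := 0) hk)) =
      a.color (D.semiSheetOf (chartFace χ (flip s m) (i := 0) hk)) := by
  by_cases hm0 : m = 0
  · have : chartFace χ (flip s m) (i := 0) hk = chartFace χ s (i := 0) hk := by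
      subst hm0
      exact Subtype.ext (congrArg (χ.lift 0) (facePos_flip_self s 0))
    rw [this]
  by_cases hm : (m : ℕ) < k
  · exact color_chartFace_flip_of_lt hN χ s (Fin.pos_of_ne_zero hm0) hk hm
  -- For `m ≥ k` no sheet of the chart is crossed, so both points lie in the same sector.
  · congr 1
    refine semiSheetOf_eq_of_mem_sector χ (flip s m) hk (χ.onSheet_face s 0) ?_
    change χ.φ (χ.lift 0 (facePos s 0)).1 ∈ _
    rw [χ.φ_face]
    have h := χ.facePos_mem_sector s 0
    refine ⟨h.1, h.2.1, fun j hj hj0 => ?_⟩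
    have hjm : j ≠ m := fun e => hm (e ▸ hj)
    rw [flip_ne s hjm]
    exact h.2.2 j hj hj0

theorem update_eq_self_or_flip (s : Fin 3 → ℤˣ) (m : Fin 3) (e : ℤˣ) :
    Function.update s m e = s ∨ Function.update s m e = flip s m := by
  by_cases h : e = s m
  · left; rw [h, Function.update_eq_self]
  · right; rw [flip, Int.units_ne_iff_eq_neg.mp h]

/-- Any octant is reached from any other by adjusting the three signs one at a time. -/
theorem update_three (s σ : Fin 3 → ℤˣ) :
    Function.update (Function.update (Function.update s 0 (σ 0)) 1 (σ 1)) 2 (σ 2) = σ := by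
  ext j
  fin_cases j <;> rfl

theorem color_top_eq (hN : ∀ p, o.IsNormal p (a.normal p)) (χ : CrossingChart D.F k q)
    (hk : 0 < k) (s s' : Fin 3 → ℤˣ) :
    a.color (D.semiSheetOf (chartFace χ s (i := 0) hk)) =
      a.color (D.semiSheetOf (chartFace χ s' (i := 0) hk)) := by
  have step : ∀ (s : Fin 3 → ℤˣ) (m : Fin 3) (e : ℤˣ),
      a.color (D.semiSheetOf (chartFace χ s (i := 0) hk)) =
        a.color (D.semiSheetOf (chartFace χ (Function.update s m e) (i := 0) hk)) := by
    intro s m e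
    rcases update_eq_self_or_flip s m e with h | h
    · rw [h]
    · rw [h]; exact color_top_eq_flip hN χ hk s m
  rw [step s 0 (s' 0), step _ 1 (s' 1), step _ 2 (s' 2), update_three]

theorem color_eq_of_onSheet_zero (hN : ∀ p, o.IsNormal p (a.normal p))
    (χ : CrossingChart D.F k q) (hk : 0 < k) {e : D.semiSheets} (he : χ.OnSheet 0 e) :
    a.color (D.semiSheetOf e) = a.color (D.semiSheetOf (chartFace χ 1 (i := 0) hk)) := by
  -- The signs are chosen so that `e` lies in the sector `s`; the octant `1` serves as a common
  -- reference.
  let s : Fin 3 → ℤˣ := fun j => if χ.φ e.1.1 j < 0 then 1 else -1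
  rw [semiSheetOf_eq_of_mem_sector χ s hk he, color_top_eq hN χ hk s 1]
  refine ⟨he.φ_mem, he.2.1, fun j hj hj0 => ?_⟩
  have hne := coord_ne_zero_of_mem_semiSheets he hk e.2 hj hj0
  simp only [s]
  split_ifs with h
  · simpa using h
  · simpa using lt_of_le_of_ne (not_lt.mp h) hne.symm

/-- The color is constant along the top sheet of each chart, and the semi-sheets are dense in the
sheets, so the colors factor through the components of the latter. -/
theorem exists_sheetColor (hN : ∀ p, o.IsNormal p (a.normal p)) :
    ∃ g : D.Sheet → X, ∀ e, g (D.sheetOf e) = a.color (D.semiSheetOf e) := by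
  refine exists_connectedComponents_extension D.semiSheets_subset sheets_subset_closure
    (fun e => a.color (D.semiSheetOf e)) fun p hp => ?_
  obtain ⟨k, χ, hk, h⟩ := exists_chart_of_mem_sheets hp
  exact ⟨χ.offOthers 0, χ.isOpen_offOthers 0, h.mem_offOthers hk, _, fun e he =>
    color_eq_of_onSheet_zero hN χ hk (χ.onSheet_of_mem_offOthers e.2.1 he)⟩

end Rules

/-! ### Canonical forms and colorings of the oriented diagram -/

section Correspondence

variable {X : Type u} {Y : Type v} [Quandle X] [MulAction (AssocGroup X)ᵐᵒᵖ Y]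

/-- The assignment and the coloring have the same colors and labels. -/
def Corresponds (a : D.Assignment (Double X) Y) (C : D.Coloring o X Y) : Prop :=
  a.region = C.region ∧ ∀ e, a.color (D.semiSheetOf e) = ⟨C.color (D.sheetOf e), 1⟩

theorem exists_corresponds_coloring {a : D.Assignment (Double X) Y}
    (hN : ∀ p, o.IsNormal p (a.normal p)) (ha : ∀ σ, (a.color σ).sign = 1) :
    ∃ C : D.Coloring o X Y, Corresponds a C := by
  obtain ⟨g, hg⟩ := exists_sheetColor hN
  have hcol : ∀ e, a.color (D.semiSheetOf e) = ⟨(g (D.sheetOf e)).val, 1⟩ := fun e => by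
    rw [hg]; exact Double.ext rfl (ha _)
  refine ⟨⟨fun σ => (g σ).val, a.region, ?_, ?_⟩, rfl, hcol⟩
  · intro q χ b c e n hb hc he hb0 hc0 hn hs
    -- The rule has to hold for every `n` that is normal for `o`; at the same point `n` and the
    -- normal of `a` lie on the same side.
    have hs' : 0 < χ.slope 0 e.1.1 (a.normal e) :=
      (pos_iff_pos_of_mul_pos (slope_mul_slope_pos χ (by simp) he he hn (hN e))).mp hs
    have h := (a.under_rule q χ b c e hb hc he hb0 hc0 hs').1
      (slope_mul_slope_pos χ (by simp) hb hc (hN b) (hN c))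
    rw [hcol, hcol, hcol] at h
    have h' := congrArg Double.val h
    change powAct _ _ 1 = _ at h'
    rwa [powAct_one] at h'
  · intro q χ c c' e n hc hc' he hc0 hc0' hn hs
    have hs' : 0 < χ.slope 0 e.1.1 (a.normal e) :=
      (pos_iff_pos_of_mul_pos (slope_mul_slope_pos χ (by simp) he he hn (hN e))).mp hs
    have h := a.side_rule q χ c c' e hc hc' he hc0 hc0' hs'
    rwa [hcol, xact_double_one] at h

/-- The continuous normal field is taken from `a₀`, and the colors are pulled back along the map
from semi-sheets to sheets. The incoherent clauses are vacuous, because these normals come from `o`.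
-/
theorem exists_corresponds_assignment {a₀ : D.Assignment (Double X) Y}
    (hN : ∀ p, o.IsNormal p (a₀.normal p)) (C : D.Coloring o X Y) :
    ∃ a : D.Assignment (Double X) Y, a.normal = a₀.normal ∧ Corresponds a C := by
  have hι : Continuous (Set.inclusion D.semiSheets_subset) :=
    continuous_inclusion D.semiSheets_subset
  refine ⟨⟨a₀.normal, a₀.continuous_normal, a₀.isUnitNormal,
    fun σ => ⟨C.color (hι.connectedComponentsMap σ), 1⟩, C.region, ?_, ?_, ?_⟩, rfl, rfl,
    fun e => rfl⟩
  · intro q χ b c hb hc _ _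
    have hsl := slope_mul_slope_pos χ (by simp) hb hc (hN b) (hN c)
    refine ⟨fun _ => ?_, fun h => absurd hsl (not_lt.mpr h.le)⟩
    have h : D.sheetOf b = D.sheetOf c := sheetOf_eq_of_onSheet_zero χ (by simp)
      (p := ⟨b.1, D.semiSheets_subset b.2⟩) (p' := ⟨c.1, D.semiSheets_subset c.2⟩) hb hc
    change (⟨C.color (D.sheetOf b), 1⟩ : Double X) = ⟨C.color (D.sheetOf c), 1⟩
    rw [h]
  · intro q χ b c e hb hc he hb0 hc0 hs
    have hsl := slope_mul_slope_pos χ (by simp) hb hc (hN b) (hN c)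
    refine ⟨fun _ => ?_, fun h => absurd hsl (not_lt.mpr h.le)⟩
    refine Double.ext ?_ rfl
    change powAct (C.color (D.sheetOf b)) (C.color (D.sheetOf e)) 1 = C.color (D.sheetOf c)
    rw [powAct_one]
    exact C.crossing_rule q χ b c e _ hb hc he hb0 hc0 (hN e) hs
  · intro q χ c c' e hc hc' he hc0 hc0' hs
    change xact _ (⟨C.color (D.sheetOf e), 1⟩ : Double X) = _
    rw [xact_double_one]
    exact C.side_rule q χ c c' e _ hc hc' he hc0 hc0' (hN e) hs

theorem Corresponds.coloring_unique {a : D.Assignment (Double X) Y} {C C' : D.Coloring o X Y}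
    (h : Corresponds a C) (h' : Corresponds a C') : C = C' := by
  have hr : C.region = C'.region := h.1.symm.trans h'.1
  have hc : C.color = C'.color := by
    funext σ
    obtain ⟨e, rfl⟩ := exists_sheetOf_eq σ
    exact congrArg Double.val ((h.2 e).symm.trans (h'.2 e))
  cases C; cases C'
  simp only at hr hc
  subst hr hc
  rfl

theorem Corresponds.assignment_unique {a a' : D.Assignment (Double X) Y} {C : D.Coloring o X Y}
    (h : Corresponds a C) (h' : Corresponds a' C) (hn : a.normal = a'.normal) : a = a' := by
  have hr : a.region = a'.region := h.1.trans h'.1.symm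
  have hc : a.color = a'.color := by
    funext σ
    obtain ⟨e, rfl⟩ := ConnectedComponents.surjective_coe σ
    exact (h.2 e).trans (h'.2 e).symm
  cases a; cases a'
  simp only at hr hc hn
  subst hr hc hn
  rfl

theorem Corresponds.sign_eq_one {a : D.Assignment (Double X) Y} {C : D.Coloring o X Y}
    (h : Corresponds a C) (σ : D.SemiSheet) : (a.color σ).sign = 1 := by
  obtain ⟨e, rfl⟩ := ConnectedComponents.surjective_coe σ
  exact congrArg Double.sign (h.2 e)

/-- Two representatives that differ by an inversion on a semi-sheet have colors of opposite sign
there, so they cannot both be positive. -/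
theorem IsCanonicalForm.unique {C : D.SymColoring (Double X) Y} {a a' : D.Assignment (Double X) Y}
    (h : IsCanonicalForm C a) (h' : IsCanonicalForm C a') : a = a' := by
  have hrel : (D.assignmentSetoid (Double X) Y).r a a' := Quotient.exact (h.1.trans h'.1.symm)
  have key : ∀ σ : D.SemiSheet, (∀ p, D.semiSheetOf p = σ → a.normal p = a'.normal p) ∧
      a.color σ = a'.color σ := by
    intro σ
    refine (hrel.2 σ).resolve_right fun hneg => ?_
    have h1 : (a.color σ).sign = -(a'.color σ).sign := congrArg Double.sign hneg.2
    rw [h.2, h'.2] at h1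
    exact absurd h1 (by decide)
  have hr : a.region = a'.region := hrel.1
  have hn : a.normal = a'.normal := funext fun p => (key _).1 p rfl
  have hc : a.color = a'.color := funext fun σ => (key σ).2
  cases a; cases a'
  simp only at hr hc hn
  subst hr hc hn
  rfl

end Correspondence

end Diagram

/-! ### Weights -/

theorem flip_flip (s : Fin 3 → ℤˣ) (m : Fin 3) : flip (flip s m) m = s := by
  funext j
  by_cases h : j = m
  · rw [h, flip_self, flip_self, neg_neg]
  · rw [flip_ne _ h, flip_ne _ h]

theorem CubeChart.slope_neg {q : E3} (χ : CubeChart q) (i : Fin 3) (x n : E3) :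
    χ.slope i x (-n) = -χ.slope i x n := by
  simp [CubeChart.slope]

namespace Diagram

variable {D : Diagram} {o : D.Orientation}

theorem TriplePoint.sign_flip (t : D.TriplePoint) (s : Fin 3 → ℤˣ) (m : Fin 3) :
    t.sign (flip s m) = -t.sign s := by
  have h : ∏ i, (flip s m i : ℤ) = -∏ i, (s i : ℤ) := by
    rw [← Finset.mul_prod_erase _ _ (Finset.mem_univ m),
      ← Finset.mul_prod_erase (a := m) _ (fun j => (s j : ℤ)) (Finset.mem_univ m), flip_self,
      Finset.prod_congr rfl (fun j hj => by rw [flip_ne s (Finset.ne_of_mem_erase hj)])]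
    simp
  rw [TriplePoint.sign, TriplePoint.sign, h, mul_neg]

theorem TriplePoint.facePt_flip_self (t : D.TriplePoint) (s : Fin 3 → ℤˣ) (m : Fin 3) :
    t.facePt (flip s m) m = t.facePt s m :=
  Subtype.ext (congrArg (t.chart.lift m) (facePos_flip_self s m))

section SymWeight

variable {X : Type u} {Y : Type v} [SymmetricQuandle X] [MulAction (SymAssocGroup X)ᵐᵒᵖ Y]
  {a : D.Assignment X Y}

theorem faceColor_of_pos {t : D.TriplePoint} {s : Fin 3 → ℤˣ} {i : Fin 3}
    (h : 0 < ((s i : ℤ) : ℝ) * t.chart.slope i (t.face s i).1 (a.normal (t.facePt s i))) :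
    a.faceColor t s i = a.color (D.semiSheetOf (t.facePt s i)) := if_pos h

theorem faceColor_of_neg {t : D.TriplePoint} {s : Fin 3 → ℤˣ} {i : Fin 3}
    (h : ((s i : ℤ) : ℝ) * t.chart.slope i (t.face s i).1 (a.normal (t.facePt s i)) < 0) :
    a.faceColor t s i = ρ (a.color (D.semiSheetOf (t.facePt s i))) := if_neg (not_lt.mpr h.le)

theorem onSheet_facePt (t : D.TriplePoint) (s : Fin 3 → ℤˣ) (i : Fin 3) :
    t.chart.OnSheet i (t.facePt s i) := t.chart.onSheet_face s i

theorem signed_slope_ne_zero (t : D.TriplePoint) (s : Fin 3 → ℤˣ) (i : Fin 3) {n : E3}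
    (hn : o.IsNormal (t.facePt s i) n) :
    ((s i : ℤ) : ℝ) * t.chart.slope i (t.face s i).1 n ≠ 0 := by
  have h := slope_mul_slope_pos t.chart i.2 (onSheet_facePt t s i) (onSheet_facePt t s i) hn hn
  exact mul_ne_zero (by exact_mod_cast (s i).ne_zero) (left_ne_zero_of_mul h.ne')

/-- An inversion reverses the normal and applies `ρ` simultaneously, so the color belonging to the
outward normal is unaffected. The slope must not be zero, since `faceColor` applies `ρ` in that case
whichever way the normal is chosen. -/
theorem faceColor_eq_of_equiv {b : D.Assignment X Y} (hN : ∀ p, o.IsNormal p (a.normal p))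
    (hab : (D.assignmentSetoid X Y).r b a) (t : D.TriplePoint) (s : Fin 3 → ℤˣ) (i : Fin 3) :
    b.faceColor t s i = a.faceColor t s i := by
  rcases hab.2 (D.semiSheetOf (t.facePt s i)) with ⟨h1, h2⟩ | ⟨h1, h2⟩
  · simp only [Assignment.faceColor, h1 _ rfl, h2]
  · rcases lt_or_gt_of_ne (signed_slope_ne_zero t s i (hN (t.facePt s i))) with h | h
    · rw [faceColor_of_neg h, faceColor_of_pos, h2]
      rw [h1 _ rfl, CubeChart.slope_neg, mul_neg]
      exact neg_pos.mpr h
    · rw [faceColor_of_pos h, faceColor_of_neg, h2, SymmetricQuandle.ρ_ρ]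
      rw [h1 _ rfl, CubeChart.slope_neg, mul_neg]
      exact neg_neg_of_pos h

theorem weight_eq_of_equiv {b : D.Assignment X Y} (hN : ∀ p, o.IsNormal p (a.normal p))
    (hab : (D.assignmentSetoid X Y).r b a) (t : D.TriplePoint) (s : Fin 3 → ℤˣ) :
    b.weight t s = a.weight t s := by
  simp only [Assignment.weight, hab.1, faceColor_eq_of_equiv hN hab]

theorem signed_slope_pos_iff (hN : ∀ p, o.IsNormal p (a.normal p)) (t : D.TriplePoint)
    (s s' : Fin 3 → ℤˣ) {i : Fin 3} (e : ℤˣ) :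
    0 < ((e : ℤ) : ℝ) * t.chart.slope i (t.face s i).1 (a.normal (t.facePt s i)) ↔
      0 < ((e : ℤ) : ℝ) * t.chart.slope i (t.face s' i).1 (a.normal (t.facePt s' i)) := by
  have hsl := slope_mul_slope_pos t.chart i.2 (onSheet_facePt t s i) (onSheet_facePt t s' i)
    (hN _) (hN _)
  refine pos_iff_pos_of_mul_pos ?_
  rcases Int.units_eq_one_or e with rfl | rfl <;> simpa [TriplePoint.facePt] using hsl

theorem faceColor_flip_of_lt (hN : ∀ p, o.IsNormal p (a.normal p)) (t : D.TriplePoint)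
    (s : Fin 3 → ℤˣ) {i m : Fin 3} (him : i < m) :
    a.faceColor t (flip s m) i = a.faceColor t s i := by
  have hc : a.color (D.semiSheetOf (t.facePt s i)) =
      a.color (D.semiSheetOf (t.facePt (flip s m) i)) :=
    color_chartFace_flip_of_lt hN t.chart s him i.2 m.2
  simp only [Assignment.faceColor, flip_ne s him.ne, signed_slope_pos_iff hN t (flip s m) s, hc]

theorem faceColor_flip_of_gt (hN : ∀ p, o.IsNormal p (a.normal p)) (t : D.TriplePoint)
    (s : Fin 3 → ℤˣ) {i m : Fin 3} (him : m < i)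
    (hs : 0 < ((s m : ℤ) : ℝ) * t.chart.slope m (t.face s m).1 (a.normal (t.facePt s m))) :
    a.faceColor t (flip s m) i = a.faceColor t s m ◃ a.faceColor t s i := by
  have hc : a.color (D.semiSheetOf (t.facePt s m)) ◃ a.color (D.semiSheetOf (t.facePt s i)) =
      a.color (D.semiSheetOf (t.facePt (flip s m) i)) :=
    color_chartFace_flip_of_gt hN t.chart s him i.2 m.2 hs
  rw [faceColor_of_pos hs]
  simp only [Assignment.faceColor, flip_ne s him.ne', signed_slope_pos_iff hN t (flip s m) s, ← hc]
  split_ifs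
  · rfl
  · exact SymmetricQuandle.ρ_act _ _

theorem faceColor_flip_self (t : D.TriplePoint) (s : Fin 3 → ℤˣ) {m : Fin 3}
    (hs : 0 < ((s m : ℤ) : ℝ) * t.chart.slope m (t.face s m).1 (a.normal (t.facePt s m))) :
    a.faceColor t (flip s m) m = ρ (a.faceColor t s m) := by
  have hf : t.face (flip s m) m = t.face s m := congrArg Subtype.val (t.facePt_flip_self s m)
  rw [faceColor_of_pos hs, faceColor_of_neg, t.facePt_flip_self]
  rw [hf, t.facePt_flip_self, flip_self]
  simpa using hs

/-- The tuple changes by `invert m.rev` and the sign by `-1`; the two changes cancel modulo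
`symDegen`. -/
theorem weight_flip (hN : ∀ p, o.IsNormal p (a.normal p)) (t : D.TriplePoint)
    (s : Fin 3 → ℤˣ) {m : Fin 3}
    (hs : 0 < ((s m : ℤ) : ℝ) * t.chart.slope m (t.face s m).1 (a.normal (t.facePt s m))) :
    a.weight t (flip s m) = a.weight t s := by
  let z : Tup X Y 3 := (a.region (t.octant s), fun j => a.faceColor t s j.rev)
  -- Charts number the sheets from top to bottom, tuples from bottom to top. The entries before
  -- `m.rev` thus belong to the sheets below sheet `m`, on which its color acts.
  have hz : ((a.region (t.octant (flip s m)), fun j => a.faceColor t (flip s m) j.rev) :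
      Tup X Y 3) = invert m.rev z := by
    refine Prod.ext ?_ (funext fun j => ?_)
    · simp only [invert, z, Fin.rev_rev, faceColor_of_pos hs]
      exact (region_corner_flip t.chart s m.2 hs (t.corner_mem s) (t.corner_mem _)).symm
    · simp only [invert, z, Fin.rev_rev]
      rcases lt_trichotomy j m.rev with h | h | h
      · rw [if_pos h]
        exact faceColor_flip_of_gt hN t s (Fin.lt_rev_iff.mp h) hs
      · subst h
        rw [if_neg (lt_irrefl _), if_pos rfl, Fin.rev_rev]
        exact faceColor_flip_self t s hs
      · rw [if_neg (lt_asymm h), if_neg h.ne']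
        exact faceColor_flip_of_lt hN t s (Fin.rev_lt_iff.mp h)
  have hinv : (Submodule.Quotient.mk (Finsupp.single (invert m.rev z) 1) : SQChain X Y 3) =
      -Submodule.Quotient.mk (Finsupp.single z 1) := by
    rw [eq_neg_iff_add_eq_zero, add_comm, ← Submodule.Quotient.mk_add,
      Submodule.Quotient.mk_eq_zero]
    exact Submodule.mem_sup_right (Submodule.subset_span ⟨z, m.rev, rfl⟩)
  rw [Assignment.weight, hz, hinv, t.sign_flip, neg_smul_neg]
  rfl

theorem weight_eq_of_outward (hN : ∀ p, o.IsNormal p (a.normal p)) (t : D.TriplePoint)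
    (s σ : Fin 3 → ℤˣ) (hσ : ∀ (i : Fin 3) (s : Fin 3 → ℤˣ),
      0 < ((σ i : ℤ) : ℝ) * t.chart.slope i (t.face s i).1 (a.normal (t.facePt s i))) :
    a.weight t s = a.weight t σ := by
  have step : ∀ (s : Fin 3 → ℤˣ) (m : Fin 3),
      a.weight t s = a.weight t (Function.update s m (σ m)) := by
    intro s m
    rcases update_eq_self_or_flip s m (σ m) with h | h
    · rw [h]
    -- The normal points out of the new octant `flip s m`, so `weight_flip` is applied there and
    -- leads back to `s`.
    · have hm : flip s m m = σ m := by rw [← h, Function.update_self]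
      have := weight_flip hN t (flip s m) (m := m) (by rw [hm]; exact hσ m _)
      rwa [flip_flip, ← h] at this
  rw [step s 0, step _ 1, step _ 2, update_three]

end SymWeight

/-! ### Comparison of weight sums and of sets of colorings -/

section Transfer

variable {X : Type u} {Y : Type v} [Quandle X] [MulAction (AssocGroup X)ᵐᵒᵖ Y]
  {a : D.Assignment (Double X) Y}

/-- The sides to which the three normals point form the sign vector of such an octant; its existence
makes the choice by `Classical.epsilon` meaningful. -/
theorem TriplePoint.isSource_source (hN : ∀ p, o.IsNormal p (a.normal p)) (t : D.TriplePoint) :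
    t.IsSource o (t.source o) := by
  choose σ hσ using fun i : Fin 3 => exists_sign_slope o t.chart i.2
  exact Classical.epsilon_spec (p := t.IsSource o)
    ⟨σ, fun i => ⟨_, hN (t.facePt σ i), hσ i _ (onSheet_facePt t σ i) _ (hN _)⟩⟩

/-- At the source octant no inversion is needed: all three face colors are positive, and `T` merely
strips their signs. -/
theorem Corresponds.T_weight {C : D.Coloring o X Y} (h : Corresponds a C)
    (hN : ∀ p, o.IsNormal p (a.normal p)) (t : D.TriplePoint) (s : Fin 3 → ℤˣ) :
    T X Y 3 (a.weight t s) = C.weight t := by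
  have hσ : ∀ (i : Fin 3) (s : Fin 3 → ℤˣ), 0 < ((t.source o i : ℤ) : ℝ) *
      t.chart.slope i (t.face s i).1 (a.normal (t.facePt s i)) := by
    intro i s
    obtain ⟨n, hn, hpos⟩ := t.isSource_source hN i
    have hsl := slope_mul_slope_pos t.chart i.2 (onSheet_facePt t (t.source o) i)
      (onSheet_facePt t s i) hn (hN _)
    refine (pos_iff_pos_of_mul_pos ?_).mp hpos
    rcases Int.units_eq_one_or (t.source o i) with he | he <;> rw [he] <;>
      simpa [TriplePoint.facePt] using hsl
  have hcol : ∀ i, a.faceColor t (t.source o) i =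
      ⟨C.color (D.sheetOf (t.facePt (t.source o) i)), 1⟩ := fun i => by
    rw [faceColor_of_pos (hσ i _), h.2]
  rw [weight_eq_of_outward hN t s (t.source o) hσ, Assignment.weight, map_smul, T_single_pos,
    Coloring.weight, ← h.1]
  · simp only [strip, hcol]
  · intro i
    simp only [hcol]

theorem Corresponds.T_W {C : D.Coloring o X Y} (h : Corresponds a C)
    (hN : ∀ p, o.IsNormal p (a.normal p)) (s : D.TriplePoint → Fin 3 → ℤˣ)
    {C' : D.SymColoring (Double X) Y} (hC' : Quotient.mk _ a = C') :
    T X Y 3 (SymColoring.W s C') = C.W := by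
  have hout : (D.assignmentSetoid (Double X) Y).r (Quotient.out C') a :=
    Quotient.exact ((Quotient.out_eq C').trans hC'.symm)
  -- Injectivity of `T` lets it pass through `finsum` without finiteness of the set of triple
  -- points.
  have hmap := (T X Y 3).toAddMonoidHom.map_finsum_of_injective (T_bijective X Y 3).1
    fun t : D.TriplePoint => (Quotient.out C').weight t (s t)
  refine hmap.trans (finsum_congr fun t => ?_)
  -- The weight sum is defined by an arbitrary representative; here it is replaced by `a`.
  rw [weight_eq_of_equiv hN hout]
  exact h.T_weight hN t (s t)

/-- The colorings that induce the orientation `o` correspond to the colorings of `(D, o)`, and `T`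
carries the weight sums to each other. -/
theorem exists_equiv_oriClass {C : D.SymColoring (Double X) Y} (hC : Induces C o)
    (s : D.TriplePoint → Fin 3 → ℤˣ) :
    ∃ Φ : oriClass C ≃ D.Coloring o X Y, ∀ C', T X Y 3 (SymColoring.W s C'.1) = (Φ C').W := by
  obtain ⟨a₀, ha₀, hN₀⟩ := hC
  have hcan : ∀ C' : oriClass C, ∃ a, IsCanonicalForm C'.1 a ∧ a.normal = a₀.normal := by
    rintro ⟨C', b, b', hb, hb', hn⟩
    -- The canonical form `b` of `C` given by `OriEquiv` equals `a₀` by uniqueness, so the normals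
    -- are those of `a₀`.
    exact ⟨b', hb', by rw [← hn, hb.unique ha₀]⟩
  choose a ha han using hcan
  have hN : ∀ C' p, o.IsNormal p ((a C').normal p) := fun C' p => by rw [han]; exact hN₀ p
  choose Φ hΦ using fun C' => exists_corresponds_coloring (hN C') (ha C').2
  have hbij : Function.Bijective Φ := by
    constructor
    · intro C₁ C₂ h12
      have h1 := hΦ C₁
      rw [h12] at h1
      have h := h1.assignment_unique (hΦ C₂) ((han C₁).trans (han C₂).symm)
      refine Subtype.ext ?_
      rw [← (ha C₁).1, ← (ha C₂).1, h]
    · intro K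
      obtain ⟨b, hbn, hb⟩ := exists_corresponds_assignment hN₀ K
      have hcb : IsCanonicalForm (Quotient.mk _ b) b := ⟨rfl, hb.sign_eq_one⟩
      let C' : oriClass C := ⟨Quotient.mk _ b, a₀, b, ha₀, hcb, hbn.symm⟩
      have h := hΦ C'
      rw [(ha C').unique hcb] at h
      exact ⟨C', h.coloring_unique hb⟩
  exact ⟨Equiv.ofBijective Φ hbij, fun C' => (hΦ C').T_W (hN C') s (ha C').1⟩

end Transfer

end Diagram

end SurfaceLink

theorem mainTheorem10 {X : Type u} {Y : Type v} [Quandle X]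
    [MulAction (SurfaceLink.AssocGroup X)ᵐᵒᵖ Y] (D : SurfaceLink.Diagram) (o : D.Orientation)
    (C : D.SymColoring (SurfaceLink.Double X) Y) (hC : SurfaceLink.Diagram.Induces C o)
    (s : D.TriplePoint → Fin 3 → ℤˣ) :
    Function.Bijective (SurfaceLink.T3 X Y) ∧
      SurfaceLink.MultiSet.map (SurfaceLink.T3 X Y)
        (D.symHomologyInvariant s (SurfaceLink.Diagram.oriClass C)) =
      D.homologyInvariant o X Y := by
  have hT := SurfaceLink.T3_bijective X Y
  refine ⟨hT, funext fun h => ?_⟩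
  obtain ⟨h, rfl⟩ := hT.2 h
  rw [SurfaceLink.MultiSet.map_apply_of_bijective hT]
  obtain ⟨Φ, hΦ⟩ := SurfaceLink.Diagram.exists_equiv_oriClass hC s
  -- Both multiplicities count colorings with a prescribed class, so Φ only has to be restricted to
  -- the colorings whose weight sums represent corresponding classes.
  refine Cardinal.mk_congr ((Equiv.subtypeSubtypeEquivSubtypeInter
    (· ∈ SurfaceLink.Diagram.oriClass C) _).symm.trans (Φ.subtypeEquiv fun C' => ?_))
  rw [SurfaceLink.represents_T3_iff, hΦ]
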